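/- Let $\mathbb{T}=\mathbb{R}/2\pi\mathbb{Z}$ with normalized Lebesgue measure, $\hat f(k)=\frac1{2\pi}\int_0^{2\pi}f(x)e^{-ikx}\,dx$, and let $\mathcal H$ be the Hilbert transform, $\widehat{\mathcal H f}(k)=-i\,\mathrm{sgn}(k)\hat f(k)$. For $T\in(0,1]$, a smooth solution of the Benjamin–Ono equation on $[0,T]$ is a real-valued function $u\in C^\infty([0,T]\times\mathbb{T})$ with $\int_{\mathbb{T}}u(0,x)\,dx=0$ and $$\partial_t u+\mathcal H\partial_{xx}u=u\,\partial_x u .$$ For $N\in\{1,2,4,8,\dots\}$ let $P_N$ be the Fourier projection onto the frequencies $N\le|k|<2N$ if $N\ge2$, and onto $|k|<2$ if $N=1$. For an interval $I=[a,b)$, a $U^2(I)$-atom is a step function $\sum_{k=1}^K\phi_{k-1}\chi_{[t_{k-1},t_k)}$ with $a=t_0<\dots<t_K=b$, $\phi_k\in L^2(\mathbb{T};\mathbb{C})$ and $\sum_{k}\|\phi_k\|_{L^2}^2=1$; put $$\|f\|_{U^2(I)}=\inf\Big\{\sum_{n}|\lambda_n| : f(t)=\sum_{n}\lambda_n a_n(t)\text{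 for } t\in I,\ a_n\ U^2(I)\text{-atoms}\Big\},\qquad \|f\|_{U^2_{BO}(I)}=\|e^{t\mathcal H\partial_{xx}}f\|_{U^2(I)} .$$ Here $e^{t\mathcal H\partial_{xx}}$ has the Fourier multiplier $e^{itk|k|}$, that is, it is the inverse of the free evolution. For $\sigma\ge 0$ define $$\|u\|_{F^\sigma(T)}^2=\sum_{N}N^{2\sigma}\sup_{I\subseteq[0,T],\ |I|=\min(N^{-1},T)}\|P_Nu\|_{U^2_{BO}(I)}^2,\qquad \|u\|_{E^\sigma(T)}^2=\sum_{N}N^{2\sigma}\sup_{t\in[0,T]}\|P_Nu(t)\|_{L^2}^2,$$ and $\|f\|_{H^\sigma}^2=\sum_{k\in\mathbb Z}(1+k^2)^{\sigma}|\hat f(k)|^2$. Let $s>1$. There is a constant $C=C(s)$ such that for every $T\in(0,1]$ the following holds. (a) Every smooth solution $u$ of the Benjamin–Ono equation on $[0,T]$ satisfies $$\|u\|_{E^s(T)}^2\le C\big(\|u(0)\|_{H^s}^2+\|u\|_{F^s(T)}^3\big).$$ (b) If $u_1,u_2$ are smooth solutions of the Benjamin–Ono equation on $[0,T]$ and $v=u_1-u_2$,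 then $$\|v\|_{E^0(T)}^2\le C\big(\|v(0)\|_{L^2}^2+\|v\|_{F^0(T)}^2(\|u_1\|_{F^s(T)}+\|u_2\|_{F^s(T)})\big)$$ and $$\|v\|_{E^s(T)}^2\le C\big(\|v(0)\|_{H^s}^2+\|v\|_{F^s(T)}^3+\|v\|_{F^s(T)}^2\|u_2\|_{F^s(T)}+\|v\|_{F^0(T)}\|v\|_{F^s(T)}\|u_2\|_{F^{2s}(T)}\big).$$ -/

import Mathlib

open MeasureTheory Set
open scoped ENNReal NNReal Real

noncomputable section

namespace BenjaminOno

instance factTwoPiPos : Fact (0 < 2 * π) := ⟨Real.two_pi_pos⟩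

/-- The torus `ℝ / 2πℤ`, so that the frequencies are the integers. -/
abbrev Torus : Type := AddCircle (2 * π)

/-- The Hilbert space `L²(𝕋; ℂ)`, with respect to the normalized Haar measure. -/
abbrev L2Torus : Type := Lp ℂ 2 (AddCircle.haarAddCircle (T := 2 * π))

/-- The Fourier coefficient `(2π)⁻¹ ∫ f(x) e^{-ikx} dx` of a real-valued function. -/
def fhat (f : Torus → ℝ) (k : ℤ) : ℂ := fourierCoeff (fun x => (f x : ℂ)) k

/-- The derivative of a function on the torus. -/
def dx (f : Torus → ℝ) (x : Torus) : ℝ := deriv (fun h : ℝ => f (x + (h : Torus))) 0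

/-- The Hilbert transform, with Fourier multiplier `-i sgn k`. It is applied to smooth functions
only, for which the series converges absolutely. -/
def hilbertTransform (f : Torus → ℝ) (x : Torus) : ℂ :=
  ∑' k : ℤ, (-Complex.I * ((Int.sign k : ℤ) : ℂ)) * fhat f k * fourier k x

/-- `u` is a smooth real-valued solution with vanishing mean of the Benjamin-Ono equation
`∂ₜ u + H ∂ₓₓ u = u ∂ₓ u` on `[0, T] × 𝕋`. As `u` is smooth up to `t = 0` and `t = T`, it
suffices to ask for the equation in the interior. -/
structure IsSmoothSolution (T : ℝ) (u : ℝ → Torus → ℝ) : Prop where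
  smooth : ContDiffOn ℝ ((⊤ : ℕ∞) : WithTop ℕ∞)
    (fun p : ℝ × ℝ => u p.1 (p.2 : Torus)) (Icc 0 T ×ˢ univ)
  equation : ∀ t ∈ Ioo 0 T, ∀ x : Torus,
    ((deriv (fun τ => u τ x) t : ℝ) : ℂ) + hilbertTransform (dx (dx (u t))) x
      = ((u t x * dx (u t) x : ℝ) : ℂ)
  mean_zero : ∫ x, u 0 x ∂AddCircle.haarAddCircle = 0

/-- The frequencies of the dyadic block `N = 2 ^ j`: those with `N ≤ |k| < 2N` if `j ≥ 1`,
and those with `|k| < 2` if `j = 0`. -/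
def block (j : ℕ) : Finset ℤ :=
  (Finset.Ioo (-2 ^ (j + 1)) (2 ^ (j + 1))).filter fun k => j = 0 ∨ 2 ^ j ≤ |k|

/-- The Littlewood-Paley projection `P_N f`, `N = 2 ^ j`, as an element of `L²(𝕋)`. -/
def projBlock (j : ℕ) (f : Torus → ℝ) : L2Torus :=
  ∑ k ∈ block j, fhat f k • fourierLp 2 k

/-- `e^{-itφ(∇/i)} P_N f` for `N = 2 ^ j` and the Benjamin-Ono dispersion relation
`φ(ξ) = -ξ|ξ|`; that is, `P_N f` transported back along the free evolution `e^{-tH∂ₓₓ}`. -/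
def profileBlock (j : ℕ) (t : ℝ) (f : Torus → ℝ) : L2Torus :=
  ∑ k ∈ block j,
    (Complex.exp (Complex.I * (t : ℂ) * ((k * |k| : ℤ) : ℂ)) * fhat f k) • fourierLp 2 k

/-- `f` is a `U²([a, b); H)`-atom: `f = ∑ φ_{k-1} χ_{[t_{k-1}, t_k)}` for a partition
`a = t_0 < ⋯ < t_K = b` and vectors with `∑ ‖φ_k‖² = 1`. -/
def IsU2Atom {H : Type*} [NormedAddCommGroup H] (a b : ℝ) (f : ℝ → H) : Prop :=
  ∃ (K : ℕ) (τ : Fin (K + 1) → ℝ) (φ : Fin K → H),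
    StrictMono τ ∧ τ 0 = a ∧ τ (Fin.last K) = b ∧ ∑ k, ‖φ k‖ ^ 2 = 1 ∧
      ∀ t, f t = ∑ k, (Ico (τ k.castSucc) (τ k.succ)).indicator (fun _ => φ k) t

/-- The `U²([a, b); H)`-norm: the infimum of `∑ |λ_n|` over all representations
`f = ∑ λ_n a_n` on `[a, b)` by atoms, with value `∞` if there is none. -/
def u2Norm {H : Type*} [NormedAddCommGroup H] [NormedSpace ℂ H] (a b : ℝ) (f : ℝ → H) : ℝ≥0∞ :=
  ⨅ (c : ℕ → ℂ) (A : ℕ → ℝ → H) (_ : ∀ n, IsU2Atom a b (A n))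
    (_ : ∀ t ∈ Ico a b, HasSum (fun n => c n • A n t) (f t)), ∑' n, ‖c n‖ₑ

/-- The length `min(N⁻¹, T)` of the time windows for the block `N = 2 ^ j` inside `[0, T]`. -/
def windowLength (T : ℝ) (j : ℕ) : ℝ := min ((2 : ℝ) ^ j)⁻¹ T

/-- The short-time norm `F^s(T)`. -/
def FNorm (s T : ℝ) (u : ℝ → Torus → ℝ) : ℝ≥0∞ :=
  (∑' j : ℕ, ((2 : ℝ≥0∞) ^ j) ^ (2 * s) *
    ⨆ (a : ℝ) (_ : 0 ≤ a) (_ : a + windowLength T j ≤ T),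
      u2Norm a (a + windowLength T j) (fun t => profileBlock j t (u t)) ^ 2) ^ (1 / 2 : ℝ)

/-- The energy norm `E^s(T)`. -/
def ENorm (s T : ℝ) (u : ℝ → Torus → ℝ) : ℝ≥0∞ :=
  (∑' j : ℕ, ((2 : ℝ≥0∞) ^ j) ^ (2 * s) *
    ⨆ t ∈ Icc 0 T, ‖projBlock j (u t)‖ₑ ^ 2) ^ (1 / 2 : ℝ)

/-- The Sobolev norm `H^s(𝕋)`. -/
def HNorm (s : ℝ) (f : Torus → ℝ) : ℝ≥0∞ :=
  (∑' k : ℤ, ENNReal.ofReal ((1 + (k : ℝ) ^ 2) ^ s) * ‖fhat f k‖ₑ ^ 2) ^ (1 / 2 : ℝ)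

/-- The norm of `L²(𝕋)`. -/
def L2Norm (f : Torus → ℝ) : ℝ≥0∞ := eLpNorm f 2 AddCircle.haarAddCircle

end BenjaminOno

end

/-!
The proof is an energy estimate for each dyadic block, carried out on the Fourier coefficients.

Write `v` for the difference of two solutions `u₁` and `u₂`; it is transported by `w = u₁ + u₂`.
For a Lipschitz cutoff `φ` to frequencies of size `N = 2 ^ j`, the growth of `∑ φ(k) |v̂(k)|²` up to
time `t₀` is the time integral of a trilinear form in `v, v, w` with symbol `k₁ φ(k₁)`, where
`k₁ + k₂ + k₃ = 0`. The form may be symmetrized in `k₁, k₂`, and in all three frequencies on the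
part of `w` equal to `v`. Since `k φ(k)` is odd and Lipschitz uniformly in `N`, this moves the
derivative to the third frequency, respectively to the lowest one.

The time integral is estimated on windows of length `1/N`, where `N` is the highest frequency. For
free solutions, the phase of a product at frequencies `k₁, k₂` with fixed `k₁ + k₂` has derivative
`2(|k₁| - |k₂|)` in `k₁`, so the phases are separated by multiples of `N` if `|k₁|` and `|k₂|`
differ by at least `N/2`. The large sieve inequality then yields a bilinear `L²` bound which gains
`N^{-1/2}`. Since `k₁ + k₂ + k₃ = 0`, the largest modulus is at least twice the smallest, so two of
the three factors always satisfy this condition. The step functions in the definition of `U²` carry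
the bound over to arbitrary functions, and Cauchy-Schwarz with the third factor gains another
`N^{-1/2}` on a window. In total this pays exactly for the `N` windows needed to cover `[0, t₀]`.

What remains is a sum over dyadic blocks in which the two highest frequencies are comparable. The
derivative on the remaining factor costs one power of its frequency, and `s > 1` leaves a convergent
geometric series. The estimate for a single solution is the case `u₂ = 0`.
-/

namespace BenjaminOno

open AddCircle

/-! ### Almost orthogonality of separated exponentials -/

section LargeSieve

lemma summable_one_div_one_add_sq : Summable (fun k : ℤ => 1 / (1 + (k : ℝ) ^ 2)) := by
  have hsq : Summable fun k : ℤ => 1 / (k : ℝ) ^ 2 :=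
    Real.summable_one_div_int_pow.mpr one_lt_two
  refine hsq.of_norm_bounded_eventually ((Set.finite_singleton (0 : ℤ)).subset fun k hk => ?_)
  by_contra hk0
  have hk0 : (k : ℝ) ≠ 0 := by exact_mod_cast hk0
  refine hk ?_
  change ‖1 / (1 + (k : ℝ) ^ 2)‖ ≤ 1 / (k : ℝ) ^ 2
  rw [Real.norm_of_nonneg (by positivity)]
  exact one_div_le_one_div_of_le (by positivity) (by linarith)

/-- The sum of `1 / (1 + k²)` over the integers, which bounds the row sums in the Schur test for
separated frequencies. -/
noncomputable def decaySum : ℝ := ∑' k : ℤ, 1 / (1 + (k : ℝ) ^ 2)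

lemma decaySum_nonneg : 0 ≤ decaySum := tsum_nonneg fun _ => by positivity

lemma sum_one_div_one_add_sub_sq_le (S : Finset ℤ) (k : ℤ) :
    ∑ l ∈ S, 1 / (1 + ((k - l : ℤ) : ℝ) ^ 2) ≤ decaySum := by
  have h : Summable (fun l : ℤ => 1 / (1 + ((k - l : ℤ) : ℝ) ^ 2)) :=
    (Equiv.subLeft k).summable_iff.mpr summable_one_div_one_add_sq
  calc ∑ l ∈ S, 1 / (1 + ((k - l : ℤ) : ℝ) ^ 2)
      ≤ ∑' l : ℤ, 1 / (1 + ((k - l : ℤ) : ℝ) ^ 2) := h.sum_le_tsum S fun _ _ => by positivity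
    _ = decaySum := (Equiv.subLeft k).tsum_eq fun l : ℤ => 1 / (1 + (l : ℝ) ^ 2)

lemma sum_mul_mul_le_of_symm {ι : Type*} (S : Finset ι) (x : ι → ℝ) {g : ι → ι → ℝ} {A : ℝ}
    (hg : ∀ k l, 0 ≤ g k l) (hsymm : ∀ k l, g k l = g l k)
    (hrow : ∀ k ∈ S, ∑ l ∈ S, g k l ≤ A) :
    ∑ k ∈ S, ∑ l ∈ S, x k * x l * g k l ≤ A * ∑ k ∈ S, x k ^ 2 := by
  have hdiag : ∑ k ∈ S, ∑ l ∈ S, x k ^ 2 * g k l ≤ A * ∑ k ∈ S, x k ^ 2 := by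
    rw [Finset.mul_sum]
    refine Finset.sum_le_sum fun k hk => ?_
    rw [← Finset.mul_sum, mul_comm A]
    exact mul_le_mul_of_nonneg_left (hrow k hk) (sq_nonneg _)
  have hflip : ∑ k ∈ S, ∑ l ∈ S, x l ^ 2 * g k l = ∑ k ∈ S, ∑ l ∈ S, x k ^ 2 * g k l := by
    rw [Finset.sum_comm]
    simp_rw [hsymm]
  calc ∑ k ∈ S, ∑ l ∈ S, x k * x l * g k l
      ≤ ∑ k ∈ S, ∑ l ∈ S, (x k ^ 2 * g k l + x l ^ 2 * g k l) / 2 :=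
        Finset.sum_le_sum fun k _ => Finset.sum_le_sum fun l _ => by
          nlinarith [mul_nonneg (sq_nonneg (x k - x l)) (hg k l)]
    _ = ∑ k ∈ S, ∑ l ∈ S, x k ^ 2 * g k l := by
        simp_rw [← Finset.sum_div, Finset.sum_add_distrib]
        rw [hflip, add_self_div_two]
    _ ≤ _ := hdiag

lemma exp_neg_sq_div_four_le (x : ℝ) : Real.exp (-(x ^ 2 / 4)) ≤ 4 * (1 / (1 + x ^ 2)) := by
  rw [Real.exp_neg, mul_one_div, inv_eq_one_div, div_le_div_iff₀ (Real.exp_pos _) (by positivity)]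
  nlinarith [Real.add_one_le_exp (x ^ 2 / 4), sq_nonneg x]

/-- A smooth majorant, up to the factor `e`, of the indicator of `[α, α + 1 / N]`, whose Fourier
transform is explicit. -/
noncomputable def gaussianWindow (N α t : ℝ) : ℝ := Real.exp (-(N ^ 2 * (t - α) ^ 2))

lemma gaussianWindow_nonneg (N α t : ℝ) : 0 ≤ gaussianWindow N α t := (Real.exp_pos _).le

lemma one_le_exp_one_mul_gaussianWindow {N α t : ℝ} (h₀ : 0 ≤ N * (t - α))
    (h₁ : N * (t - α) ≤ 1) : 1 ≤ Real.exp 1 * gaussianWindow N α t := by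
  rw [gaussianWindow, ← Real.exp_add]
  exact Real.one_le_exp (by nlinarith)

variable {N : ℝ}

lemma gaussianWindow_mul_exp (N α μ t : ℝ) :
    (gaussianWindow N α t : ℂ) * Complex.exp (Complex.I * μ * t) =
      Complex.exp (-(N : ℂ) ^ 2 * (t : ℂ) ^ 2 + (2 * N ^ 2 * α + Complex.I * μ) * t
        + (-(N : ℂ) ^ 2 * α ^ 2)) := by
  rw [gaussianWindow, Complex.ofReal_exp, ← Complex.exp_add]
  congr 1
  push_cast
  ring

lemma integrable_gaussianWindow_mul_exp (hN : 0 < N) (α μ : ℝ) :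
    Integrable fun t : ℝ => (gaussianWindow N α t : ℂ) * Complex.exp (Complex.I * μ * t) := by
  simp_rw [gaussianWindow_mul_exp]
  refine integrable_cexp_quadratic ?_ _ _
  rw [← Complex.ofReal_pow, Complex.ofReal_re]
  positivity

lemma norm_integral_gaussianWindow_mul_exp (hN : 0 < N) (α μ : ℝ) :
    ‖∫ t : ℝ, (gaussianWindow N α t : ℂ) * Complex.exp (Complex.I * μ * t)‖ =
      √π / N * Real.exp (-((μ / N) ^ 2 / 4)) := by
  have hre : (-(N : ℂ) ^ 2).re < 0 := by
    rw [Complex.neg_re, ← Complex.ofReal_pow, Complex.ofReal_re]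
    nlinarith
  have hN' : (N : ℂ) ≠ 0 := by exact_mod_cast hN.ne'
  have hscale : ‖((π : ℂ) / - -(N : ℂ) ^ 2) ^ (1 / 2 : ℂ)‖ = √π / N := by
    have h : ((π : ℂ) / - -(N : ℂ) ^ 2) ^ (1 / 2 : ℂ) = (((π / N ^ 2) ^ (1 / 2 : ℝ) : ℝ) : ℂ) := by
      rw [Complex.ofReal_cpow (by positivity)]
      push_cast
      rw [neg_neg]
    rw [h, Complex.norm_real, Real.norm_of_nonneg (by positivity), ← Real.sqrt_eq_rpow,
      Real.sqrt_div Real.pi_pos.le, Real.sqrt_sq hN.le]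
  have hexponent :
      -(N : ℂ) ^ 2 * α ^ 2 - (2 * N ^ 2 * α + Complex.I * μ) ^ 2 / (4 * -(N : ℂ) ^ 2) =
        ((-((μ / N) ^ 2 / 4) : ℝ) : ℂ) + ((μ * α : ℝ) : ℂ) * Complex.I := by
    push_cast
    field_simp
    ring_nf
    simp only [Complex.I_sq]
    ring
  simp_rw [gaussianWindow_mul_exp]
  rw [integral_cexp_quadratic hre, norm_mul, hscale, Complex.norm_exp, hexponent, Complex.add_re,
    Complex.ofReal_re, Complex.re_ofReal_mul, Complex.I_re, mul_zero, add_zero]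

lemma gaussianWindow_mul_norm_sq_expSum {ι : Type*} (S : Finset ι) (c : ι → ℂ) (ω : ι → ℝ)
    (N α t : ℝ) :
    ((gaussianWindow N α t *
      ‖∑ k ∈ S, c k * Complex.exp (Complex.I * t * ω k)‖ ^ 2 : ℝ) : ℂ) =
      ∑ k ∈ S, ∑ l ∈ S, (c k * (starRingEnd ℂ) (c l)) *
        (gaussianWindow N α t * Complex.exp (Complex.I * (ω k - ω l : ℝ) * t)) := by
  have hexp (k l : ι) : Complex.exp (Complex.I * (ω k - ω l : ℝ) * t) =
      Complex.exp (Complex.I * t * ω k) * (starRingEnd ℂ) (Complex.exp (Complex.I * t * ω l)) := by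
    rw [← Complex.exp_conj, ← Complex.exp_add]
    simp only [map_mul, Complex.conj_I, Complex.conj_ofReal]
    push_cast
    ring_nf
  rw [Complex.ofReal_mul, Complex.ofReal_pow, ← Complex.mul_conj', map_sum, Finset.sum_mul_sum]
  simp_rw [Finset.mul_sum, hexp, map_mul]
  exact Finset.sum_congr rfl fun k _ => Finset.sum_congr rfl fun l _ => by ring

lemma integrable_gaussianWindow_mul_norm_sq_expSum {ι : Type*} (S : Finset ι) (c : ι → ℂ)
    (ω : ι → ℝ) (hN : 0 < N) (α : ℝ) :
    Integrable fun t : ℝ =>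
      gaussianWindow N α t * ‖∑ k ∈ S, c k * Complex.exp (Complex.I * t * ω k)‖ ^ 2 := by
  have h : Integrable fun t : ℝ => ((gaussianWindow N α t *
      ‖∑ k ∈ S, c k * Complex.exp (Complex.I * t * ω k)‖ ^ 2 : ℝ) : ℂ) := by
    simp_rw [gaussianWindow_mul_norm_sq_expSum]
    exact integrable_finsetSum _ fun k _ => integrable_finsetSum _ fun l _ =>
      (integrable_gaussianWindow_mul_exp hN α _).const_mul _
  simpa only [RCLike.re_eq_complex_re, Complex.ofReal_re] using h.re

lemma norm_integral_gaussianWindow_mul_exp_le (hN : 0 < N) (α : ℝ) {μ d : ℝ}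
    (hd : N * |d| ≤ |μ|) :
    ‖∫ t : ℝ, (gaussianWindow N α t : ℂ) * Complex.exp (Complex.I * μ * t)‖ ≤
      4 * √π / N * (1 / (1 + d ^ 2)) := by
  have hsq : d ^ 2 ≤ (μ / N) ^ 2 := by
    rwa [sq_le_sq, abs_div, abs_of_pos hN, le_div_iff₀ hN, mul_comm]
  rw [norm_integral_gaussianWindow_mul_exp hN]
  calc √π / N * Real.exp (-((μ / N) ^ 2 / 4))
      ≤ √π / N * Real.exp (-(d ^ 2 / 4)) := by gcongr
    _ ≤ √π / N * (4 * (1 / (1 + d ^ 2))) := by gcongr; exact exp_neg_sq_div_four_le d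
    _ = _ := by ring

variable (S : Finset ℤ) (c : ℤ → ℂ) {ω : ℤ → ℝ}

lemma integral_gaussianWindow_mul_norm_sq_expSum_le (hN : 0 < N) (α : ℝ)
    (hsep : ∀ k ∈ S, ∀ l ∈ S, N * |((k - l : ℤ) : ℝ)| ≤ |ω k - ω l|) :
    ∫ t : ℝ, gaussianWindow N α t * ‖∑ k ∈ S, c k * Complex.exp (Complex.I * t * ω k)‖ ^ 2 ≤
      4 * √π / N * decaySum * ∑ k ∈ S, ‖c k‖ ^ 2 := by
  have hint (k l : ℤ) : Integrable fun t : ℝ => (c k * (starRingEnd ℂ) (c l)) *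
      (gaussianWindow N α t * Complex.exp (Complex.I * (ω k - ω l : ℝ) * t)) :=
    (integrable_gaussianWindow_mul_exp hN α _).const_mul _
  refine (le_abs_self _).trans ?_
  rw [← Real.norm_eq_abs, ← Complex.norm_real, ← integral_complex_ofReal]
  simp_rw [gaussianWindow_mul_norm_sq_expSum]
  rw [integral_finsetSum _ fun k _ => integrable_finsetSum _ fun l _ => hint k l]
  simp_rw [integral_finsetSum S fun l _ => hint _ l, integral_const_mul]
  calc _ ≤ ∑ k ∈ S, ∑ l ∈ S, ‖c k‖ * ‖c l‖ *
          (4 * √π / N * (1 / (1 + ((k - l : ℤ) : ℝ) ^ 2))) := by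
        refine norm_sum_le_of_le S fun k hk => norm_sum_le_of_le S fun l hl => ?_
        rw [norm_mul, norm_mul, RCLike.norm_conj]
        gcongr
        exact norm_integral_gaussianWindow_mul_exp_le hN α (hsep k hk l hl)
    _ ≤ _ := by
        refine sum_mul_mul_le_of_symm S (fun k => ‖c k‖) (fun _ _ => by positivity)
          (fun k l => ?_) fun k _ => ?_
        · rw [← neg_sub k l, Int.cast_neg, neg_sq]
        · rw [← Finset.mul_sum]
          gcongr
          exact sum_one_div_one_add_sub_sq_le S k

/-- The constant of the large sieve inequality for separated exponentials. -/
noncomputable def sieveConst : ℝ := Real.exp 1 * (4 * √π * decaySum)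

lemma sieveConst_nonneg : 0 ≤ sieveConst := by
  have := decaySum_nonneg
  unfold sieveConst; positivity

/-- The large sieve: it compares the sharp time cutoff with a Gaussian, under which the exponentials
have rapidly decaying inner products, and concludes by the Schur test. -/
theorem lintegral_enorm_sq_expSum_le (hN : 0 < N) {α β : ℝ} (hαβ : β - α ≤ 1 / N)
    (hsep : ∀ k ∈ S, ∀ l ∈ S, N * |((k - l : ℤ) : ℝ)| ≤ |ω k - ω l|) :
    ∫⁻ t in Ioc α β, ‖∑ k ∈ S, c k * Complex.exp (Complex.I * t * ω k)‖ₑ ^ 2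
      ≤ ENNReal.ofReal (sieveConst / N) * ∑ k ∈ S, ‖c k‖ₑ ^ 2 := by
  set F : ℝ → ℝ := fun t =>
    gaussianWindow N α t * ‖∑ k ∈ S, c k * Complex.exp (Complex.I * t * ω k)‖ ^ 2 with hF
  have hF0 (t : ℝ) : 0 ≤ F t := mul_nonneg (gaussianWindow_nonneg _ _ _) (by positivity)
  have hmajorant : ∀ t ∈ Ioc α β, ‖∑ k ∈ S, c k * Complex.exp (Complex.I * t * ω k)‖ₑ ^ 2 ≤
      ENNReal.ofReal (Real.exp 1 * F t) := fun t ht => by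
    rw [← ofReal_norm, ← ENNReal.ofReal_pow (norm_nonneg _), hF, ← mul_assoc]
    refine ENNReal.ofReal_le_ofReal (le_mul_of_one_le_left (by positivity)
      (one_le_exp_one_mul_gaussianWindow (mul_nonneg hN.le (by linarith [ht.1])) ?_))
    rw [mul_comm, ← le_div_iff₀ hN]
    linarith [ht.2]
  calc ∫⁻ t in Ioc α β, ‖∑ k ∈ S, c k * Complex.exp (Complex.I * t * ω k)‖ₑ ^ 2
      ≤ ∫⁻ t in Ioc α β, ENNReal.ofReal (Real.exp 1 * F t) :=
        setLIntegral_mono' measurableSet_Ioc hmajorant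
    _ ≤ ∫⁻ t, ENNReal.ofReal (Real.exp 1 * F t) := setLIntegral_le_lintegral _ _
    _ = ENNReal.ofReal (Real.exp 1 * ∫ t, F t) := by
        rw [← integral_const_mul, ofReal_integral_eq_lintegral_ofReal
          ((integrable_gaussianWindow_mul_norm_sq_expSum S c ω hN α).const_mul _)
          (.of_forall fun t => mul_nonneg (Real.exp_pos _).le (hF0 t))]
    _ ≤ ENNReal.ofReal (Real.exp 1 * (4 * √π / N * decaySum * ∑ k ∈ S, ‖c k‖ ^ 2)) := by
        gcongr
        exact integral_gaussianWindow_mul_norm_sq_expSum_le S c hN α hsep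
    _ = ENNReal.ofReal (sieveConst / N * ∑ k ∈ S, ‖c k‖ ^ 2) := by
        unfold sieveConst
        ring_nf
    _ = _ := by
        have := sieveConst_nonneg
        rw [ENNReal.ofReal_mul (by positivity),
          ENNReal.ofReal_sum_of_nonneg fun _ _ => by positivity]
        simp_rw [ENNReal.ofReal_pow (norm_nonneg _), ofReal_norm]

end LargeSieve

/-! ### The resonance function of the Benjamin-Ono dispersion relation -/

lemma hasDerivAt_mul_abs (x : ℝ) : HasDerivAt (fun y : ℝ => y * |y|) (2 * |x|) x := by
  have hne (y : ℝ) (hy : y ≠ 0) : HasDerivAt (fun y : ℝ => y * |y|) (2 * |y|) y := by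
    refine ((hasDerivAt_id y).mul (hasDerivAt_abs hy)).congr_deriv ?_
    simp only [id_eq, one_mul, mul_comm y, sign_mul_self]
    ring
  rcases eq_or_ne x 0 with rfl | hx
  · exact hasDerivAt_of_hasDerivAt_of_ne hne (by fun_prop) (by fun_prop)
  · exact hne x hx

lemma min_abs_sub_abs_le {ξ k l x : ℝ} (hx : x ∈ Icc k l) :
    min (|k| - |ξ - k|) (|l| - |ξ - l|) ≤ |x| - |ξ - x| := by
  obtain ⟨hkx, hxl⟩ := hx
  rcases le_total 0 ξ with hξ | hξ
  · exact (min_le_left _ _).trans (by grind)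
  · exact (min_le_right _ _).trans (by grind)

/-- The phase of the product of two free waves with frequencies `x` and `ξ - x`, as a function of
`x` for a fixed output frequency `ξ`. -/
def pairPhase (ξ x : ℝ) : ℝ := x * |x| + (ξ - x) * |ξ - x|

lemma pairPhase_sub (ξ x : ℝ) : pairPhase ξ (ξ - x) = pairPhase ξ x := by
  rw [pairPhase, pairPhase, sub_sub_cancel, add_comm]

lemma hasDerivAt_pairPhase (ξ x : ℝ) :
    HasDerivAt (pairPhase ξ) (2 * (|x| - |ξ - x|)) x := by
  refine ((hasDerivAt_mul_abs x).add
    ((hasDerivAt_mul_abs (ξ - x)).comp x ((hasDerivAt_id x).const_sub ξ))).congr_deriv ?_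
  ring

lemma mul_sub_le_pairPhase_sub {ξ k l N : ℝ} (hkl : k ≤ l) (hk : N / 2 ≤ |k| - |ξ - k|)
    (hl : N / 2 ≤ |l| - |ξ - l|) : N * (l - k) ≤ pairPhase ξ l - pairPhase ξ k := by
  have hderiv := hasDerivAt_pairPhase ξ
  refine (convex_Icc k l).mul_sub_le_image_sub_of_le_deriv
    (fun x _ => (hderiv x).continuousAt.continuousWithinAt)
    (fun x _ => (hderiv x).differentiableAt.differentiableWithinAt) (fun x hx => ?_)
    k (left_mem_Icc.mpr hkl) l (right_mem_Icc.mpr hkl) hkl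
  rw [(hderiv x).deriv]
  linarith [le_min hk hl, min_abs_sub_abs_le (ξ := ξ) (interior_subset hx)]

lemma mul_abs_sub_le_abs_pairPhase_sub {ξ k l N : ℝ} (hk : N / 2 ≤ |k| - |ξ - k|)
    (hl : N / 2 ≤ |l| - |ξ - l|) : N * |k - l| ≤ |pairPhase ξ k - pairPhase ξ l| := by
  wlog hkl : k ≤ l generalizing k l
  · simpa only [abs_sub_comm] using this hl hk (le_of_not_ge hkl)
  · rw [abs_sub_comm k, abs_sub_comm (pairPhase ξ k), abs_of_nonneg (sub_nonneg.mpr hkl)]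
    exact (mul_sub_le_pairPhase_sub hkl hk hl).trans (le_abs_self _)

lemma mul_abs_sub_le_abs_pairPhase_sub' {ξ k l N : ℝ} (hk : N / 2 ≤ |ξ - k| - |k|)
    (hl : N / 2 ≤ |ξ - l| - |l|) : N * |k - l| ≤ |pairPhase ξ k - pairPhase ξ l| := by
  have := mul_abs_sub_le_abs_pairPhase_sub (ξ := ξ) (k := ξ - k) (l := ξ - l) (N := N)
    (by rwa [sub_sub_cancel]) (by rwa [sub_sub_cancel])
  rwa [pairPhase_sub, pairPhase_sub, sub_sub_sub_cancel_left, abs_sub_comm l] at this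

/-! ### The transfer principle for `U²` -/

lemma ennreal_tsum_mul_sq_le {ι : Type*} (f g : ι → ℝ≥0∞) :
    (∑' i, f i * g i) ^ 2 ≤ (∑' i, f i ^ 2) * ∑' i, g i ^ 2 := by
  let _ : MeasurableSpace ι := ⊤
  have hölder := ENNReal.lintegral_mul_le_Lp_mul_Lq (Measure.count (α := ι))
    Real.HolderConjugate.two_two (f := f) (g := g)
    (measurable_from_top.aemeasurable) (measurable_from_top.aemeasurable)
  simp only [lintegral_count, Pi.mul_apply] at hölder
  calc (∑' i, f i * g i) ^ 2
      ≤ ((∑' i, f i ^ (2 : ℝ)) ^ (1 / 2 : ℝ) * (∑' i, g i ^ (2 : ℝ)) ^ (1 / 2 : ℝ)) ^ 2 := by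
        gcongr
    _ = _ := by
        rw [mul_pow, ← ENNReal.rpow_natCast, ← ENNReal.rpow_natCast, ← ENNReal.rpow_mul,
          ← ENNReal.rpow_mul]
        norm_num

lemma ennreal_sum_mul_sq_le {ι : Type*} (s : Finset ι) (f g : ι → ℝ≥0∞) :
    (∑ i ∈ s, f i * g i) ^ 2 ≤ (∑ i ∈ s, f i ^ 2) * ∑ i ∈ s, g i ^ 2 := by
  have h := ennreal_tsum_mul_sq_le (fun i : s => f i) (fun i : s => g i)
  simpa only [tsum_fintype, Finset.sum_coe_sort s fun i => f i * g i,
    Finset.sum_coe_sort s fun i => f i ^ 2, Finset.sum_coe_sort s fun i => g i ^ 2] using h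

lemma ennreal_tsum_mul_sq_le_weight {ι : Type*} (c x : ι → ℝ≥0∞) :
    (∑' i, c i * x i) ^ 2 ≤ (∑' i, c i) * ∑' i, c i * x i ^ 2 := by
  have hsqrt (i : ι) : (c i ^ (1 / 2 : ℝ)) ^ 2 = c i := by
    rw [← ENNReal.rpow_natCast, ← ENNReal.rpow_mul]
    norm_num
  have h := ennreal_tsum_mul_sq_le (fun i => c i ^ (1 / 2 : ℝ)) fun i => c i ^ (1 / 2 : ℝ) * x i
  simpa only [mul_pow, ← mul_assoc, ← sq, hsqrt] using h

lemma ennreal_add_sq_le (x y : ℝ≥0∞) : (x + y) ^ 2 ≤ 2 * (x ^ 2 + y ^ 2) := by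
  have h := ennreal_sum_mul_sq_le (Finset.univ : Finset (Fin 2)) (fun _ => 1) ![x, y]
  simpa [Fin.sum_univ_two, one_add_one_eq_two] using h

lemma ennreal_le_mul_sq_of_forall_gt {x K u : ℝ≥0∞} (hK : K ≠ ⊤) (hu : u ≠ ⊤)
    (h : ∀ r, u < r → x ≤ K * r ^ 2) : x ≤ K * u ^ 2 := by
  have : (nhdsWithin u (Ioi u)).NeBot := nhdsGT_neBot_of_exists_gt ⟨⊤, hu.lt_top⟩
  have htendsto : Filter.Tendsto (fun r : ℝ≥0∞ => K * r ^ 2) (nhdsWithin u (Ioi u))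
      (nhds (K * u ^ 2)) :=
    ((ENNReal.continuous_const_mul hK).comp (ENNReal.continuous_pow 2)).continuousWithinAt.tendsto
  exact ge_of_tendsto htendsto (Filter.eventually_of_mem self_mem_nhdsWithin fun r hr => h r hr)

section Transfer

variable {H : Type*} [NormedAddCommGroup H]

lemma IsU2Atom.exists_values {a b : ℝ} {f : ℝ → H} (hf : IsU2Atom a b f) :
    ∃ (K : ℕ) (φ : Fin K → H), ∑ p, ‖φ p‖ₑ ^ 2 = 1 ∧ ∀ t, f t = 0 ∨ ∃ p, f t = φ p := by
  obtain ⟨K, τ, φ, hτ, -, -, hφ, hf⟩ := hf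
  refine ⟨K, φ, ?_, fun t => ?_⟩
  · simp_rw [← ofReal_norm, ← ENNReal.ofReal_pow (norm_nonneg _)]
    rw [← ENNReal.ofReal_sum_of_nonneg fun _ _ => by positivity, hφ, ENNReal.ofReal_one]
  have hdisj : Pairwise fun p q : Fin K =>
      Disjoint (Ico (τ p.castSucc) (τ p.succ)) (Ico (τ q.castSucc) (τ q.succ)) := by
    refine (pairwise_disjoint_on _).mpr fun p q hpq => disjoint_left.mpr fun x hp hq => ?_
    have : τ p.succ ≤ τ q.castSucc := hτ.monotone (Fin.succ_le_castSucc_iff.mpr hpq)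
    exact absurd (this.trans hq.1) (not_le.mpr hp.2)
  by_cases h : ∃ p : Fin K, t ∈ Ico (τ p.castSucc) (τ p.succ)
  · obtain ⟨p, hp⟩ := h
    refine Or.inr ⟨p, ?_⟩
    rw [hf, Finset.sum_eq_single_of_mem p (Finset.mem_univ p), indicator_of_mem hp]
    exact fun q _ hqp => indicator_of_notMem (disjoint_left.mp (hdisj hqp.symm) hp) _
  · refine Or.inl ?_
    rw [hf]
    exact Finset.sum_eq_zero fun p _ => indicator_of_notMem (fun hp => h ⟨p, hp⟩) _

lemma IsU2Atom.enorm_le_one {a b : ℝ} {f : ℝ → H} (hf : IsU2Atom a b f) (t : ℝ) :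
    ‖f t‖ₑ ≤ 1 := by
  obtain ⟨K, φ, hφ, hval⟩ := hf.exists_values
  rcases hval t with h | ⟨p, h⟩
  · simp [h]
  · rw [h, ← ENNReal.pow_le_pow_left_iff two_ne_zero, one_pow, ← hφ]
    exact Finset.single_le_sum (f := fun p => ‖φ p‖ₑ ^ 2) (fun _ _ => zero_le)
      (Finset.mem_univ p)

variable [NormedSpace ℂ H]

lemma enorm_le_u2Norm {a b : ℝ} {f : ℝ → H} {t : ℝ} (ht : t ∈ Ico a b) :
    ‖f t‖ₑ ≤ u2Norm a b f := by
  refine le_iInf fun c => le_iInf fun A => le_iInf fun hA => le_iInf fun hf => ?_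
  rw [← (hf t ht).tsum_eq]
  refine enorm_tsum_le_tsum_enorm.trans (ENNReal.tsum_le_tsum fun n => ?_)
  rw [enorm_smul]
  exact mul_le_of_le_one_right' ((hA n).enorm_le_one t)

variable {E : Type*} [NormedAddCommGroup E] [NormedSpace ℂ E]

lemma enorm_map_sq_le_of_hasSum (L : H →L[ℂ] E) {c : ℕ → ℂ} {x : ℕ → H} {y : H}
    (h : HasSum (fun n => c n • x n) y) :
    ‖L y‖ₑ ^ 2 ≤ (∑' n, ‖c n‖ₑ) * ∑' n, ‖c n‖ₑ * ‖L (x n)‖ₑ ^ 2 := by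
  refine le_trans ?_ (ennreal_tsum_mul_sq_le_weight _ _)
  gcongr
  rw [← (L.hasSum h).tsum_eq]
  refine enorm_tsum_le_tsum_enorm.trans_eq ?_
  simp only [map_smul, enorm_smul]

variable {ι : Type*} {μ : Measure ℝ} (Ξ : Finset ι) {K : ℝ≥0∞} {a b : ℝ}

lemma IsU2Atom.exists_lintegral_majorant {Ψ : ℝ → ι → H →L[ℂ] E}
    (hΨ : ∀ φ i, AEMeasurable (fun t => ‖Ψ t i φ‖ₑ) μ)
    (hK : ∀ φ, ∫⁻ t, ∑ i ∈ Ξ, ‖Ψ t i φ‖ₑ ^ 2 ∂μ ≤ K * ‖φ‖ₑ ^ 2)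
    {f : ℝ → H} (hf : IsU2Atom a b f) :
    ∃ G : ℝ → ℝ≥0∞, AEMeasurable G μ ∧ (∀ t, ∑ i ∈ Ξ, ‖Ψ t i (f t)‖ₑ ^ 2 ≤ G t) ∧
      ∫⁻ t, G t ∂μ ≤ K := by
  obtain ⟨P, φ, hφ, hval⟩ := hf.exists_values
  have hmeas (p : Fin P) : AEMeasurable (fun t => ∑ i ∈ Ξ, ‖Ψ t i (φ p)‖ₑ ^ 2) μ :=
    Finset.aemeasurable_fun_sum _ fun i _ => (hΨ (φ p) i).pow_const 2
  refine ⟨fun t => ∑ p, ∑ i ∈ Ξ, ‖Ψ t i (φ p)‖ₑ ^ 2,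
    Finset.aemeasurable_fun_sum _ fun p _ => hmeas p, fun t => ?_, ?_⟩
  · rcases hval t with h | ⟨p, h⟩
    · simp [h]
    · rw [h]
      exact Finset.single_le_sum (f := fun p => ∑ i ∈ Ξ, ‖Ψ t i (φ p)‖ₑ ^ 2)
        (fun _ _ => zero_le) (Finset.mem_univ p)
  · rw [lintegral_finsetSum' _ fun p _ => hmeas p]
    refine (Finset.sum_le_sum fun p _ => hK (φ p)).trans_eq ?_
    rw [← Finset.mul_sum, hφ, mul_one]

/-- A `U²` function is a superposition of step functions, and for a step function the estimate for
constant vectors applies on every step. -/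
theorem lintegral_sum_sq_le_u2Norm (hKtop : K ≠ ⊤) {Ψ : ℝ → ι → H →L[ℂ] E}
    (hΨ : ∀ φ i, AEMeasurable (fun t => ‖Ψ t i φ‖ₑ) μ)
    (hK : ∀ φ, ∫⁻ t, ∑ i ∈ Ξ, ‖Ψ t i φ‖ₑ ^ 2 ∂μ ≤ K * ‖φ‖ₑ ^ 2)
    (hμ : ∀ᵐ t ∂μ, t ∈ Ico a b) {f : ℝ → H} (hf : u2Norm a b f ≠ ⊤) :
    ∫⁻ t, ∑ i ∈ Ξ, ‖Ψ t i (f t)‖ₑ ^ 2 ∂μ ≤ K * u2Norm a b f ^ 2 := by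
  refine ennreal_le_mul_sq_of_forall_gt hKtop hf fun r hr => ?_
  simp only [u2Norm, iInf_lt_iff] at hr
  obtain ⟨c, A, hA, hsum, hr⟩ := hr
  choose G hGmeas hAG hGK using fun n => (hA n).exists_lintegral_majorant Ξ hΨ hK
  have hmajorant : ∀ᵐ t ∂μ, ∑ i ∈ Ξ, ‖Ψ t i (f t)‖ₑ ^ 2 ≤
      (∑' n, ‖c n‖ₑ) * ∑' n, ‖c n‖ₑ * G n t := by
    filter_upwards [hμ] with t ht
    calc ∑ i ∈ Ξ, ‖Ψ t i (f t)‖ₑ ^ 2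
        ≤ ∑ i ∈ Ξ, (∑' n, ‖c n‖ₑ) * ∑' n, ‖c n‖ₑ * ‖Ψ t i (A n t)‖ₑ ^ 2 :=
          Finset.sum_le_sum fun i _ => enorm_map_sq_le_of_hasSum (Ψ t i) (hsum t ht)
      _ = (∑' n, ‖c n‖ₑ) * ∑' n, ‖c n‖ₑ * ∑ i ∈ Ξ, ‖Ψ t i (A n t)‖ₑ ^ 2 := by
          rw [← Finset.mul_sum, ← Summable.tsum_finsetSum fun _ _ => ENNReal.summable]
          simp_rw [← Finset.mul_sum]
      _ ≤ _ := by
          gcongr with n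
          exact hAG n t
  calc ∫⁻ t, ∑ i ∈ Ξ, ‖Ψ t i (f t)‖ₑ ^ 2 ∂μ
      ≤ ∫⁻ t, (∑' n, ‖c n‖ₑ) * ∑' n, ‖c n‖ₑ * G n t ∂μ := lintegral_mono_ae hmajorant
    _ = (∑' n, ‖c n‖ₑ) * ∑' n, ‖c n‖ₑ * ∫⁻ t, G n t ∂μ := by
        rw [lintegral_const_mul'' _ (AEMeasurable.tsum fun n => (hGmeas n).const_mul _),
          lintegral_tsum fun n => (hGmeas n).const_mul _]
        simp_rw [lintegral_const_mul'' _ (hGmeas _)]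
    _ ≤ (∑' n, ‖c n‖ₑ) * ∑' n, ‖c n‖ₑ * K := by
        gcongr with n
        exact hGK n
    _ = K * (∑' n, ‖c n‖ₑ) ^ 2 := by rw [ENNReal.tsum_mul_right]; ring
    _ ≤ K * r ^ 2 := by gcongr

theorem lintegral_sum_bilinear_sq_le_u2Norm {H' : Type*} [NormedAddCommGroup H']
    [NormedSpace ℂ H'] {a' b' : ℝ} (hKtop : K ≠ ⊤) {B : ℝ → ι → H →L[ℂ] H' →L[ℂ] E}
    {f : ℝ → H} {g : ℝ → H'} (hB : ∀ φ ψ i, AEMeasurable (fun t => ‖B t i φ ψ‖ₑ) μ)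
    (hBg : ∀ φ i, AEMeasurable (fun t => ‖B t i φ (g t)‖ₑ) μ)
    (hK : ∀ φ ψ, ∫⁻ t, ∑ i ∈ Ξ, ‖B t i φ ψ‖ₑ ^ 2 ∂μ ≤ K * ‖φ‖ₑ ^ 2 * ‖ψ‖ₑ ^ 2)
    (hμ : ∀ᵐ t ∂μ, t ∈ Ico a b) (hμ' : ∀ᵐ t ∂μ, t ∈ Ico a' b')
    (hf : u2Norm a b f ≠ ⊤) (hg : u2Norm a' b' g ≠ ⊤) :
    ∫⁻ t, ∑ i ∈ Ξ, ‖B t i (f t) (g t)‖ₑ ^ 2 ∂μ ≤ K * u2Norm a b f ^ 2 * u2Norm a' b' g ^ 2 := by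
  have hfixed (φ : H) : ∫⁻ t, ∑ i ∈ Ξ, ‖B t i φ (g t)‖ₑ ^ 2 ∂μ ≤
      K * u2Norm a' b' g ^ 2 * ‖φ‖ₑ ^ 2 := by
    rw [mul_right_comm]
    exact lintegral_sum_sq_le_u2Norm Ξ (by finiteness) (hB φ) (hK φ) hμ' hg
  rw [mul_right_comm]
  exact lintegral_sum_sq_le_u2Norm Ξ (Ψ := fun t i => (B t i).flip (g t)) (by finiteness)
    hBg hfixed hμ hf

end Transfer

/-! ### The bilinear estimate -/

/-- The Fourier multiplier of the free Benjamin-Ono evolution. -/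
noncomputable def wave (t : ℝ) (k : ℤ) : ℂ :=
  Complex.exp (-(Complex.I * (t : ℂ) * ((k * |k| : ℤ) : ℂ)))

lemma enorm_wave (t : ℝ) (k : ℤ) : ‖wave t k‖ₑ = 1 := by
  rw [← ofReal_norm, wave, Complex.norm_exp]
  simp

lemma continuous_wave (k : ℤ) : Continuous fun t => wave t k := by
  unfold wave
  fun_prop

lemma wave_mul_wave_sub (t : ℝ) (ξ k : ℤ) :
    wave t k * wave t (ξ - k) = Complex.exp (Complex.I * t * (-pairPhase ξ k : ℝ)) := by
  have hphase : pairPhase ξ k = ((k * |k| + (ξ - k) * |ξ - k| : ℤ) : ℝ) := by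
    push_cast [pairPhase]
    rfl
  rw [wave, wave, ← Complex.exp_add, hphase, Complex.ofReal_neg, Complex.ofReal_intCast]
  congr 1
  push_cast
  ring

/-- Transversality of two frequencies: the group velocities `2|k|` and `2|l|` differ by at
least `N`. -/
def Transversal (N : ℝ) (k l : ℤ) : Prop := N / 2 ≤ |(|(k : ℝ)| - |(l : ℝ)|)|

lemma lintegral_enorm_sum_sq_le_filter_add_filter_not {α ι E : Type*} [MeasurableSpace α]
    [NormedAddCommGroup E] (μ : Measure α) (S : Finset ι) (p : ι → Prop) [DecidablePred p]
    {F : ι → α → E} (hF : AEMeasurable (fun x => ‖∑ i ∈ S with p i, F i x‖ₑ) μ) :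
    ∫⁻ x, ‖∑ i ∈ S, F i x‖ₑ ^ 2 ∂μ ≤ 2 * ((∫⁻ x, ‖∑ i ∈ S with p i, F i x‖ₑ ^ 2 ∂μ) +
      ∫⁻ x, ‖∑ i ∈ S with ¬ p i, F i x‖ₑ ^ 2 ∂μ) := by
  rw [← lintegral_add_left' (hF.pow_const 2), ← lintegral_const_mul' _ _ ENNReal.ofNat_ne_top]
  refine lintegral_mono fun x => ?_
  rw [← Finset.sum_filter_add_sum_filter_not S p]
  exact (pow_le_pow_left₀ zero_le (enorm_add_le _ _) 2).trans (ennreal_add_sq_le _ _)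

/-- The frequencies with `|k| > |ξ - k|` and those with `|k| < |ξ - k|` are treated separately,
since the phase is monotone on each of these two sets only. -/
lemma lintegral_enorm_sq_waves_le (S : Finset ℤ) (c : ℤ → ℂ) (ξ : ℤ) {N : ℝ} (hN : 0 < N)
    {α β : ℝ} (hαβ : β - α ≤ 1 / N) (hS : ∀ k ∈ S, Transversal N k (ξ - k)) :
    ∫⁻ t in Ioo α β, ‖∑ k ∈ S, c k * (wave t k * wave t (ξ - k))‖ₑ ^ 2
      ≤ ENNReal.ofReal (2 * sieveConst / N) * ∑ k ∈ S, ‖c k‖ₑ ^ 2 := by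
  classical
  simp_rw [wave_mul_wave_sub]
  set w : ℝ → ℤ → ℂ := fun t k => Complex.exp (Complex.I * t * (-pairPhase ξ k : ℝ))
  set p : ℤ → Prop := fun k => N / 2 ≤ |(k : ℝ)| - |(ξ - k : ℝ)|
  have hpos : ∫⁻ t in Ioc α β, ‖∑ k ∈ S with p k, c k * w t k‖ₑ ^ 2 ≤
      ENNReal.ofReal (sieveConst / N) * ∑ k ∈ S with p k, ‖c k‖ₑ ^ 2 := by
    refine lintegral_enorm_sq_expSum_le _ c hN hαβ fun k hk l hl => ?_
    rw [neg_sub_neg, abs_sub_comm, Int.cast_sub, abs_sub_comm]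
    simpa only [abs_sub_comm] using mul_abs_sub_le_abs_pairPhase_sub (Finset.mem_filter.mp hk).2
      (Finset.mem_filter.mp hl).2
  have hneg : ∫⁻ t in Ioc α β, ‖∑ k ∈ S with ¬ p k, c k * w t k‖ₑ ^ 2 ≤
      ENNReal.ofReal (sieveConst / N) * ∑ k ∈ S with ¬ p k, ‖c k‖ₑ ^ 2 := by
    have hnp (k : ℤ) (hk : k ∈ S.filter (¬ p ·)) : N / 2 ≤ |(ξ - k : ℝ)| - |(k : ℝ)| := by
      obtain ⟨hkS, hkp⟩ := Finset.mem_filter.mp hk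
      have := hS k hkS
      rw [Transversal, Int.cast_sub] at this
      exact neg_sub |(k : ℝ)| _ ▸ (le_abs.mp this).resolve_left hkp
    refine lintegral_enorm_sq_expSum_le _ c hN hαβ fun k hk l hl => ?_
    rw [neg_sub_neg, abs_sub_comm, Int.cast_sub, abs_sub_comm]
    simpa only [abs_sub_comm] using mul_abs_sub_le_abs_pairPhase_sub' (hnp k hk) (hnp l hl)
  have hcont : Continuous fun t => ∑ k ∈ S with p k, c k * w t k := by fun_prop
  calc ∫⁻ t in Ioo α β, ‖∑ k ∈ S, c k * w t k‖ₑ ^ 2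
      ≤ ∫⁻ t in Ioc α β, ‖∑ k ∈ S, c k * w t k‖ₑ ^ 2 := lintegral_mono_set Ioo_subset_Ioc_self
    _ ≤ 2 * ((∫⁻ t in Ioc α β, ‖∑ k ∈ S with p k, c k * w t k‖ₑ ^ 2)
        + ∫⁻ t in Ioc α β, ‖∑ k ∈ S with ¬ p k, c k * w t k‖ₑ ^ 2) :=
        lintegral_enorm_sum_sq_le_filter_add_filter_not _ S p hcont.measurable.enorm.aemeasurable
    _ ≤ 2 * (ENNReal.ofReal (sieveConst / N) * ∑ k ∈ S with p k, ‖c k‖ₑ ^ 2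
        + ENNReal.ofReal (sieveConst / N) * ∑ k ∈ S with ¬ p k, ‖c k‖ₑ ^ 2) := by gcongr
    _ = _ := by
        rw [← mul_add, Finset.sum_filter_add_sum_filter_not, ← mul_assoc, mul_div_assoc 2,
          ENNReal.ofReal_mul zero_le_two, ENNReal.ofReal_ofNat]

/-- The `k`-th Fourier coefficient as a functional on `L²`. -/
noncomputable def coef (k : ℤ) : L2Torus →L[ℂ] ℂ := innerSL ℂ (fourierLp 2 k)

lemma sum_enorm_coef_comp_sq_le {ι : Type*} (S : Finset ι) {e : ι → ℤ} (he : Function.Injective e)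
    (φ : L2Torus) : ∑ k ∈ S, ‖coef (e k) φ‖ₑ ^ 2 ≤ ‖φ‖ₑ ^ 2 := by
  have bessel := ((orthonormal_fourier (T := 2 * π)).comp e he).sum_inner_products_le (s := S) φ
  simp_rw [← ofReal_norm, ← ENNReal.ofReal_pow (norm_nonneg _)]
  rw [← ENNReal.ofReal_sum_of_nonneg fun _ _ => by positivity]
  exact ENNReal.ofReal_le_ofReal bessel

lemma sum_enorm_coef_sq_le (S : Finset ℤ) (φ : L2Torus) :
    ∑ k ∈ S, ‖coef k φ‖ₑ ^ 2 ≤ ‖φ‖ₑ ^ 2 :=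
  sum_enorm_coef_comp_sq_le S Function.injective_id φ

section Bilinear

variable (B₁ B₂ : Finset ℤ) (m : ℤ → ℤ → ℤ → ℂ) (t : ℝ) (k₃ : ℤ)

/-- The component at the output frequency `-k₃` of the bilinear form with symbol `m`, evaluated at
the free evolutions at time `t` of its two arguments. -/
noncomputable def bilin : L2Torus →L[ℂ] L2Torus →L[ℂ] ℂ :=
  ∑ k₁ ∈ B₁, ∑ k₂ ∈ B₂,
    (m k₁ k₂ k₃ * (wave t k₁ * wave t k₂)) • (coef k₁).smulRight (coef k₂)

lemma bilin_apply (φ ψ : L2Torus) : bilin B₁ B₂ m t k₃ φ ψ =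
    ∑ k₁ ∈ B₁, ∑ k₂ ∈ B₂, m k₁ k₂ k₃ * (wave t k₁ * wave t k₂) * (coef k₁ φ * coef k₂ ψ) := by
  simp only [bilin, sum_apply, smul_apply,
    ContinuousLinearMap.smulRight_apply, smul_eq_mul]

lemma aemeasurable_bilin {μ : Measure ℝ} {f g : ℝ → L2Torus}
    (hf : ∀ k, AEMeasurable (fun t => coef k (f t)) μ)
    (hg : ∀ k, AEMeasurable (fun t => coef k (g t)) μ) :
    AEMeasurable (fun t => bilin B₁ B₂ m t k₃ (f t) (g t)) μ := by
  have hwave (k : ℤ) : AEMeasurable (fun t => wave t k) μ := (continuous_wave k).aemeasurable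
  simp_rw [bilin_apply]
  fun_prop

lemma bilin_apply_of_sum_eq_zero (hm : ∀ k₁ k₂, m k₁ k₂ k₃ ≠ 0 → k₁ + k₂ + k₃ = 0)
    (φ ψ : L2Torus) : bilin B₁ B₂ m t k₃ φ ψ =
      ∑ k₁ ∈ B₁ with -k₃ - k₁ ∈ B₂ ∧ m k₁ (-k₃ - k₁) k₃ ≠ 0,
        m k₁ (-k₃ - k₁) k₃ * (coef k₁ φ * coef (-k₃ - k₁) ψ) *
          (wave t k₁ * wave t (-k₃ - k₁)) := by
  have hm_zero (k₁ k₂ : ℤ) (hk : k₂ ≠ -k₃ - k₁) : m k₁ k₂ k₃ = 0 := by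
    by_contra h
    have := hm k₁ k₂ h
    omega
  rw [bilin_apply, Finset.sum_filter]
  refine Finset.sum_congr rfl fun k₁ _ => ?_
  split_ifs with h
  · rw [Finset.sum_eq_single_of_mem _ h.1 fun k₂ _ hk => by simp only [hm_zero k₁ k₂ hk, zero_mul]]
    ring
  · refine Finset.sum_eq_zero fun k₂ hk₂ => ?_
    have : m k₁ k₂ k₃ = 0 := by
      by_cases hk : k₂ = -k₃ - k₁
      · subst hk
        exact not_not.mp fun hne => h ⟨hk₂, hne⟩
      · exact hm_zero k₁ k₂ hk
    simp only [this, zero_mul]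

variable {B₁ B₂ m k₃} {M : ℝ≥0∞} {N α β : ℝ}

lemma lintegral_enorm_sq_bilin_le (hN : 0 < N) (hm : ∀ k₁ k₂, ‖m k₁ k₂ k₃‖ₑ ≤ M)
    (hsupp : ∀ k₁ k₂, m k₁ k₂ k₃ ≠ 0 → k₁ + k₂ + k₃ = 0 ∧ Transversal N k₁ k₂)
    (hαβ : β - α ≤ 1 / N) (φ ψ : L2Torus) :
    ∫⁻ t in Ioo α β, ‖bilin B₁ B₂ m t k₃ φ ψ‖ₑ ^ 2 ≤ ENNReal.ofReal (2 * sieveConst / N) *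
      ∑ k₁ ∈ B₁, M ^ 2 * (‖coef k₁ φ‖ₑ ^ 2 * ‖coef (-k₃ - k₁) ψ‖ₑ ^ 2) := by
  simp_rw [bilin_apply_of_sum_eq_zero B₁ B₂ m _ k₃ fun k₁ k₂ h => (hsupp k₁ k₂ h).1]
  refine (lintegral_enorm_sq_waves_le _ _ (-k₃) hN hαβ fun k hk =>
    (hsupp _ _ (Finset.mem_filter.mp hk).2.2).2).trans ?_
  gcongr
  refine (Finset.sum_le_sum_of_subset (Finset.filter_subset _ _)).trans
    (Finset.sum_le_sum fun k₁ _ => ?_)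
  simp only [enorm_mul, mul_pow]
  gcongr
  exact hm _ _

variable {B₃ : Finset ℤ} (hN : 0 < N) (hm : ∀ k₁ k₂ k₃, ‖m k₁ k₂ k₃‖ₑ ≤ M)
  (hsupp : ∀ k₁ k₂ k₃, m k₁ k₂ k₃ ≠ 0 → k₁ + k₂ + k₃ = 0 ∧ Transversal N k₁ k₂)
  (hαβ : β - α ≤ 1 / N)

include hN hm hsupp hαβ

lemma lintegral_sum_enorm_sq_bilin_le (φ ψ : L2Torus) :
    ∫⁻ t in Ioo α β, ∑ k₃ ∈ B₃, ‖bilin B₁ B₂ m t k₃ φ ψ‖ₑ ^ 2 ≤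
      ENNReal.ofReal (2 * sieveConst / N) * M ^ 2 * ‖φ‖ₑ ^ 2 * ‖ψ‖ₑ ^ 2 := by
  rw [lintegral_finsetSum' _ fun k₃ _ => (aemeasurable_bilin B₁ B₂ m k₃
    (fun _ => aemeasurable_const) (fun _ => aemeasurable_const)).enorm.pow_const 2]
  refine (Finset.sum_le_sum fun k₃ _ => lintegral_enorm_sq_bilin_le hN (fun k₁ k₂ => hm k₁ k₂ k₃)
    (fun k₁ k₂ => hsupp k₁ k₂ k₃) hαβ φ ψ).trans ?_
  rw [← Finset.mul_sum, Finset.sum_comm, mul_assoc, mul_assoc]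
  gcongr
  calc ∑ k₁ ∈ B₁, ∑ k₃ ∈ B₃, M ^ 2 * (‖coef k₁ φ‖ₑ ^ 2 * ‖coef (-k₃ - k₁) ψ‖ₑ ^ 2)
      ≤ ∑ k₁ ∈ B₁, M ^ 2 * (‖coef k₁ φ‖ₑ ^ 2 * ‖ψ‖ₑ ^ 2) := by
        refine Finset.sum_le_sum fun k₁ _ => ?_
        rw [← Finset.mul_sum, ← Finset.mul_sum]
        gcongr
        exact sum_enorm_coef_comp_sq_le B₃ (fun _ _ h => by simpa using h) ψ
    _ = M ^ 2 * ((∑ k₁ ∈ B₁, ‖coef k₁ φ‖ₑ ^ 2) * ‖ψ‖ₑ ^ 2) := by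
        rw [← Finset.mul_sum, ← Finset.sum_mul]
    _ ≤ M ^ 2 * (‖φ‖ₑ ^ 2 * ‖ψ‖ₑ ^ 2) := by
        gcongr
        exact sum_enorm_coef_sq_le B₁ φ

theorem lintegral_sum_enorm_sq_bilin_le_u2Norm (hM : M ≠ ⊤) {f g : ℝ → L2Torus}
    {a₁ b₁ a₂ b₂ : ℝ} (hf : u2Norm a₁ b₁ f ≠ ⊤) (hg : u2Norm a₂ b₂ g ≠ ⊤)
    (h₁ : Ioo α β ⊆ Ico a₁ b₁) (h₂ : Ioo α β ⊆ Ico a₂ b₂)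
    (hgm : ∀ k, AEMeasurable (fun t => coef k (g t)) (volume.restrict (Ioo α β))) :
    ∫⁻ t in Ioo α β, ∑ k₃ ∈ B₃, ‖bilin B₁ B₂ m t k₃ (f t) (g t)‖ₑ ^ 2 ≤
      ENNReal.ofReal (2 * sieveConst / N) * M ^ 2 * u2Norm a₁ b₁ f ^ 2 * u2Norm a₂ b₂ g ^ 2 :=
  lintegral_sum_bilinear_sq_le_u2Norm B₃ (by finiteness)
    (fun _ _ k₃ => (aemeasurable_bilin B₁ B₂ m k₃ (fun _ => aemeasurable_const)
      (fun _ => aemeasurable_const)).enorm)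
    (fun _ k₃ => (aemeasurable_bilin B₁ B₂ m k₃ (fun _ => aemeasurable_const) hgm).enorm)
    (lintegral_sum_enorm_sq_bilin_le hN hm hsupp hαβ)
    (ae_restrict_of_forall_mem measurableSet_Ioo h₁)
    (ae_restrict_of_forall_mem measurableSet_Ioo h₂) hf hg

end Bilinear

/-! ### The trilinear estimate on a short time interval -/

/-- The trilinear form with symbol `m`, evaluated at the free evolutions at time `t` of its three
arguments. -/
noncomputable def trilin (B₁ B₂ B₃ : Finset ℤ) (m : ℤ → ℤ → ℤ → ℂ) (t : ℝ)
    (φ ψ χ : L2Torus) : ℂ :=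
  ∑ k₁ ∈ B₁, ∑ k₂ ∈ B₂, ∑ k₃ ∈ B₃, m k₁ k₂ k₃ *
    ((wave t k₁ * coef k₁ φ) * (wave t k₂ * coef k₂ ψ) * (wave t k₃ * coef k₃ χ))

section Trilin

variable (B₁ B₂ B₃ : Finset ℤ) (m : ℤ → ℤ → ℤ → ℂ) (t : ℝ) (φ ψ χ : L2Torus)

lemma trilin_swap :
    trilin B₁ B₂ B₃ m t φ ψ χ = trilin B₁ B₃ B₂ (fun k₁ k₃ k₂ => m k₁ k₂ k₃) t φ χ ψ := by
  unfold trilin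
  refine Finset.sum_congr rfl fun k₁ _ => ?_
  rw [Finset.sum_comm]
  refine Finset.sum_congr rfl fun k₃ _ => Finset.sum_congr rfl fun k₂ _ => ?_
  ring

lemma trilin_rotate :
    trilin B₁ B₂ B₃ m t φ ψ χ = trilin B₂ B₃ B₁ (fun k₂ k₃ k₁ => m k₁ k₂ k₃) t ψ χ φ := by
  unfold trilin
  rw [Finset.sum_comm]
  refine Finset.sum_congr rfl fun k₂ _ => ?_
  rw [Finset.sum_comm]
  refine Finset.sum_congr rfl fun k₃ _ => Finset.sum_congr rfl fun k₁ _ => ?_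
  ring

lemma trilin_add (m' : ℤ → ℤ → ℤ → ℂ) :
    trilin B₁ B₂ B₃ (m + m') t φ ψ χ =
      trilin B₁ B₂ B₃ m t φ ψ χ + trilin B₁ B₂ B₃ m' t φ ψ χ := by
  simp only [trilin, ← Finset.sum_add_distrib, Pi.add_apply, add_mul]

lemma trilin_eq_sum_bilin :
    trilin B₁ B₂ B₃ m t φ ψ χ =
      ∑ k₃ ∈ B₃, (wave t k₃ * coef k₃ χ) * bilin B₁ B₂ m t k₃ φ ψ := by
  rw [trilin_rotate, trilin_rotate, trilin]
  simp only [bilin_apply, Finset.mul_sum]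
  refine Finset.sum_congr rfl fun k₃ _ => Finset.sum_congr rfl fun k₁ _ =>
    Finset.sum_congr rfl fun k₂ _ => ?_
  ring

lemma enorm_trilin_sq_le :
    ‖trilin B₁ B₂ B₃ m t φ ψ χ‖ₑ ^ 2 ≤
      ‖χ‖ₑ ^ 2 * ∑ k₃ ∈ B₃, ‖bilin B₁ B₂ m t k₃ φ ψ‖ₑ ^ 2 := by
  rw [trilin_eq_sum_bilin]
  calc _ ≤ (∑ k₃ ∈ B₃, ‖coef k₃ χ‖ₑ * ‖bilin B₁ B₂ m t k₃ φ ψ‖ₑ) ^ 2 := by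
        gcongr
        refine (enorm_sum_le _ _).trans_eq (Finset.sum_congr rfl fun k₃ _ => ?_)
        rw [enorm_mul, enorm_mul, enorm_wave, one_mul]
    _ ≤ _ := by
        refine (ennreal_sum_mul_sq_le _ _ _).trans ?_
        gcongr
        exact sum_enorm_coef_sq_le B₃ χ

lemma aemeasurable_trilin {μ : Measure ℝ} {f g h : ℝ → L2Torus}
    (hf : ∀ k, AEMeasurable (fun t => coef k (f t)) μ)
    (hg : ∀ k, AEMeasurable (fun t => coef k (g t)) μ)
    (hh : ∀ k, AEMeasurable (fun t => coef k (h t)) μ) :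
    AEMeasurable (fun t => trilin B₁ B₂ B₃ m t (f t) (g t) (h t)) μ := by
  have hwave (k : ℤ) : AEMeasurable (fun t => wave t k) μ := (continuous_wave k).aemeasurable
  unfold trilin
  fun_prop

end Trilin

lemma lintegral_sq_le_lintegral_sq_mul {α : Type*} [MeasurableSpace α] {μ : Measure α}
    {F : α → ℝ≥0∞} (hF : AEMeasurable F μ) :
    (∫⁻ x, F x ∂μ) ^ 2 ≤ (∫⁻ x, F x ^ 2 ∂μ) * μ univ := by
  have holder := ENNReal.lintegral_mul_le_Lp_mul_Lq μ Real.HolderConjugate.two_two (f := F)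
    (g := 1) hF aemeasurable_const
  simp only [mul_one, Pi.one_apply, ENNReal.one_rpow, lintegral_const, one_mul] at holder
  calc _ ≤ ((∫⁻ x, F x ^ (2 : ℝ) ∂μ) ^ (1 / 2 : ℝ) * μ univ ^ (1 / 2 : ℝ)) ^ 2 := by gcongr
    _ = _ := by
        rw [mul_pow, ← ENNReal.rpow_natCast, ← ENNReal.rpow_natCast, ← ENNReal.rpow_mul,
          ← ENNReal.rpow_mul]
        norm_num

/-- `f` is measurable on `(α, β)`, and its `U²` norm is at most `A` on some interval containing
`(α, β)`. The interval is left free because each frequency block comes with its own windows. -/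
structure U2BoundedOn (α β : ℝ) (f : ℝ → L2Torus) (A : ℝ≥0∞) : Prop where
  aemeasurable_coef (k : ℤ) : AEMeasurable (fun t => coef k (f t)) (volume.restrict (Ioo α β))
  exists_u2Norm_le : ∃ a b, Ioo α β ⊆ Ico a b ∧ u2Norm a b f ≤ A

lemma U2BoundedOn.enorm_le {α β t : ℝ} {f : ℝ → L2Torus} {A : ℝ≥0∞} (hf : U2BoundedOn α β f A)
    (ht : t ∈ Ioo α β) : ‖f t‖ₑ ≤ A := by
  obtain ⟨a, b, hsub, hle⟩ := hf.exists_u2Norm_le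
  exact (enorm_le_u2Norm (hsub ht)).trans hle

section Window

variable {B₁ B₂ B₃ : Finset ℤ} {m : ℤ → ℤ → ℤ → ℂ} {M : ℝ≥0∞} {N α β : ℝ}
  {f g h : ℝ → L2Torus} {A B C : ℝ≥0∞}

lemma lintegral_enorm_trilin_le_ite_add (hf : U2BoundedOn α β f A) (hg : U2BoundedOn α β g B)
    (hh : U2BoundedOn α β h C) (m : ℤ → ℤ → ℤ → ℂ) (p : ℤ → ℤ → ℤ → Prop)
    [∀ k₁ k₂ k₃, Decidable (p k₁ k₂ k₃)] :
    ∫⁻ t in Ioo α β, ‖trilin B₁ B₂ B₃ m t (f t) (g t) (h t)‖ₑ ≤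
      (∫⁻ t in Ioo α β, ‖trilin B₁ B₂ B₃ (fun k₁ k₂ k₃ => if p k₁ k₂ k₃ then m k₁ k₂ k₃ else 0)
        t (f t) (g t) (h t)‖ₑ) +
      ∫⁻ t in Ioo α β, ‖trilin B₁ B₂ B₃ (fun k₁ k₂ k₃ => if ¬ p k₁ k₂ k₃ then m k₁ k₂ k₃ else 0)
        t (f t) (g t) (h t)‖ₑ := by
  rw [← lintegral_add_left' (aemeasurable_trilin _ _ _ _ hf.aemeasurable_coef
    hg.aemeasurable_coef hh.aemeasurable_coef).enorm]
  refine lintegral_mono fun t => le_of_eq_of_le ?_ (enorm_add_le _ _)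
  rw [← trilin_add]
  congr 2
  ext k₁ k₂ k₃
  by_cases hp : p k₁ k₂ k₃ <;> simp [hp]

variable (hN : 0 < N) (hM : M ≠ ⊤) (hm : ∀ k₁ k₂ k₃, ‖m k₁ k₂ k₃‖ₑ ≤ M)
  (hαβ : β - α ≤ 1 / N) (hf : U2BoundedOn α β f A) (hg : U2BoundedOn α β g B)
  (hh : U2BoundedOn α β h C)

include hN hM hm hαβ hf hg hh

lemma lintegral_enorm_trilin_le_of_transversal₁₂ (hA : A ≠ ⊤) (hB : B ≠ ⊤)
    (hsupp : ∀ k₁ k₂ k₃, m k₁ k₂ k₃ ≠ 0 → k₁ + k₂ + k₃ = 0 ∧ Transversal N k₁ k₂) :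
    ∫⁻ t in Ioo α β, ‖trilin B₁ B₂ B₃ m t (f t) (g t) (h t)‖ₑ ≤
      ENNReal.ofReal (√(2 * sieveConst) / N) * M * (A * B * C) := by
  have hsieve := sieveConst_nonneg
  obtain ⟨a₁, b₁, hsub₁, hle₁⟩ := hf.exists_u2Norm_le
  obtain ⟨a₂, b₂, hsub₂, hle₂⟩ := hg.exists_u2Norm_le
  have htrilin := aemeasurable_trilin B₁ B₂ B₃ m hf.aemeasurable_coef hg.aemeasurable_coef
    hh.aemeasurable_coef
  have hbilin (k₃ : ℤ) := aemeasurable_bilin B₁ B₂ m k₃ hf.aemeasurable_coef hg.aemeasurable_coef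
  refine (ENNReal.pow_le_pow_left_iff two_ne_zero).mp
    ((lintegral_sq_le_lintegral_sq_mul htrilin.enorm).trans ?_)
  rw [Measure.restrict_apply_univ, Real.volume_Ioo]
  calc (∫⁻ t in Ioo α β, ‖trilin B₁ B₂ B₃ m t (f t) (g t) (h t)‖ₑ ^ 2) * ENNReal.ofReal (β - α)
      ≤ (∫⁻ t in Ioo α β, C ^ 2 * ∑ k₃ ∈ B₃, ‖bilin B₁ B₂ m t k₃ (f t) (g t)‖ₑ ^ 2) *
          ENNReal.ofReal (1 / N) := by
        gcongr ?_ * ENNReal.ofReal ?_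
        refine setLIntegral_mono' measurableSet_Ioo fun t ht =>
          (enorm_trilin_sq_le _ _ _ _ _ _ _ _).trans ?_
        gcongr
        exact hh.enorm_le ht
    _ ≤ (C ^ 2 * (ENNReal.ofReal (2 * sieveConst / N) * M ^ 2 * A ^ 2 * B ^ 2)) *
          ENNReal.ofReal (1 / N) := by
        rw [lintegral_const_mul'' _ (Finset.aemeasurable_fun_sum _ fun k₃ _ =>
          (hbilin k₃).enorm.pow_const 2)]
        gcongr
        refine (lintegral_sum_enorm_sq_bilin_le_u2Norm hN hm hsupp hαβ hM
          (ne_top_of_le_ne_top hA hle₁) (ne_top_of_le_ne_top hB hle₂) hsub₁ hsub₂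
          hg.aemeasurable_coef).trans ?_
        gcongr
    _ = (ENNReal.ofReal (2 * sieveConst / N) * ENNReal.ofReal (1 / N)) * (M * (A * B * C)) ^ 2 := by
        ring
    _ = (ENNReal.ofReal (√(2 * sieveConst) / N) * M * (A * B * C)) ^ 2 := by
        rw [mul_assoc (ENNReal.ofReal _) M, mul_pow (ENNReal.ofReal _),
          ← ENNReal.ofReal_pow (by positivity), div_pow, Real.sq_sqrt (by positivity),
          ← ENNReal.ofReal_mul (by positivity)]
        congr 2
        field_simp

lemma lintegral_enorm_trilin_le_of_transversal₁₃ (hA : A ≠ ⊤) (hC : C ≠ ⊤)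
    (hsupp : ∀ k₁ k₂ k₃, m k₁ k₂ k₃ ≠ 0 → k₁ + k₂ + k₃ = 0 ∧ Transversal N k₁ k₃) :
    ∫⁻ t in Ioo α β, ‖trilin B₁ B₂ B₃ m t (f t) (g t) (h t)‖ₑ ≤
      ENNReal.ofReal (√(2 * sieveConst) / N) * M * (A * B * C) := by
  simp_rw [trilin_swap B₁ B₂ B₃ m, mul_right_comm A B C]
  exact lintegral_enorm_trilin_le_of_transversal₁₂ hN hM (fun k₁ k₃ k₂ => hm k₁ k₂ k₃) hαβ hf hh hg
    hA hC fun k₁ k₃ k₂ hne => ⟨add_right_comm k₁ k₂ k₃ ▸ (hsupp _ _ _ hne).1, (hsupp _ _ _ hne).2⟩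

lemma lintegral_enorm_trilin_le_of_transversal₂₃ (hB : B ≠ ⊤) (hC : C ≠ ⊤)
    (hsupp : ∀ k₁ k₂ k₃, m k₁ k₂ k₃ ≠ 0 → k₁ + k₂ + k₃ = 0 ∧ Transversal N k₂ k₃) :
    ∫⁻ t in Ioo α β, ‖trilin B₁ B₂ B₃ m t (f t) (g t) (h t)‖ₑ ≤
      ENNReal.ofReal (√(2 * sieveConst) / N) * M * (A * B * C) := by
  simp_rw [trilin_rotate B₁ B₂ B₃ m, mul_assoc A B C, mul_comm A (B * C)]
  exact lintegral_enorm_trilin_le_of_transversal₁₂ hN hM (fun k₂ k₃ k₁ => hm k₁ k₂ k₃) hαβ hg hh hf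
    hB hC fun k₂ k₃ k₁ hne => ⟨by linarith [(hsupp _ _ _ hne).1], (hsupp _ _ _ hne).2⟩

lemma lintegral_enorm_trilin_le (hA : A ≠ ⊤) (hB : B ≠ ⊤) (hC : C ≠ ⊤)
    (hsupp : ∀ k₁ k₂ k₃, m k₁ k₂ k₃ ≠ 0 → k₁ + k₂ + k₃ = 0 ∧
      (Transversal N k₁ k₂ ∨ Transversal N k₁ k₃ ∨ Transversal N k₂ k₃)) :
    ∫⁻ t in Ioo α β, ‖trilin B₁ B₂ B₃ m t (f t) (g t) (h t)‖ₑ ≤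
      3 * (ENNReal.ofReal (√(2 * sieveConst) / N) * M * (A * B * C)) := by
  classical
  have hcut {m' : ℤ → ℤ → ℤ → ℂ} (hm' : ∀ k₁ k₂ k₃, ‖m' k₁ k₂ k₃‖ₑ ≤ M)
      (p : ℤ → ℤ → ℤ → Prop) [∀ k₁ k₂ k₃, Decidable (p k₁ k₂ k₃)] (k₁ k₂ k₃ : ℤ) :
      ‖if p k₁ k₂ k₃ then m' k₁ k₂ k₃ else 0‖ₑ ≤ M := by
    split_ifs
    exacts [hm' _ _ _, by simp]
  have h₁₂ := lintegral_enorm_trilin_le_of_transversal₁₂ (B₁ := B₁) (B₂ := B₂) (B₃ := B₃) hN hM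
    (hcut hm fun k₁ k₂ _ => Transversal N k₁ k₂) hαβ hf hg hh hA hB fun k₁ k₂ k₃ hne =>
      ⟨(hsupp _ _ _ (ite_ne_right_iff.mp hne).2).1, (ite_ne_right_iff.mp hne).1⟩
  have hm' := hcut hm fun k₁ k₂ _ => ¬ Transversal N k₁ k₂
  have h₁₃ := lintegral_enorm_trilin_le_of_transversal₁₃ (B₁ := B₁) (B₂ := B₂) (B₃ := B₃) hN hM
    (hcut hm' fun k₁ _ k₃ => Transversal N k₁ k₃) hαβ hf hg hh hA hC fun k₁ k₂ k₃ hne => by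
      simp only [ite_ne_right_iff] at hne
      exact ⟨(hsupp _ _ _ hne.2.2).1, hne.1⟩
  have h₂₃ := lintegral_enorm_trilin_le_of_transversal₂₃ (B₁ := B₁) (B₂ := B₂) (B₃ := B₃) hN hM
    (hcut hm' fun k₁ _ k₃ => ¬ Transversal N k₁ k₃) hαβ hf hg hh hB hC fun k₁ k₂ k₃ hne => by
      simp only [ite_ne_right_iff] at hne
      have := hsupp _ _ _ hne.2.2
      exact ⟨this.1, (this.2.resolve_left hne.2.1).resolve_left hne.1⟩
  refine (lintegral_enorm_trilin_le_ite_add hf hg hh m fun k₁ k₂ _ => Transversal N k₁ k₂).trans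
    ((add_le_add h₁₂ ((lintegral_enorm_trilin_le_ite_add hf hg hh _ fun k₁ _ k₃ =>
      Transversal N k₁ k₃).trans (add_le_add h₁₃ h₂₃))).trans_eq ?_)
  ring

end Window

/-! ### The trilinear estimate for dyadic blocks -/

lemma coef_fourierLp (k l : ℤ) : coef k (fourierLp 2 l) = if k = l then 1 else 0 :=
  orthonormal_iff_ite.mp (orthonormal_fourier (T := 2 * π)) k l

lemma coef_profileBlock {j : ℕ} {k : ℤ} (hk : k ∈ block j) (t : ℝ) (f : Torus → ℝ) :
    coef k (profileBlock j t f) =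
      Complex.exp (Complex.I * (t : ℂ) * ((k * |k| : ℤ) : ℂ)) * fhat f k := by
  simp only [profileBlock, map_sum, map_smul, coef_fourierLp, smul_eq_mul, mul_ite, mul_one,
    mul_zero]
  rw [Finset.sum_ite_eq, if_pos hk]

lemma coef_profileBlock_of_notMem {j : ℕ} {k : ℤ} (hk : k ∉ block j) (t : ℝ) (f : Torus → ℝ) :
    coef k (profileBlock j t f) = 0 := by
  simp only [profileBlock, map_sum, map_smul, coef_fourierLp, smul_eq_mul, mul_ite, mul_one,
    mul_zero]
  rw [Finset.sum_ite_eq, if_neg hk]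

lemma wave_mul_coef_profileBlock {j : ℕ} {k : ℤ} (hk : k ∈ block j) (t : ℝ) (f : Torus → ℝ) :
    wave t k * coef k (profileBlock j t f) = fhat f k := by
  rw [coef_profileBlock hk, wave, ← mul_assoc, ← Complex.exp_add, neg_add_cancel, Complex.exp_zero,
    one_mul]

lemma enorm_fhat_le_profileBlock {j : ℕ} {k : ℤ} (hk : k ∈ block j) (t : ℝ) (f : Torus → ℝ) :
    ‖fhat f k‖ₑ ≤ ‖profileBlock j t f‖ₑ := by
  have bessel := sum_enorm_coef_sq_le {k} (profileBlock j t f)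
  rw [Finset.sum_singleton] at bessel
  rw [← wave_mul_coef_profileBlock hk t f, enorm_mul, enorm_wave, one_mul]
  exact (ENNReal.pow_le_pow_left_iff two_ne_zero).mp bessel

lemma trilin_profileBlock (j₁ j₂ j₃ : ℕ) (m : ℤ → ℤ → ℤ → ℂ) (t : ℝ) (f₁ f₂ f₃ : Torus → ℝ) :
    trilin (block j₁) (block j₂) (block j₃) m t (profileBlock j₁ t f₁) (profileBlock j₂ t f₂)
      (profileBlock j₃ t f₃) = ∑ k₁ ∈ block j₁, ∑ k₂ ∈ block j₂, ∑ k₃ ∈ block j₃,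
        m k₁ k₂ k₃ * (fhat f₁ k₁ * fhat f₂ k₂ * fhat f₃ k₃) := by
  unfold trilin
  refine Finset.sum_congr rfl fun k₁ h₁ => Finset.sum_congr rfl fun k₂ h₂ =>
    Finset.sum_congr rfl fun k₃ h₃ => ?_
  rw [wave_mul_coef_profileBlock h₁, wave_mul_coef_profileBlock h₂, wave_mul_coef_profileBlock h₃]

lemma mem_block_iff_log {j : ℕ} {k : ℤ} : k ∈ block j ↔ Nat.log 2 k.natAbs = j := by
  have hblock : k ∈ block j ↔ k.natAbs < 2 ^ (j + 1) ∧ (j = 0 ∨ 2 ^ j ≤ k.natAbs) := by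
    simp only [block, Finset.mem_filter, Finset.mem_Ioo, ← abs_lt, Int.abs_eq_natAbs]
    norm_cast
  rw [hblock]
  rcases Nat.eq_zero_or_pos j with rfl | hj
  · simp [Nat.log_eq_zero_iff]
  · rw [Nat.log_eq_iff (Or.inl hj.ne'), or_iff_right hj.ne', and_comm]

lemma two_pow_le_abs_of_mem_block {j : ℕ} {k : ℤ} (hk : k ∈ block j) (hk0 : k ≠ 0) :
    (2 : ℤ) ^ j ≤ |k| := by
  rw [← mem_block_iff_log.mp hk, Int.abs_eq_natAbs]
  exact_mod_cast Nat.pow_log_le_self 2 (Int.natAbs_ne_zero.mpr hk0)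

lemma abs_lt_of_mem_block {j : ℕ} {k : ℤ} (hk : k ∈ block j) : |k| < (2 : ℤ) ^ (j + 1) := by
  simp only [block, Finset.mem_filter, Finset.mem_Ioo] at hk
  exact abs_lt.mpr hk.1

/-- The largest of the three moduli is the sum of the two others, hence at least twice the
smallest. -/
lemma exists_transversal_of_sum_eq_zero {N : ℝ} {k₁ k₂ k₃ : ℤ} (h0 : k₁ + k₂ + k₃ = 0)
    (hN : N ≤ |(k₁ : ℝ)| ∨ N ≤ |(k₂ : ℝ)| ∨ N ≤ |(k₃ : ℝ)|) :
    Transversal N k₁ k₂ ∨ Transversal N k₁ k₃ ∨ Transversal N k₂ k₃ := by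
  have h0' : (k₁ : ℝ) + k₂ + k₃ = 0 := by exact_mod_cast h0
  unfold Transversal
  grind

lemma exists_transversal_of_mem_block {j₁ j₂ j₃ : ℕ} {k₁ k₂ k₃ : ℤ} (h0 : k₁ + k₂ + k₃ = 0)
    (h₁ : k₁ ∈ block j₁ ∧ k₁ ≠ 0) (h₂ : k₂ ∈ block j₂ ∧ k₂ ≠ 0) (h₃ : k₃ ∈ block j₃ ∧ k₃ ≠ 0) :
    Transversal (2 ^ max j₁ (max j₂ j₃)) k₁ k₂ ∨ Transversal (2 ^ max j₁ (max j₂ j₃)) k₁ k₃ ∨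
      Transversal (2 ^ max j₁ (max j₂ j₃)) k₂ k₃ := by
  have hpow {j : ℕ} {k : ℤ} (h : k ∈ block j ∧ k ≠ 0) : (2 : ℝ) ^ j ≤ |(k : ℝ)| := by
    exact_mod_cast two_pow_le_abs_of_mem_block h.1 h.2
  refine exists_transversal_of_sum_eq_zero h0 ?_
  rcases max_choice j₁ (max j₂ j₃) with h | h <;> rw [h]
  · exact Or.inl (hpow h₁)
  · rcases max_choice j₂ j₃ with h' | h' <;> rw [h']
    exacts [Or.inr (Or.inl (hpow h₂)), Or.inr (Or.inr (hpow h₃))]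

/-- The largest `U²` norm of the block `j` of `u` over the windows of that block: the supremum in
the definition of `FNorm`. -/
noncomputable def blockNorm (T : ℝ) (u : ℝ → Torus → ℝ) (j : ℕ) : ℝ≥0∞ :=
  ⨆ (a : ℝ) (_ : 0 ≤ a) (_ : a + windowLength T j ≤ T),
    u2Norm a (a + windowLength T j) (fun t => profileBlock j t (u t))

lemma u2Norm_le_blockNorm {T a : ℝ} (u : ℝ → Torus → ℝ) (j : ℕ) (ha : 0 ≤ a)
    (ha' : a + windowLength T j ≤ T) :
    u2Norm a (a + windowLength T j) (fun t => profileBlock j t (u t)) ≤ blockNorm T u j :=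
  le_iSup₂_of_le a ha (le_iSup (fun _ => u2Norm a (a + windowLength T j)
    (fun t => profileBlock j t (u t))) ha')

lemma windowLength_pos {T : ℝ} (hT : 0 < T) (j : ℕ) : 0 < windowLength T j :=
  lt_min (by positivity) hT

lemma windowLength_anti (T : ℝ) : Antitone (windowLength T) := fun i j hij =>
  min_le_min_right _ (inv_anti₀ (by positivity) (pow_le_pow_right₀ one_le_two hij))

lemma exists_window {T : ℝ} (j : ℕ) {α β : ℝ} (hα : 0 ≤ α) (hβ : β ≤ T)
    (hαβ : β - α ≤ windowLength T j) :
    ∃ a, 0 ≤ a ∧ a + windowLength T j ≤ T ∧ Ioo α β ⊆ Ico a (a + windowLength T j) := by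
  have hL : windowLength T j ≤ T := min_le_right _ _
  refine ⟨min α (T - windowLength T j), le_min hα (by linarith), ?_, fun t ht => ?_⟩
  · linarith [min_le_right α (T - windowLength T j)]
  · refine ⟨(min_le_left _ _).trans ht.1.le, ?_⟩
    rcases min_choice α (T - windowLength T j) with h | h <;> rw [h] <;> linarith [ht.2]

lemma fhat_eq_zero_of_blockNorm_eq_zero {T : ℝ} {u : ℝ → Torus → ℝ} {j : ℕ}
    (h : blockNorm T u j = 0) {t : ℝ} (ht : t ∈ Ioo 0 T) {k : ℤ} (hk : k ∈ block j) :
    fhat (u t) k = 0 := by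
  have hL := windowLength_pos (ht.1.trans ht.2) j
  set β := min T (t + windowLength T j / 2)
  have hβ : t < β := lt_min ht.2 (by linarith)
  obtain ⟨a, ha, ha', hsub⟩ := exists_window (T := T) j (α := max 0 (t - windowLength T j / 2))
    (le_max_left _ _) (min_le_left _ _ : β ≤ T)
    (by linarith [min_le_right T (t + windowLength T j / 2),
      le_max_right 0 (t - windowLength T j / 2)])
  have hmem := hsub (show t ∈ Ioo _ β from ⟨max_lt ht.1 (by linarith), hβ⟩)
  rw [← enorm_eq_zero, ← nonpos_iff_eq_zero, ← h]
  exact (enorm_fhat_le_profileBlock hk t (u t)).trans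
    ((enorm_le_u2Norm (f := fun t => profileBlock j t (u t)) hmem).trans
      (u2Norm_le_blockNorm u j ha ha'))

lemma aemeasurable_coef_profileBlock {T : ℝ} {u : ℝ → Torus → ℝ}
    (hu : ∀ k, ContinuousOn (fun t => fhat (u t) k) (Icc 0 T)) (j : ℕ) {α β : ℝ} (hα : 0 ≤ α)
    (hβ : β ≤ T) (k : ℤ) :
    AEMeasurable (fun t => coef k (profileBlock j t (u t))) (volume.restrict (Ioo α β)) := by
  by_cases hk : k ∈ block j
  · simp_rw [coef_profileBlock hk]
    refine ContinuousOn.aemeasurable ?_ measurableSet_Ioo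
    refine ContinuousOn.mul (Continuous.continuousOn (by fun_prop)) ((hu k).mono ?_)
    exact fun t ht => ⟨hα.trans ht.1.le, ht.2.le.trans hβ⟩
  · simp_rw [coef_profileBlock_of_notMem hk]
    exact aemeasurable_const

lemma u2BoundedOn_profileBlock {T : ℝ} {u : ℝ → Torus → ℝ}
    (hu : ∀ k, ContinuousOn (fun t => fhat (u t) k) (Icc 0 T)) {j : ℕ} {α β : ℝ} (hα : 0 ≤ α)
    (hβ : β ≤ T) (hαβ : β - α ≤ windowLength T j) :
    U2BoundedOn α β (fun t => profileBlock j t (u t)) (blockNorm T u j) where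
  aemeasurable_coef := aemeasurable_coef_profileBlock hu j hα hβ
  exists_u2Norm_le :=
    have ⟨a, ha, ha', hsub⟩ := exists_window j hα hβ hαβ
    ⟨a, _, hsub, u2Norm_le_blockNorm u j ha ha'⟩

lemma enorm_intervalIntegral_le_ceil_mul {E : Type*} [NormedAddCommGroup E] [NormedSpace ℝ E]
    {G : ℝ → E} {t₀ L : ℝ} {A : ℝ≥0∞} (ht₀ : 0 ≤ t₀) (hL : 0 < L)
    (hG : IntervalIntegrable G volume 0 t₀)
    (hA : ∀ α β, 0 ≤ α → α ≤ β → β ≤ t₀ → β - α ≤ L → ‖∫ t in α..β, G t‖ₑ ≤ A) :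
    ‖∫ t in 0..t₀, G t‖ₑ ≤ ⌈t₀ / L⌉₊ * A := by
  rcases ht₀.eq_or_lt with rfl | ht₀
  · simp
  set n := ⌈t₀ / L⌉₊
  have hn : (0 : ℝ) < n := by exact_mod_cast Nat.ceil_pos.mpr (div_pos ht₀ hL)
  have hstep : t₀ / n ≤ L := by
    rw [div_le_iff₀ hn, mul_comm, ← div_le_iff₀ hL]
    exact Nat.le_ceil _
  set p : ℕ → ℝ := fun i => i * (t₀ / n) with hp
  have hp_nonneg (i : ℕ) : 0 ≤ p i := by positivity
  have hp_succ (i : ℕ) : p (i + 1) - p i = t₀ / n := by simp only [hp]; push_cast; ring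
  have hp_le_succ (i : ℕ) : p i ≤ p (i + 1) := sub_nonneg.mp (hp_succ i ▸ by positivity)
  have hp_last : p n = t₀ := by simp only [hp]; field_simp
  have hp_le {i : ℕ} (hi : i ≤ n) : p i ≤ t₀ :=
    (monotone_nat_of_le_succ hp_le_succ hi).trans_eq hp_last
  have hint (i : ℕ) (hi : i < n) : IntervalIntegrable G volume (p i) (p (i + 1)) := by
    refine hG.mono_set ?_
    rw [uIcc_of_le (hp_le_succ i), uIcc_of_le ht₀.le]
    exact Icc_subset_Icc (hp_nonneg i) (hp_le hi)
  have hadj := intervalIntegral.sum_integral_adjacent_intervals hint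
  rw [hp_last, show p 0 = 0 by simp [hp]] at hadj
  rw [← hadj]
  calc _ ≤ ∑ i ∈ Finset.range n, ‖∫ t in p i..p (i + 1), G t‖ₑ := enorm_sum_le _ _
    _ ≤ ∑ _i ∈ Finset.range n, A := Finset.sum_le_sum fun i hi =>
        hA _ _ (hp_nonneg i) (hp_le_succ i) (hp_le (Finset.mem_range.mp hi))
          ((hp_succ i).trans_le hstep)
    _ = n * A := by rw [Finset.sum_const, Finset.card_range, nsmul_eq_mul]

lemma ceil_div_windowLength_le {T t₀ : ℝ} (hT : 0 < T) (hT1 : T ≤ 1) (ht₀ : t₀ ∈ Icc 0 T) (j : ℕ) :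
    (⌈t₀ / windowLength T j⌉₊ : ℝ) ≤ 2 * 2 ^ j := by
  have hL := windowLength_pos hT j
  have hpow : (1 : ℝ) ≤ 2 ^ j := one_le_pow₀ one_le_two
  have hdiv : t₀ / windowLength T j ≤ 2 ^ j := by
    rw [div_le_iff₀ hL, windowLength, mul_min_of_nonneg _ _ (by positivity),
      mul_inv_cancel₀ (by positivity)]
    exact le_min (ht₀.2.trans hT1) (ht₀.2.trans (le_mul_of_one_le_left hT.le hpow))
  linarith [Nat.ceil_lt_add_one (div_nonneg ht₀.1 hL.le)]

/-- The constant of the trilinear estimate. The summand `1` makes it nonzero, so that the estimate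
is not empty when a block norm is infinite. -/
noncomputable def trilinConst : ℝ≥0∞ := 1 + ENNReal.ofReal (6 * √(2 * sieveConst))

lemma ofReal_ceil_mul_le_trilinConst {T t₀ : ℝ} (hT : 0 < T) (hT1 : T ≤ 1) (ht₀ : t₀ ∈ Icc 0 T)
    (j : ℕ) : (⌈t₀ / windowLength T j⌉₊ : ℝ≥0∞) *
      (3 * ENNReal.ofReal (√(2 * sieveConst) / 2 ^ j)) ≤ trilinConst := by
  refine le_trans ?_ le_add_self
  rw [← ENNReal.ofReal_natCast, ← ENNReal.ofReal_ofNat 3, ← ENNReal.ofReal_mul (by positivity),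
    ← ENNReal.ofReal_mul (by positivity)]
  refine ENNReal.ofReal_le_ofReal ?_
  calc (⌈t₀ / windowLength T j⌉₊ : ℝ) * (3 * (√(2 * sieveConst) / 2 ^ j))
      ≤ (2 * 2 ^ j) * (3 * (√(2 * sieveConst) / 2 ^ j)) := by
        gcongr
        exact ceil_div_windowLength_le hT hT1 ht₀ j
    _ = 6 * √(2 * sieveConst) := by field_simp; ring

lemma sum_mul_integral_eq_integral_sum (B₁ B₂ B₃ : Finset ℤ) (m : ℤ → ℤ → ℤ → ℂ)
    {F : ℤ → ℤ → ℤ → ℝ → ℂ} {α β : ℝ}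
    (hF : ∀ k₁ k₂ k₃, IntervalIntegrable (F k₁ k₂ k₃) volume α β) :
    ∑ k₁ ∈ B₁, ∑ k₂ ∈ B₂, ∑ k₃ ∈ B₃, m k₁ k₂ k₃ * ∫ t in α..β, F k₁ k₂ k₃ t =
      ∫ t in α..β, ∑ k₁ ∈ B₁, ∑ k₂ ∈ B₂, ∑ k₃ ∈ B₃, m k₁ k₂ k₃ * F k₁ k₂ k₃ t := by
  have hint (p : ℤ × ℤ × ℤ) :
      IntervalIntegrable (fun t => m p.1 p.2.1 p.2.2 * F p.1 p.2.1 p.2.2 t) volume α β :=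
    (hF _ _ _).const_mul _
  simp only [← Finset.sum_product', ← intervalIntegral.integral_const_mul]
  exact (intervalIntegral.integral_finsetSum fun p _ => hint p).symm

section Blocks

variable {T t₀ : ℝ} {u₁ u₂ u₃ : ℝ → Torus → ℝ} {j₁ j₂ j₃ : ℕ} {m : ℤ → ℤ → ℤ → ℂ} {M : ℝ≥0∞}

lemma sum_integral_eq_zero_of_blockNorm_mul_eq_zero (ht₀ : t₀ ∈ Icc 0 T)
    (h : blockNorm T u₁ j₁ * blockNorm T u₂ j₂ * blockNorm T u₃ j₃ = 0) :
    ∑ k₁ ∈ block j₁, ∑ k₂ ∈ block j₂, ∑ k₃ ∈ block j₃, m k₁ k₂ k₃ *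
      ∫ t in 0..t₀, fhat (u₁ t) k₁ * fhat (u₂ t) k₂ * fhat (u₃ t) k₃ = 0 := by
  refine Finset.sum_eq_zero fun k₁ h₁ => Finset.sum_eq_zero fun k₂ h₂ =>
    Finset.sum_eq_zero fun k₃ h₃ => ?_
  rw [intervalIntegral.integral_of_le ht₀.1, integral_Ioc_eq_integral_Ioo,
    setIntegral_eq_zero_of_forall_eq_zero, mul_zero]
  intro t ht
  have ht' : t ∈ Ioo 0 T := ⟨ht.1, ht.2.trans_le ht₀.2⟩
  simp only [mul_eq_zero] at h ⊢
  exact h.imp (Or.imp (fhat_eq_zero_of_blockNorm_eq_zero · ht' h₁)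
    (fhat_eq_zero_of_blockNorm_eq_zero · ht' h₂)) (fhat_eq_zero_of_blockNorm_eq_zero · ht' h₃)

variable (hT : 0 < T) (hT1 : T ≤ 1)
  (hu₁ : ∀ k, ContinuousOn (fun t => fhat (u₁ t) k) (Icc 0 T))
  (hu₂ : ∀ k, ContinuousOn (fun t => fhat (u₂ t) k) (Icc 0 T))
  (hu₃ : ∀ k, ContinuousOn (fun t => fhat (u₃ t) k) (Icc 0 T))
  (hM : M ≠ ⊤) (hm : ∀ k₁ k₂ k₃, ‖m k₁ k₂ k₃‖ₑ ≤ M)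
  (hsupp : ∀ k₁ k₂ k₃, m k₁ k₂ k₃ ≠ 0 → k₁ + k₂ + k₃ = 0 ∧ (k₁ ∈ block j₁ ∧ k₁ ≠ 0) ∧
    (k₂ ∈ block j₂ ∧ k₂ ≠ 0) ∧ (k₃ ∈ block j₃ ∧ k₃ ≠ 0))

include hu₁ hu₂ hu₃ hM hm hsupp

lemma enorm_integral_trilin_le_of_length_le (hF₁ : blockNorm T u₁ j₁ ≠ ⊤)
    (hF₂ : blockNorm T u₂ j₂ ≠ ⊤) (hF₃ : blockNorm T u₃ j₃ ≠ ⊤) {α β : ℝ} (hα : 0 ≤ α)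
    (hαβ : α ≤ β) (hβ : β ≤ T) (hlen : β - α ≤ windowLength T (max j₁ (max j₂ j₃))) :
    ‖∫ t in α..β, trilin (block j₁) (block j₂) (block j₃) m t (profileBlock j₁ t (u₁ t))
        (profileBlock j₂ t (u₂ t)) (profileBlock j₃ t (u₃ t))‖ₑ ≤
      3 * (ENNReal.ofReal (√(2 * sieveConst) / 2 ^ max j₁ (max j₂ j₃)) * M *
        (blockNorm T u₁ j₁ * blockNorm T u₂ j₂ * blockNorm T u₃ j₃)) := by
  have hwindow {j : ℕ} (hj : j ≤ max j₁ (max j₂ j₃)) : β - α ≤ windowLength T j :=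
    hlen.trans (windowLength_anti T hj)
  rw [intervalIntegral.integral_of_le hαβ, integral_Ioc_eq_integral_Ioo]
  refine (enorm_integral_le_lintegral_enorm _).trans ?_
  refine lintegral_enorm_trilin_le (by positivity) hM hm
    (hlen.trans ((min_le_left _ _).trans_eq (one_div _).symm))
    (u2BoundedOn_profileBlock hu₁ hα hβ (hwindow (by simp)))
    (u2BoundedOn_profileBlock hu₂ hα hβ (hwindow (by simp)))
    (u2BoundedOn_profileBlock hu₃ hα hβ (hwindow (by simp))) hF₁ hF₂ hF₃ fun k₁ k₂ k₃ hne => ?_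
  obtain ⟨h0, h₁, h₂, h₃⟩ := hsupp k₁ k₂ k₃ hne
  exact ⟨h0, exists_transversal_of_mem_block h0 h₁ h₂ h₃⟩

include hT hT1

lemma enorm_sum_integral_le_of_ne_top (ht₀ : t₀ ∈ Icc 0 T) (hF₁ : blockNorm T u₁ j₁ ≠ ⊤)
    (hF₂ : blockNorm T u₂ j₂ ≠ ⊤) (hF₃ : blockNorm T u₃ j₃ ≠ ⊤) :
    ‖∑ k₁ ∈ block j₁, ∑ k₂ ∈ block j₂, ∑ k₃ ∈ block j₃, m k₁ k₂ k₃ *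
        ∫ t in 0..t₀, fhat (u₁ t) k₁ * fhat (u₂ t) k₂ * fhat (u₃ t) k₃‖ₑ ≤
      trilinConst * M * (blockNorm T u₁ j₁ * blockNorm T u₂ j₂ * blockNorm T u₃ j₃) := by
  have hsub : uIcc 0 t₀ ⊆ Icc 0 T := uIcc_of_le ht₀.1 ▸ Icc_subset_Icc_right ht₀.2
  have hcont (k₁ k₂ k₃ : ℤ) : ContinuousOn
      (fun t => fhat (u₁ t) k₁ * fhat (u₂ t) k₂ * fhat (u₃ t) k₃) (Icc 0 T) :=
    ((hu₁ k₁).mul (hu₂ k₂)).mul (hu₃ k₃)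
  rw [sum_mul_integral_eq_integral_sum _ _ _ _ fun k₁ k₂ k₃ =>
    ((hcont k₁ k₂ k₃).mono hsub).intervalIntegrable]
  have hint : IntervalIntegrable (fun t => ∑ k₁ ∈ block j₁, ∑ k₂ ∈ block j₂, ∑ k₃ ∈ block j₃,
      m k₁ k₂ k₃ * (fhat (u₁ t) k₁ * fhat (u₂ t) k₂ * fhat (u₃ t) k₃)) volume 0 t₀ :=
    ContinuousOn.intervalIntegrable <| ContinuousOn.mono (by fun_prop) hsub
  simp_rw [← fun t => trilin_profileBlock j₁ j₂ j₃ m t (u₁ t) (u₂ t) (u₃ t)] at hint ⊢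
  refine (enorm_intervalIntegral_le_ceil_mul ht₀.1 (windowLength_pos hT (max j₁ (max j₂ j₃))) hint
    fun α β hα hαβ hβ hlen => enorm_integral_trilin_le_of_length_le hu₁ hu₂ hu₃ hM hm hsupp
      hF₁ hF₂ hF₃ hα hαβ (hβ.trans ht₀.2) hlen).trans ?_
  rw [mul_assoc (ENNReal.ofReal _), ← mul_assoc 3, ← mul_assoc (Nat.cast _), mul_assoc trilinConst]
  gcongr
  exact ofReal_ceil_mul_le_trilinConst hT hT1 ht₀ _

/-- The interval splits into about `N` windows of length `1 / N`, where `N` is the largest of the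
three frequencies, and the estimate on a short interval gains `N⁻¹` on each. -/
theorem enorm_sum_integral_le (ht₀ : t₀ ∈ Icc 0 T) :
    ‖∑ k₁ ∈ block j₁, ∑ k₂ ∈ block j₂, ∑ k₃ ∈ block j₃, m k₁ k₂ k₃ *
        ∫ t in 0..t₀, fhat (u₁ t) k₁ * fhat (u₂ t) k₂ * fhat (u₃ t) k₃‖ₑ ≤
      trilinConst * M * (blockNorm T u₁ j₁ * blockNorm T u₂ j₂ * blockNorm T u₃ j₃) := by
  by_cases hF0 : blockNorm T u₁ j₁ * blockNorm T u₂ j₂ * blockNorm T u₃ j₃ = 0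
  · simp [sum_integral_eq_zero_of_blockNorm_mul_eq_zero ht₀ hF0]
  by_cases hF : blockNorm T u₁ j₁ * blockNorm T u₂ j₂ * blockNorm T u₃ j₃ = ⊤
  · rcases eq_or_ne M 0 with rfl | hM0
    · have hm0 (k₁ k₂ k₃ : ℤ) : m k₁ k₂ k₃ = 0 := by simpa using hm k₁ k₂ k₃
      simp [hm0]
    · have hconst : trilinConst ≠ 0 := by simp [trilinConst]
      rw [hF, ENNReal.mul_top (mul_ne_zero hconst hM0)]
      exact le_top
  · simp only [mul_eq_zero, not_or] at hF0
    obtain ⟨⟨hF₁0, hF₂0⟩, hF₃0⟩ := hF0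
    simp only [ENNReal.mul_eq_top, mul_ne_zero_iff, not_or, not_and] at hF
    refine enorm_sum_integral_le_of_ne_top hT hT1 hu₁ hu₂ hu₃ hM hm hsupp ht₀ ?_ ?_ ?_ <;> tauto

end Blocks

/-! ### Fourier coefficients of functions with a smooth lift -/

lemma continuous_of_continuous_lift {f : Torus → ℝ} (hf : Continuous fun x : ℝ => f x) :
    Continuous f :=
  (QuotientAddGroup.isQuotientMap_mk (N := AddSubgroup.zmultiples (2 * π))).continuous_iff.mpr hf

lemma norm_fourier_eq_one (n : ℤ) (x : Torus) : ‖fourier n x‖ = 1 := by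
  rw [fourier_apply]
  exact Circle.norm_coe _

lemma dx_coe (f : Torus → ℝ) (x : ℝ) : dx f x = deriv (fun y : ℝ => f y) x := by
  have htranslate := deriv_comp_const_add (f := fun y : ℝ => f y) x 0
  rw [add_zero] at htranslate
  rw [← htranslate, dx]
  simp only [AddCircle.coe_add]

lemma dx_of_hasDerivAt {f : Torus → ℝ} {f' x : ℝ} (h : HasDerivAt (fun y : ℝ => f y) f' x) :
    dx f x = f' := by
  rw [dx_coe, h.deriv]

lemma norm_fhat_le {f : Torus → ℝ} {D : ℝ} (hD : ∀ x, |f x| ≤ D) (k : ℤ) : ‖fhat f k‖ ≤ D := by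
  rw [fhat, fourierCoeff]
  have hbound (x : Torus) : ‖fourier (-k) x • ((f x : ℝ) : ℂ)‖ ≤ D := by
    rw [norm_smul, Complex.norm_real, norm_fourier_eq_one, one_mul]
    exact hD x
  simpa using norm_integral_le_of_norm_le_const (μ := haarAddCircle (T := 2 * π))
    (Filter.Eventually.of_forall hbound)

lemma fhat_neg (f : Torus → ℝ) (k : ℤ) : fhat f (-k) = (starRingEnd ℂ) (fhat f k) := by
  rw [fhat, fhat, fourierCoeff, fourierCoeff, ← integral_conj]
  congr 1 with x
  simp only [smul_eq_mul, map_mul, Complex.conj_ofReal]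
  rw [← fourier_neg, neg_neg]

lemma fhat_sub {f g : Torus → ℝ} (hf : Continuous f) (hg : Continuous g) (k : ℤ) :
    fhat (f - g) k = fhat f k - fhat g k := by
  have hint {h : Torus → ℝ} (hh : Continuous h) :
      Integrable (fun x => fourier (-k) x • (h x : ℂ)) haarAddCircle :=
    (by fun_prop : Continuous fun x => fourier (-k) x • (h x : ℂ)).integrable_of_hasCompactSupport
      (HasCompactSupport.of_compactSpace _)
  simp only [fhat, fourierCoeff]
  rw [← integral_sub (hint hf) (hint hg)]
  congr 1 with x
  simp only [Pi.sub_apply, Complex.ofReal_sub, smul_eq_mul]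
  ring

lemma fhat_dx {f : Torus → ℝ} (hf : ContDiff ℝ 1 fun x : ℝ => f x) (k : ℤ) :
    fhat (dx f) k = Complex.I * k * fhat f k := by
  have hderiv (x : ℝ) : HasDerivAt (fun y : ℝ => ((f y : ℝ) : ℂ)) ((dx f x : ℝ) : ℂ) x := by
    rw [dx_coe]
    exact ((hf.differentiable one_ne_zero).differentiableAt.hasDerivAt).ofReal_comp
  have hcont : Continuous fun x : ℝ => ((dx f x : ℝ) : ℂ) := by
    simp_rw [dx_coe]
    exact Complex.continuous_ofReal.comp (hf.continuous_deriv le_rfl)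
  have byParts := intervalIntegral.integral_mul_deriv_eq_deriv_mul (a := 0) (b := 0 + 2 * π)
    (fun x _ => hasDerivAt_fourier_neg (2 * π) k x) (fun x _ => hderiv x)
    (Continuous.intervalIntegrable (by fun_prop) _ _) (hcont.intervalIntegrable _ _)
  have hmult (x : ℝ) : -2 * π * Complex.I * k / (2 * π : ℝ) * fourier (-k) (x : Torus) * (f x : ℂ)
      = (-Complex.I * k) * (fourier (-k) (x : Torus) * (f x : ℂ)) := by
    have hπ : (π : ℂ) ≠ 0 := by exact_mod_cast Real.pi_ne_zero
    push_cast
    field_simp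
  rw [fhat, fhat, fourierCoeff_eq_intervalIntegral _ k 0, fourierCoeff_eq_intervalIntegral _ k 0]
  simp only [smul_eq_mul, Complex.real_smul]
  rw [byParts, AddCircle.coe_add_period, sub_self, zero_sub]
  simp_rw [hmult]
  rw [intervalIntegral.integral_const_mul]
  ring

lemma hasSum_fourierCoeff_mul {c : ℤ → ℂ} (hc : Summable fun n => ‖c n‖) {g : Torus → ℂ}
    (hg : Continuous g) (k : ℤ) :
    HasSum (fun n => c n * fourierCoeff g (k - n))
      (fourierCoeff (fun x => (∑' n, c n * fourier n x) * g x) k) := by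
  have hint (n : ℤ) : Integrable (fun x => c n * (fourier (-(k - n)) x * g x)) haarAddCircle :=
    (by fun_prop : Continuous fun x => c n * (fourier (-(k - n)) x * g x))
      |>.integrable_of_hasCompactSupport (HasCompactSupport.of_compactSpace _)
  have hnorm (n : ℤ) (x : Torus) :
      ‖c n * (fourier (-(k - n)) x * g x)‖ = ‖c n‖ * ‖g x‖ := by
    rw [norm_mul, norm_mul, norm_fourier_eq_one, one_mul]
  have hsum := hasSum_integral_of_summable_integral_norm hint (by
    simp_rw [hnorm, integral_const_mul]
    exact hc.mul_right _)
  have hterm (n : ℤ) : ∫ x, c n * (fourier (-(k - n)) x * g x) ∂haarAddCircle =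
      c n * fourierCoeff g (k - n) := integral_const_mul _ _
  have hvalue : ∫ x, ∑' n, c n * (fourier (-(k - n)) x * g x) ∂haarAddCircle =
      fourierCoeff (fun x => (∑' n, c n * fourier n x) * g x) k := by
    refine integral_congr_ae (Filter.Eventually.of_forall fun x => ?_)
    simp only [smul_eq_mul]
    rw [← tsum_mul_right, ← tsum_mul_left]
    refine tsum_congr fun n => ?_
    rw [neg_sub, sub_eq_add_neg, fourier_add]
    ring
  rw [← hvalue]
  simpa only [hterm] using hsum

lemma tsum_fhat_mul_fourier {f : Torus → ℝ} (hf : Continuous f) (hs : Summable fun n => ‖fhat f n‖)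
    (x : Torus) : ∑' n, fhat f n * fourier n x = f x :=
  (has_pointwise_sum_fourier_series_of_summable
    (f := (⟨fun x => (f x : ℂ), by fun_prop⟩ : C(Torus, ℂ))) hs.of_norm x).tsum_eq

lemma hasSum_fhat_mul {f g : Torus → ℝ} (hf : Continuous f) (hg : Continuous g)
    (hs : Summable fun n => ‖fhat f n‖) (k : ℤ) :
    HasSum (fun n => fhat f n * fhat g (k - n)) (fhat (fun x => f x * g x) k) := by
  have h := hasSum_fourierCoeff_mul hs (g := fun x => (g x : ℂ)) (by fun_prop) k
  simp_rw [tsum_fhat_mul_fourier hf hs] at h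
  simpa only [fhat, Complex.ofReal_mul] using h

lemma norm_neg_I_mul_sign_mul_le (n : ℤ) (z : ℂ) :
    ‖(-Complex.I * ((Int.sign n : ℤ) : ℂ)) * z‖ ≤ ‖z‖ := by
  rw [norm_mul, norm_mul]
  refine mul_le_of_le_one_left (norm_nonneg _) ?_
  rcases lt_trichotomy n 0 with hn | hn | hn
  · simp [Int.sign_eq_neg_one_of_neg hn]
  · simp [hn]
  · simp [Int.sign_eq_one_of_pos hn]

lemma continuous_hilbertTransform {f : Torus → ℝ} (hs : Summable fun n => ‖fhat f n‖) :
    Continuous (hilbertTransform f) := by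
  unfold hilbertTransform
  refine continuous_tsum (fun n => by fun_prop) hs fun n x => ?_
  rw [norm_mul, norm_fourier_eq_one, mul_one]
  exact norm_neg_I_mul_sign_mul_le n _

lemma fourierCoeff_hilbertTransform {f : Torus → ℝ} (hs : Summable fun n => ‖fhat f n‖) (k : ℤ) :
    fourierCoeff (hilbertTransform f) k = -Complex.I * ((Int.sign k : ℤ) : ℂ) * fhat f k := by
  have hc : Summable fun n => ‖(-Complex.I * ((Int.sign n : ℤ) : ℂ)) * fhat f n‖ :=
    hs.of_nonneg_of_le (fun _ => norm_nonneg _) fun n => norm_neg_I_mul_sign_mul_le n _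
  have hone (n : ℤ) : fourierCoeff (fun _ : Torus => (1 : ℂ)) n = if n = 0 then 1 else 0 := by
    rw [show (fun _ : Torus => (1 : ℂ)) = ⇑(fourier 0 : C(Torus, ℂ)) from
      funext fun x => fourier_zero.symm, congrFun (fourierCoeff_fourier (T := 2 * π) 0) n,
      Pi.single_apply]
  have hsum := hasSum_fourierCoeff_mul hc (g := fun _ => 1) continuous_const k
  simp only [mul_one] at hsum
  have hcoeff := hsum.unique (hasSum_single k fun n hn => by
    rw [hone, if_neg (by omega), mul_zero])
  rw [show hilbertTransform f = fun x => ∑' n : ℤ, (-Complex.I * ((Int.sign n : ℤ) : ℂ)) *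
    fhat f n * fourier n x from rfl, hcoeff, hone, sub_self, if_pos rfl, mul_one]

lemma contDiff_dx {n : ℕ∞} {f : Torus → ℝ} (hf : ContDiff ℝ (n + 1) fun x : ℝ => f x) :
    ContDiff ℝ n fun x : ℝ => dx f x := by
  simp_rw [dx_coe]
  exact (contDiff_succ_iff_deriv.mp hf).2.2

lemma fhat_dx_dx {f : Torus → ℝ} (hf : ContDiff ℝ 2 fun x : ℝ => f x) (k : ℤ) :
    fhat (dx (dx f)) k = -(k : ℂ) ^ 2 * fhat f k := by
  rw [fhat_dx (contDiff_dx (n := 1) hf), fhat_dx (hf.of_le one_le_two)]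
  linear_combination (k : ℂ) ^ 2 * fhat f k * Complex.I_sq

lemma norm_fhat_le_decay {f : Torus → ℝ} (hf : ContDiff ℝ 2 fun x : ℝ => f x) {D₀ D₂ : ℝ}
    (h₀ : ∀ x, |f x| ≤ D₀) (h₂ : ∀ x, |dx (dx f) x| ≤ D₂) (k : ℤ) :
    ‖fhat f k‖ ≤ (D₀ + D₂) * (1 / (1 + (k : ℝ) ^ 2)) := by
  have hk : ‖-(k : ℂ) ^ 2‖ = (k : ℝ) ^ 2 := by simp
  have hdxdx := norm_fhat_le h₂ k
  rw [fhat_dx_dx hf, norm_mul, hk] at hdxdx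
  rw [mul_one_div, le_div_iff₀ (by positivity)]
  linarith [norm_fhat_le h₀ k]

lemma summable_norm_fhat_of_contDiff {f : Torus → ℝ} (hf : ContDiff ℝ 2 fun x : ℝ => f x) :
    Summable fun n => ‖fhat f n‖ := by
  have hbounded {g : Torus → ℝ} (hg : Continuous g) : ∃ D, ∀ x, |g x| ≤ D := by
    obtain ⟨D, hD⟩ := isCompact_univ.exists_bound_of_continuousOn hg.continuousOn
    exact ⟨D, fun x => hD x (mem_univ x)⟩
  obtain ⟨D₀, h₀⟩ := hbounded (continuous_of_continuous_lift hf.continuous)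
  obtain ⟨D₂, h₂⟩ := hbounded (continuous_of_continuous_lift
    (contDiff_dx (n := 0) (contDiff_dx (n := 1) hf)).continuous)
  exact Summable.of_nonneg_of_le (fun _ => norm_nonneg _) (norm_fhat_le_decay hf h₀ h₂)
    (summable_one_div_one_add_sq.mul_left _)

lemma fhat_mul_dx {f : Torus → ℝ} (hf : ContDiff ℝ 1 fun x : ℝ => f x) (k : ℤ) :
    fhat (fun x => f x * dx f x) k = Complex.I * k / 2 * fhat (fun x => f x * f x) k := by
  have hsq : ContDiff ℝ 1 fun x : ℝ => f x * f x := hf.mul hf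
  have hdx : dx (fun x => f x * f x) = fun x => 2 * (f x * dx f x) := by
    ext x
    induction x using QuotientAddGroup.induction_on with
    | H x =>
      have hderiv := ((hf.differentiable one_ne_zero).differentiableAt (x := x)).hasDerivAt
      rw [dx_of_hasDerivAt (hderiv.mul hderiv), dx_coe]
      ring
  have htwo : fhat (fun x => 2 * (f x * dx f x)) k = 2 * fhat (fun x => f x * dx f x) k := by
    simp only [fhat]
    rw [← fourierCoeff.const_mul]
    simp
  have hcoeff := fhat_dx (f := fun x => f x * f x) hsq k
  rw [hdx, htwo] at hcoeff
  linear_combination hcoeff / 2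

/-! ### Smooth solutions on the Fourier side -/

section Slab

variable {T : ℝ}

lemma uniqueDiffOn_slab (hT : 0 < T) : UniqueDiffOn ℝ (Icc 0 T ×ˢ (univ : Set ℝ)) :=
  (uniqueDiffOn_Icc hT).prod uniqueDiffOn_univ

lemma contDiffOn_partial (hT : 0 < T) {U : ℝ × ℝ → ℝ}
    (hU : ContDiffOn ℝ ((⊤ : ℕ∞) : WithTop ℕ∞) U (Icc 0 T ×ˢ univ)) (v : ℝ × ℝ) :
    ContDiffOn ℝ ((⊤ : ℕ∞) : WithTop ℕ∞)
      (fun p => fderivWithin ℝ U (Icc 0 T ×ˢ univ) p v) (Icc 0 T ×ˢ univ) :=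
  (hU.fderivWithin (uniqueDiffOn_slab hT) (by simp)).clm_apply contDiffOn_const

lemma hasDerivAt_partial_space {U : ℝ × ℝ → ℝ}
    (hU : ContDiffOn ℝ ((⊤ : ℕ∞) : WithTop ℕ∞) U (Icc 0 T ×ˢ univ)) {t : ℝ} (ht : t ∈ Icc 0 T)
    (x : ℝ) :
    HasDerivAt (fun y => U (t, y)) (fderivWithin ℝ U (Icc 0 T ×ˢ univ) (t, x) (0, 1)) x := by
  have hline : HasDerivWithinAt (fun y : ℝ => (t, y)) ((0 : ℝ), (1 : ℝ)) univ x :=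
    ((hasDerivAt_const x t).prodMk (hasDerivAt_id x)).hasDerivWithinAt
  exact hasDerivWithinAt_univ.mp
    ((hU.differentiableOn (by simp) (t, x) ⟨ht, mem_univ _⟩).hasFDerivWithinAt
      |>.comp_hasDerivWithinAt x hline fun y _ => ⟨ht, mem_univ _⟩)

lemma hasDerivAt_partial_time {U : ℝ × ℝ → ℝ}
    (hU : ContDiffOn ℝ ((⊤ : ℕ∞) : WithTop ℕ∞) U (Icc 0 T ×ˢ univ)) {t : ℝ} (ht : t ∈ Ioo 0 T)
    (x : ℝ) :
    HasDerivAt (fun τ => U (τ, x)) (fderivWithin ℝ U (Icc 0 T ×ˢ univ) (t, x) (1, 0)) t := by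
  have hline : HasDerivWithinAt (fun τ : ℝ => (τ, x)) ((1 : ℝ), (0 : ℝ)) (Icc 0 T) t :=
    ((hasDerivAt_id t).prodMk (hasDerivAt_const t x)).hasDerivWithinAt
  have hmaps : MapsTo (fun τ : ℝ => (τ, x)) (Icc 0 T) (Icc 0 T ×ˢ univ) :=
    fun _ hy => ⟨hy, mem_univ _⟩
  have hwithin : HasDerivWithinAt (fun τ => U (τ, x))
      (fderivWithin ℝ U (Icc 0 T ×ˢ univ) (t, x) (1, 0)) (Icc 0 T) t :=
    (hU.differentiableOn (by simp) (t, x) ⟨Ioo_subset_Icc_self ht, mem_univ _⟩).hasFDerivWithinAt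
      |>.comp_hasDerivWithinAt t hline hmaps
  exact hwithin.hasDerivAt (Icc_mem_nhds ht.1 ht.2)

lemma contDiffOn_dx (hT : 0 < T) {w : ℝ → Torus → ℝ}
    (hw : ContDiffOn ℝ ((⊤ : ℕ∞) : WithTop ℕ∞) (fun p : ℝ × ℝ => w p.1 (p.2 : Torus))
      (Icc 0 T ×ˢ univ)) :
    ContDiffOn ℝ ((⊤ : ℕ∞) : WithTop ℕ∞) (fun p : ℝ × ℝ => dx (w p.1) (p.2 : Torus))
      (Icc 0 T ×ˢ univ) :=
  (contDiffOn_partial hT hw (0, 1)).congr fun p hp =>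
    dx_of_hasDerivAt (hasDerivAt_partial_space hw hp.1 p.2)

lemma exists_bound_of_continuousOn_slab {V : ℝ × ℝ → ℝ} (hV : ContinuousOn V (Icc 0 T ×ˢ univ))
    {S : Set ℝ} (hS : S ⊆ Icc 0 T) {w : ℝ → Torus → ℝ}
    (hw : ∀ t ∈ S, ∀ x : ℝ, w t (x : Torus) = V (t, x)) :
    ∃ D, ∀ t ∈ S, ∀ x, |w t x| ≤ D := by
  obtain ⟨D, hD⟩ := (isCompact_Icc.prod
    (isCompact_Icc (a := (0 : ℝ)) (b := 2 * π))).exists_bound_of_continuousOn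
    (hV.mono (prod_mono (Subset.refl (Icc 0 T)) (subset_univ _)))
  refine ⟨D, fun t ht x => ?_⟩
  obtain ⟨y, hy, rfl⟩ : x ∈ ((↑) : ℝ → Torus) '' Ico 0 (0 + 2 * π) := by
    rw [AddCircle.coe_image_Ico_eq]
    exact mem_univ x
  rw [zero_add] at hy
  rw [hw t ht y]
  exact hD (t, y) ⟨hS ht, Ico_subset_Icc_self hy⟩

end Slab

/-- Fourier coefficients of a real function with vanishing mean, with continuous dependence on
time and uniform quadratic decay. -/
structure RegularCoeffs (T : ℝ) (a : ℝ → ℤ → ℂ) : Prop where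
  continuousOn : ∀ k, ContinuousOn (fun t => a t k) (Icc 0 T)
  decay : ∃ D, 0 ≤ D ∧ ∀ t ∈ Icc 0 T, ∀ k : ℤ, ‖a t k‖ ≤ D * (1 / (1 + (k : ℝ) ^ 2))
  conj : ∀ t k, a t (-k) = (starRingEnd ℂ) (a t k)
  zero : ∀ t ∈ Icc 0 T, a t 0 = 0

/-- The Benjamin-Ono equation linearized along `w / 2`, `∂ₜ v + H ∂ₓₓ v = ∂ₓ (v w) / 2`, on the
Fourier side. A solution `u` satisfies it with `v = w = u`, and a difference `u₁ - u₂` of solutions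
with `w = u₁ + u₂`. -/
def SolvesTransport (T : ℝ) (v w : ℝ → ℤ → ℂ) : Prop :=
  ∀ t ∈ Ioo 0 T, ∀ k : ℤ, HasDerivAt (fun τ => v τ k)
    (-(Complex.I * ((k * |k| : ℤ) : ℂ)) * v t k +
      Complex.I * k / 2 * ∑' n, v t n * w t (k - n)) t

namespace IsSmoothSolution

variable {T : ℝ} {u : ℝ → Torus → ℝ}

lemma contDiff_lift (hu : IsSmoothSolution T u) {t : ℝ} (ht : t ∈ Icc 0 T) :
    ContDiff ℝ ((⊤ : ℕ∞) : WithTop ℕ∞) fun x : ℝ => u t x :=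
  contDiffOn_univ.mp (hu.smooth.comp (contDiff_const.prodMk contDiff_id).contDiffOn
    fun _ _ => ⟨ht, mem_univ _⟩)

lemma continuous_slice (hu : IsSmoothSolution T u) {t : ℝ} (ht : t ∈ Icc 0 T) :
    Continuous (u t) :=
  continuous_of_continuous_lift (hu.contDiff_lift ht).continuous

lemma exists_decay (hT : 0 < T) (hu : IsSmoothSolution T u) :
    ∃ D, 0 ≤ D ∧ ∀ t ∈ Icc 0 T, ∀ k : ℤ, ‖fhat (u t) k‖ ≤ D * (1 / (1 + (k : ℝ) ^ 2)) := by
  obtain ⟨D₀, h₀⟩ := exists_bound_of_continuousOn_slab hu.smooth.continuousOn Subset.rfl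
    (w := u) fun _ _ _ => rfl
  obtain ⟨D₂, h₂⟩ := exists_bound_of_continuousOn_slab
    (contDiffOn_dx (w := fun t => dx (u t)) hT (contDiffOn_dx hT hu.smooth)).continuousOn Subset.rfl
    (w := fun t => dx (dx (u t))) fun _ _ _ => rfl
  have h0 : (0 : ℝ) ∈ Icc 0 T := ⟨le_rfl, hT.le⟩
  refine ⟨D₀ + D₂, add_nonneg ((abs_nonneg _).trans (h₀ 0 h0 0))
    ((abs_nonneg _).trans (h₂ 0 h0 0)), fun t ht k => ?_⟩
  exact norm_fhat_le_decay (contDiff_infty.mp (hu.contDiff_lift ht) 2) (h₀ t ht) (h₂ t ht) k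

lemma summable_fhat (hu : IsSmoothSolution T u) {t : ℝ} (ht : t ∈ Icc 0 T) :
    Summable fun n => ‖fhat (u t) n‖ :=
  summable_norm_fhat_of_contDiff (contDiff_infty.mp (hu.contDiff_lift ht) 2)

lemma continuousOn_fhat (hu : IsSmoothSolution T u) (k : ℤ) :
    ContinuousOn (fun t => fhat (u t) k) (Icc 0 T) := by
  obtain ⟨D₀, h₀⟩ := exists_bound_of_continuousOn_slab hu.smooth.continuousOn Subset.rfl
    (w := u) fun _ _ _ => rfl
  unfold fhat fourierCoeff
  refine continuousOn_of_dominated (bound := fun _ => D₀) (fun t ht => ?_) (fun t ht => ?_)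
    (integrable_const _) ?_
  · have := hu.continuous_slice ht
    exact Continuous.aestronglyMeasurable (by fun_prop)
  · refine Filter.Eventually.of_forall fun x => ?_
    rw [norm_smul, Complex.norm_real, norm_fourier_eq_one, one_mul]
    exact h₀ t ht x
  · refine Filter.Eventually.of_forall fun x => ?_
    induction x using QuotientAddGroup.induction_on with
    | H x =>
      have hpath : ContinuousOn (fun t => u t (x : Torus)) (Icc 0 T) :=
        hu.smooth.continuousOn.comp (f := fun t : ℝ => (t, x)) (by fun_prop)
          fun t ht => ⟨ht, mem_univ _⟩
      simp only [smul_eq_mul]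
      exact continuousOn_const.mul (Complex.continuous_ofReal.comp_continuousOn hpath)

lemma hasDerivAt_deriv_time (hu : IsSmoothSolution T u) {t : ℝ} (ht : t ∈ Ioo 0 T) (x : Torus) :
    HasDerivAt (fun τ => u τ x) (deriv (fun τ => u τ x) t) t := by
  induction x using QuotientAddGroup.induction_on with
  | H x => exact (hasDerivAt_partial_time hu.smooth ht x).differentiableAt.hasDerivAt

lemma continuous_deriv_time (hT : 0 < T) (hu : IsSmoothSolution T u) {t : ℝ} (ht : t ∈ Ioo 0 T) :
    Continuous fun x : Torus => deriv (fun τ => u τ x) t := by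
  refine continuous_of_continuous_lift ?_
  simp_rw [fun x : ℝ => (hasDerivAt_partial_time hu.smooth ht x).deriv]
  exact continuousOn_univ.mp ((contDiffOn_partial hT hu.smooth (1, 0)).continuousOn.comp
    (f := fun x : ℝ => (t, x)) (by fun_prop) fun x _ => ⟨Ioo_subset_Icc_self ht, mem_univ _⟩)

lemma exists_bound_deriv_time (hT : 0 < T) (hu : IsSmoothSolution T u) :
    ∃ D, ∀ t ∈ Ioo 0 T, ∀ x : Torus, |deriv (fun τ => u τ x) t| ≤ D :=
  exists_bound_of_continuousOn_slab (contDiffOn_partial hT hu.smooth (1, 0)).continuousOn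
    Ioo_subset_Icc_self fun _ ht x => (hasDerivAt_partial_time hu.smooth ht x).deriv

lemma hasDerivAt_fhat (hT : 0 < T) (hu : IsSmoothSolution T u) {t : ℝ} (ht : t ∈ Ioo 0 T)
    (k : ℤ) :
    HasDerivAt (fun τ => fhat (u τ) k) (fhat (fun x => deriv (fun τ => u τ x) t) k) t := by
  obtain ⟨D, hD⟩ := hu.exists_bound_deriv_time hT
  have hslice {τ : ℝ} (hτ : τ ∈ Ioo 0 T) := hu.continuous_slice (Ioo_subset_Icc_self hτ)
  have hderiv := hu.continuous_deriv_time hT ht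
  exact (hasDerivAt_integral_of_dominated_loc_of_deriv_le (μ := haarAddCircle (T := 2 * π))
    (F := fun τ x => fourier (-k) x • ((u τ x : ℝ) : ℂ))
    (F' := fun τ x => fourier (-k) x • ((deriv (fun τ => u τ x) τ : ℝ) : ℂ))
    (x₀ := t) (s := Ioo 0 T) (bound := fun _ => D) (Ioo_mem_nhds ht.1 ht.2)
    (Filter.eventually_of_mem (Ioo_mem_nhds ht.1 ht.2) fun τ hτ => by
      have := hslice hτ
      exact Continuous.aestronglyMeasurable (by fun_prop))
    (by
      have := hslice ht
      exact (by fun_prop : Continuous fun x => fourier (-k) x • ((u t x : ℝ) : ℂ))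
        |>.integrable_of_hasCompactSupport (HasCompactSupport.of_compactSpace _))
    (Continuous.aestronglyMeasurable (by fun_prop))
    (Filter.Eventually.of_forall fun x τ hτ => by
      rw [norm_smul, Complex.norm_real, norm_fourier_eq_one, one_mul]
      exact hD τ hτ x)
    (integrable_const _)
    (Filter.Eventually.of_forall fun x τ hτ => by
      simpa only [smul_eq_mul] using ((hu.hasDerivAt_deriv_time hτ x).ofReal_comp).const_mul _)).2

lemma fhat_deriv_time (hu : IsSmoothSolution T u) {t : ℝ} (ht : t ∈ Ioo 0 T) (k : ℤ) :
    fhat (fun x => deriv (fun τ => u τ x) t) k =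
      fhat (fun x => u t x * dx (u t) x) k - fourierCoeff (hilbertTransform (dx (dx (u t)))) k := by
  have hsmooth (n : ℕ) := contDiff_infty.mp (hu.contDiff_lift (Ioo_subset_Icc_self ht)) n
  have hdx (n : ℕ) := contDiff_dx (n := n) (hsmooth (n + 1))
  have hdxdx := contDiff_dx (n := 2) (hdx 3)
  have hslice := continuous_of_continuous_lift (hsmooth 0).continuous
  have hdx_cont := continuous_of_continuous_lift (hdx 0).continuous
  have hhilbert := continuous_hilbertTransform (summable_norm_fhat_of_contDiff hdxdx)
  have hint {f : Torus → ℂ} (hf : Continuous f) : Integrable f haarAddCircle :=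
    hf.integrable_of_hasCompactSupport (HasCompactSupport.of_compactSpace _)
  have hequation : (fun x => ((deriv (fun τ => u τ x) t : ℝ) : ℂ)) =
      (fun x => ((u t x * dx (u t) x : ℝ) : ℂ)) +
        fun x => (-1 : ℂ) * hilbertTransform (dx (dx (u t))) x := by
    ext x
    simp only [Pi.add_apply]
    rw [← hu.equation t ht x]
    ring
  rw [fhat, hequation, fourierCoeff.add (hint (by fun_prop)) (hint (by fun_prop)), Pi.add_apply,
    fourierCoeff.const_mul, fhat]
  ring

lemma solvesTransport (hT : 0 < T) (hu : IsSmoothSolution T u) :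
    SolvesTransport T (fun t => fhat (u t)) fun t => fhat (u t) := by
  intro t ht k
  have ht' := Ioo_subset_Icc_self ht
  have hsmooth (n : ℕ) := contDiff_infty.mp (hu.contDiff_lift ht') n
  have hdxdx := contDiff_dx (n := 2) (contDiff_dx (n := 3) (hsmooth 4))
  have hslice := hu.continuous_slice ht'
  have hsign : ((Int.sign k : ℤ) : ℂ) * (k : ℂ) ^ 2 = ((k * |k| : ℤ) : ℂ) := by
    have : Int.sign k * k ^ 2 = k * |k| := by
      rw [sq, ← mul_assoc, Int.sign_mul_self_eq_abs, mul_comm]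
    exact_mod_cast this
  convert hu.hasDerivAt_fhat hT ht k using 1
  rw [hu.fhat_deriv_time ht, fourierCoeff_hilbertTransform (summable_norm_fhat_of_contDiff hdxdx),
    fhat_dx_dx (hsmooth 2), fhat_mul_dx (hsmooth 1),
    ← (hasSum_fhat_mul hslice hslice (hu.summable_fhat ht') k).tsum_eq, ← hsign]
  ring

lemma fhat_zero (hT : 0 < T) (hu : IsSmoothSolution T u) {t : ℝ} (ht : t ∈ Icc 0 T) :
    fhat (u t) 0 = 0 := by
  have h0 : fhat (u 0) 0 = 0 := by
    rw [fhat, fourierCoeff]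
    simp only [neg_zero, fourier_zero, one_smul]
    rw [integral_complex_ofReal, hu.mean_zero, Complex.ofReal_zero]
  have hconst := intervalIntegral.integral_eq_sub_of_hasDerivAt_of_le ht.1
    ((hu.continuousOn_fhat 0).mono (Icc_subset_Icc le_rfl ht.2))
    (f' := fun _ => (0 : ℂ)) (fun τ hτ => by
      simpa using hu.solvesTransport hT τ ⟨hτ.1, hτ.2.trans_le ht.2⟩ 0) (by simp)
  simpa [h0, eq_comm] using hconst

theorem regularCoeffs (hT : 0 < T) (hu : IsSmoothSolution T u) :
    RegularCoeffs T fun t => fhat (u t) where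
  continuousOn := hu.continuousOn_fhat
  decay := hu.exists_decay hT
  conj _ _ := fhat_neg _ _
  zero _ ht := hu.fhat_zero hT ht

end IsSmoothSolution

/-! ### The energy identity -/

/-- The time integral over `[0, t₀]` of a product of three Fourier coefficients at frequencies
`p.1`, `p.2` and `-p.1 - p.2`, whose sum is zero. -/
noncomputable def triInt (a b c : ℝ → ℤ → ℂ) (t₀ : ℝ) (p : ℤ × ℤ) : ℂ :=
  ∫ t in 0..t₀, a t p.1 * b t p.2 * c t (-p.1 - p.2)

/-- The trilinear form with symbol `m`, integrated in time over `[0, t₀]`. The energy transferred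
by the nonlinearity has this form. -/
noncomputable def integratedForm (m : ℤ × ℤ → ℝ) (a b c : ℝ → ℤ → ℂ) (t₀ : ℝ) : ℂ :=
  ∑' p, (m p : ℂ) * triInt a b c t₀ p

/-- The symmetrization over the first two frequencies of the symbol `ψ p.1`. -/
noncomputable def pairSymbol (ψ : ℤ → ℝ) (p : ℤ × ℤ) : ℝ := (ψ p.1 + ψ p.2) / 2

/-- The symmetrization over all three frequencies of the symbol `ψ p.1`. -/
noncomputable def tripleSymbol (ψ : ℤ → ℝ) (p : ℤ × ℤ) : ℝ :=
  (ψ p.1 + ψ p.2 + ψ (-p.1 - p.2)) / 3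

section Symbols

variable {ψ : ℤ → ℝ} {P : ℝ}

lemma abs_pairSymbol_le (hψ : ∀ k, |ψ k| ≤ P) (p : ℤ × ℤ) : |pairSymbol ψ p| ≤ P := by
  rw [pairSymbol, abs_div, abs_two]
  linarith [abs_add_le (ψ p.1) (ψ p.2), hψ p.1, hψ p.2]

lemma abs_tripleSymbol_le (hψ : ∀ k, |ψ k| ≤ P) (p : ℤ × ℤ) : |tripleSymbol ψ p| ≤ P := by
  rw [tripleSymbol, abs_div, abs_of_pos (by norm_num : (0 : ℝ) < 3)]
  linarith [abs_add_three (ψ p.1) (ψ p.2) (ψ (-p.1 - p.2)), hψ p.1, hψ p.2, hψ (-p.1 - p.2)]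

end Symbols

section TriInt

variable {T : ℝ} {a b c d : ℝ → ℤ → ℂ} {t₀ : ℝ}

lemma RegularCoeffs.intervalIntegrable (ha : RegularCoeffs T a) (hb : RegularCoeffs T b)
    (hc : RegularCoeffs T c) (ht₀ : t₀ ∈ Icc 0 T) (k l m : ℤ) :
    IntervalIntegrable (fun t => a t k * b t l * c t m) volume 0 t₀ := by
  refine ContinuousOn.intervalIntegrable ?_
  rw [uIcc_of_le ht₀.1]
  exact (((ha.continuousOn k).mul (hb.continuousOn l)).mul (hc.continuousOn m)).mono
    (Icc_subset_Icc le_rfl ht₀.2)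

lemma RegularCoeffs.sub (ha : RegularCoeffs T a) (hb : RegularCoeffs T b) :
    RegularCoeffs T fun t k => a t k - b t k where
  continuousOn k := (ha.continuousOn k).sub (hb.continuousOn k)
  decay := by
    obtain ⟨D, hD0, hD⟩ := ha.decay
    obtain ⟨D', hD0', hD'⟩ := hb.decay
    refine ⟨D + D', add_nonneg hD0 hD0', fun t ht k => ?_⟩
    rw [add_mul]
    exact (norm_sub_le _ _).trans (add_le_add (hD t ht k) (hD' t ht k))
  conj t k := by rw [ha.conj, hb.conj, map_sub]
  zero t ht := by rw [ha.zero t ht, hb.zero t ht, sub_zero]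

lemma RegularCoeffs.add (ha : RegularCoeffs T a) (hb : RegularCoeffs T b) :
    RegularCoeffs T fun t k => a t k + b t k where
  continuousOn k := (ha.continuousOn k).add (hb.continuousOn k)
  decay := by
    obtain ⟨D, hD0, hD⟩ := ha.decay
    obtain ⟨D', hD0', hD'⟩ := hb.decay
    refine ⟨D + D', add_nonneg hD0 hD0', fun t ht k => ?_⟩
    rw [add_mul]
    exact (norm_add_le _ _).trans (add_le_add (hD t ht k) (hD' t ht k))
  conj t k := by rw [ha.conj, hb.conj, map_add]
  zero t ht := by rw [ha.zero t ht, hb.zero t ht, add_zero]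

lemma triInt_add (ha : RegularCoeffs T a) (hb : RegularCoeffs T b) (hc : RegularCoeffs T c)
    (hd : RegularCoeffs T d) (ht₀ : t₀ ∈ Icc 0 T) (p : ℤ × ℤ) :
    triInt a b (fun t k => c t k + d t k) t₀ p = triInt a b c t₀ p + triInt a b d t₀ p := by
  unfold triInt
  rw [← intervalIntegral.integral_add (ha.intervalIntegrable hb hc ht₀ _ _ _)
    (ha.intervalIntegrable hb hd ht₀ _ _ _)]
  simp only [mul_add]

lemma triInt_swap (p : ℤ × ℤ) : triInt a a c t₀ p.swap = triInt a a c t₀ p := by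
  unfold triInt
  refine intervalIntegral.integral_congr fun t _ => ?_
  simp only [Prod.fst_swap, Prod.snd_swap]
  rw [show -p.2 - p.1 = -p.1 - p.2 by ring]
  ring

lemma triInt_reflect (p : ℤ × ℤ) : triInt a b a t₀ (-p.1 - p.2, p.2) = triInt a b a t₀ p := by
  unfold triInt
  refine intervalIntegral.integral_congr fun t _ => ?_
  simp only
  rw [show -(-p.1 - p.2) - p.2 = p.1 by ring]
  ring

lemma triInt_eq_zero (ha : RegularCoeffs T a) (hb : RegularCoeffs T b) (hc : RegularCoeffs T c)
    (ht₀ : t₀ ∈ Icc 0 T) {p : ℤ × ℤ} (hp : p.1 = 0 ∨ p.2 = 0 ∨ -p.1 - p.2 = 0) :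
    triInt a b c t₀ p = 0 := by
  unfold triInt
  rw [intervalIntegral.integral_congr (g := fun _ => 0), intervalIntegral.integral_zero]
  intro t ht
  rw [uIcc_of_le ht₀.1] at ht
  have ht' : t ∈ Icc 0 T := ⟨ht.1, ht.2.trans ht₀.2⟩
  simp only
  rcases hp with hp | hp | hp
  · rw [hp, ha.zero t ht']; ring
  · rw [hp, hb.zero t ht']; ring
  · rw [hp, hc.zero t ht']; ring

lemma RegularCoeffs.exists_bound (ha : RegularCoeffs T a) :
    ∃ D, 0 ≤ D ∧ ∀ t ∈ Icc 0 T, ∀ k, ‖a t k‖ ≤ D := by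
  obtain ⟨D, hD0, hD⟩ := ha.decay
  refine ⟨D, hD0, fun t ht k => (hD t ht k).trans (mul_le_of_le_one_right hD0 ?_)⟩
  rw [div_le_one (by positivity)]
  nlinarith [sq_nonneg (k : ℝ)]

lemma RegularCoeffs.exists_bound_mul (ha : RegularCoeffs T a) (hb : RegularCoeffs T b)
    (hc : RegularCoeffs T c) : ∃ D, ∀ t ∈ Icc 0 T, ∀ k l m : ℤ,
      ‖a t k * b t l * c t m‖ ≤ D * ((1 / (1 + (k : ℝ) ^ 2)) * (1 / (1 + (l : ℝ) ^ 2))) := by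
  obtain ⟨A, hA0, hA⟩ := ha.decay
  obtain ⟨B, hB0, hB⟩ := hb.decay
  obtain ⟨C, -, hC⟩ := hc.exists_bound
  refine ⟨A * B * C, fun t ht k l m => ?_⟩
  rw [norm_mul, norm_mul]
  calc ‖a t k‖ * ‖b t l‖ * ‖c t m‖
      ≤ (A * (1 / (1 + (k : ℝ) ^ 2))) * (B * (1 / (1 + (l : ℝ) ^ 2))) * C := by
        gcongr
        · exact hA t ht k
        · exact hB t ht l
        · exact hC t ht m
    _ = _ := by ring

lemma summable_decay_mul_decay : Summable fun p : ℤ × ℤ =>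
    (1 / (1 + (p.1 : ℝ) ^ 2)) * (1 / (1 + (p.2 : ℝ) ^ 2)) :=
  summable_one_div_one_add_sq.mul_of_nonneg summable_one_div_one_add_sq
    (fun _ => by positivity) fun _ => by positivity

lemma norm_triInt_le {D : ℝ} {k l : ℤ} (hD : ∀ t ∈ Icc 0 T, ‖a t k * b t l * c t (-k - l)‖ ≤ D)
    (ht₀ : t₀ ∈ Icc 0 T) : ‖triInt a b c t₀ (k, l)‖ ≤ D * T := by
  have hD0 : 0 ≤ D := (norm_nonneg _).trans (hD t₀ ht₀)
  have hnorm : ‖triInt a b c t₀ (k, l)‖ ≤ D * |t₀ - 0| :=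
    intervalIntegral.norm_integral_le_of_norm_le_const fun t ht => by
      rw [uIoc_of_le ht₀.1] at ht
      exact hD t ⟨ht.1.le, ht.2.trans ht₀.2⟩
  rw [sub_zero, abs_of_nonneg ht₀.1] at hnorm
  exact hnorm.trans (mul_le_mul_of_nonneg_left ht₀.2 hD0)

lemma summable_mul_triInt (ha : RegularCoeffs T a) (hb : RegularCoeffs T b)
    (hc : RegularCoeffs T c) (ht₀ : t₀ ∈ Icc 0 T) {m : ℤ × ℤ → ℝ} {P : ℝ}
    (hm : ∀ p, |m p| ≤ P) : Summable fun p => (m p : ℂ) * triInt a b c t₀ p := by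
  obtain ⟨D, hD⟩ := ha.exists_bound_mul hb hc
  have hP : 0 ≤ P := (abs_nonneg _).trans (hm 0)
  refine Summable.of_norm_bounded ((summable_decay_mul_decay.mul_left D).mul_right T |>.mul_left P)
    fun p => ?_
  rw [norm_mul, Complex.norm_real]
  exact mul_le_mul (hm p) (norm_triInt_le (fun t ht => hD t ht _ _ _) ht₀) (norm_nonneg _) hP

lemma integratedForm_add (ha : RegularCoeffs T a) (hb : RegularCoeffs T b)
    (hc : RegularCoeffs T c) (hd : RegularCoeffs T d) (ht₀ : t₀ ∈ Icc 0 T) {m : ℤ × ℤ → ℝ} {P : ℝ}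
    (hm : ∀ p, |m p| ≤ P) :
    integratedForm m a b (fun t k => c t k + d t k) t₀ =
      integratedForm m a b c t₀ + integratedForm m a b d t₀ := by
  unfold integratedForm
  simp_rw [triInt_add ha hb hc hd ht₀, mul_add]
  exact (summable_mul_triInt ha hb hc ht₀ hm).tsum_add (summable_mul_triInt ha hb hd ht₀ hm)

lemma integratedForm_swap (m : ℤ × ℤ → ℝ) :
    integratedForm (fun p => m p.swap) a a c t₀ = integratedForm m a a c t₀ := by
  unfold integratedForm
  rw [← (Equiv.prodComm ℤ ℤ).tsum_eq]
  refine tsum_congr fun p => ?_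
  simp only [Equiv.prodComm_apply, triInt_swap, Prod.swap_swap]

lemma integratedForm_reflect (m : ℤ × ℤ → ℝ) :
    integratedForm (fun p => m (-p.1 - p.2, p.2)) a b a t₀ = integratedForm m a b a t₀ := by
  have hinv : Function.Involutive fun p : ℤ × ℤ => (-p.1 - p.2, p.2) := fun p => by ext <;> simp
  unfold integratedForm
  rw [← hinv.toPerm.tsum_eq]
  refine tsum_congr fun p => ?_
  simp only [Function.Involutive.coe_toPerm]
  rw [triInt_reflect, show -(-p.1 - p.2) - p.2 = p.1 by ring]

variable {ψ : ℤ → ℝ} {P : ℝ}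

lemma integratedForm_pairSymbol (ha : RegularCoeffs T a) (hc : RegularCoeffs T c)
    (ht₀ : t₀ ∈ Icc 0 T) (hψ : ∀ k, |ψ k| ≤ P) :
    integratedForm (pairSymbol ψ) a a c t₀ = integratedForm (fun p => ψ p.1) a a c t₀ := by
  have hswap : integratedForm (fun p => ψ p.2) a a c t₀ =
      integratedForm (fun p => ψ p.1) a a c t₀ := integratedForm_swap fun p => ψ p.1
  have hfst := summable_mul_triInt ha ha hc ht₀ (m := fun p => ψ p.1) fun p => hψ _
  have hsnd := summable_mul_triInt ha ha hc ht₀ (m := fun p => ψ p.2) fun p => hψ _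
  have hmean : integratedForm (pairSymbol ψ) a a c t₀ =
      (integratedForm (fun p => ψ p.1) a a c t₀ +
        integratedForm (fun p => ψ p.2) a a c t₀) / 2 := by
    unfold integratedForm
    rw [← hfst.tsum_add hsnd, ← tsum_div_const]
    refine tsum_congr fun p => ?_
    rw [pairSymbol]
    push_cast
    ring
  rw [hmean, hswap]
  ring

lemma integratedForm_tripleSymbol (ha : RegularCoeffs T a) (ht₀ : t₀ ∈ Icc 0 T)
    (hψ : ∀ k, |ψ k| ≤ P) :
    integratedForm (tripleSymbol ψ) a a a t₀ = integratedForm (fun p => ψ p.1) a a a t₀ := by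
  have hreflect : integratedForm (fun p => ψ (-p.1 - p.2)) a a a t₀ =
      integratedForm (fun p => ψ p.1) a a a t₀ := integratedForm_reflect fun p => ψ p.1
  have hpair := summable_mul_triInt ha ha ha ht₀ (abs_pairSymbol_le hψ)
  have hthird := summable_mul_triInt ha ha ha ht₀ (m := fun p => ψ (-p.1 - p.2)) fun p => hψ _
  have hmean : integratedForm (tripleSymbol ψ) a a a t₀ =
      2 / 3 * integratedForm (pairSymbol ψ) a a a t₀ +
        1 / 3 * integratedForm (fun p => ψ (-p.1 - p.2)) a a a t₀ := by
    unfold integratedForm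
    rw [← tsum_mul_left, ← tsum_mul_left, ← (hpair.mul_left _).tsum_add (hthird.mul_left _)]
    refine tsum_congr fun p => ?_
    rw [pairSymbol, tripleSymbol]
    push_cast
    ring
  rw [hmean, hreflect, integratedForm_pairSymbol ha ha ht₀ hψ]
  ring

end TriInt

section Energy

variable {T : ℝ} {v w : ℝ → ℤ → ℂ}

lemma continuousOn_convolution (hv : RegularCoeffs T v) (hw : RegularCoeffs T w) (k : ℤ) :
    ContinuousOn (fun t => ∑' n, v t n * w t (k - n)) (Icc 0 T) := by
  obtain ⟨D, hD0, hD⟩ := hv.decay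
  obtain ⟨E, -, hE⟩ := hw.exists_bound
  refine continuousOn_tsum (u := fun n : ℤ => D * (1 / (1 + (n : ℝ) ^ 2)) * E)
    (fun n => (hv.continuousOn n).mul (hw.continuousOn (k - n)))
    ((summable_one_div_one_add_sq.mul_left D).mul_right E) fun n t ht => ?_
  rw [norm_mul]
  have := hD t ht n
  have := hE t ht (k - n)
  gcongr

lemma integral_mul_convolution (hv : RegularCoeffs T v) (hw : RegularCoeffs T w) {t₀ : ℝ}
    (ht₀ : t₀ ∈ Icc 0 T) (k : ℤ) :
    ∫ t in 0..t₀, v t (-k) * ∑' n, v t n * w t (k - n) = ∑' n, triInt v v w t₀ (-k, n) := by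
  obtain ⟨D, hD⟩ := hv.exists_bound_mul hv hw
  set B : ℤ → ℝ := fun n => D * ((1 / (1 + ((-k : ℤ) : ℝ) ^ 2)) * (1 / (1 + (n : ℝ) ^ 2)))
  have hB : Summable B := (summable_one_div_one_add_sq.mul_left _).mul_left D
  have hmem (t : ℝ) (ht : t ∈ uIoc 0 t₀) : t ∈ Icc 0 T := by
    rw [uIoc_of_le ht₀.1] at ht
    exact ⟨ht.1.le, ht.2.trans ht₀.2⟩
  have hsum (t : ℝ) (ht : t ∈ uIoc 0 t₀) :
      HasSum (fun n => v t (-k) * v t n * w t (-(-k) - n))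
        (v t (-k) * ∑' n, v t n * w t (k - n)) := by
    have hvalue : v t (-k) * ∑' n, v t n * w t (k - n) =
        ∑' n, v t (-k) * v t n * w t (-(-k) - n) := by
      simp_rw [← tsum_mul_left, neg_neg, mul_assoc]
    rw [hvalue]
    exact (Summable.of_norm_bounded hB fun n => hD t (hmem t ht) _ _ _).hasSum
  exact (intervalIntegral.hasSum_integral_of_dominated_convergence (fun n _ => B n)
    (fun n => (hv.intervalIntegrable hv hw ht₀ _ _ _).def'.aestronglyMeasurable)
    (fun n => Filter.Eventually.of_forall fun t ht => hD t (hmem t ht) _ _ _)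
    (Filter.Eventually.of_forall fun _ _ => hB) intervalIntegrable_const
    (Filter.Eventually.of_forall hsum)).tsum_eq.symm

lemma SolvesTransport.hasDerivAt_norm_sq (hd : SolvesTransport T v w)
    (hconj : ∀ t k, v t (-k) = (starRingEnd ℂ) (v t k)) {t : ℝ} (ht : t ∈ Ioo 0 T) (k : ℤ) :
    HasDerivAt (fun τ => ‖v τ k‖ ^ 2)
      (Complex.I * k * (v t (-k) * ∑' n, v t n * w t (k - n))).re t := by
  convert (hd t ht k).norm_sq using 1
  rw [hconj t k, Complex.inner]
  set z := v t k
  set q := ∑' n, v t n * w t (k - n)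
  -- The dispersive term is skew-adjoint, so it does not contribute to the derivative of `|z|²`.
  have hdispersive : (z * (-(Complex.I * ((k * |k| : ℤ) : ℂ)) * (starRingEnd ℂ) z)).re = 0 := by
    have himag : z * (-(Complex.I * ((k * |k| : ℤ) : ℂ)) * (starRingEnd ℂ) z) =
        ((-(((k * |k| : ℤ) : ℝ) * Complex.normSq z) : ℝ) : ℂ) * Complex.I := by
      rw [Complex.ofReal_neg, Complex.ofReal_mul, Complex.ofReal_intCast, ← Complex.mul_conj]
      ring
    rw [himag, Complex.re_ofReal_mul, Complex.I_re, mul_zero]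
  have hsplit : (starRingEnd ℂ) z * (-(Complex.I * ((k * |k| : ℤ) : ℂ)) * z +
      Complex.I * k / 2 * q) =
      z * (-(Complex.I * ((k * |k| : ℤ) : ℂ)) * (starRingEnd ℂ) z) +
      ((1 / 2 : ℝ) : ℂ) * (Complex.I * k * ((starRingEnd ℂ) z * q)) := by
    push_cast
    ring
  rw [mul_comm _ ((starRingEnd ℂ) z), hsplit, Complex.add_re, hdispersive, Complex.re_ofReal_mul]
  ring

lemma SolvesTransport.norm_sq_sub_norm_sq (hd : SolvesTransport T v w) (hv : RegularCoeffs T v)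
    (hw : RegularCoeffs T w) {t₀ : ℝ} (ht₀ : t₀ ∈ Icc 0 T) (k : ℤ) :
    ‖v t₀ k‖ ^ 2 - ‖v 0 k‖ ^ 2 = (Complex.I * k * ∑' n, triInt v v w t₀ (-k, n)).re := by
  have hsub : uIcc 0 t₀ ⊆ Icc 0 T := uIcc_of_le ht₀.1 ▸ Icc_subset_Icc_right ht₀.2
  have hcont : ContinuousOn (fun t => Complex.I * k * (v t (-k) * ∑' n, v t n * w t (k - n)))
      (uIcc 0 t₀) :=
    (continuousOn_const.mul ((hv.continuousOn (-k)).mul (continuousOn_convolution hv hw k))).mono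
      hsub
  have hftc := intervalIntegral.integral_eq_sub_of_hasDerivAt_of_le ht₀.1
    (((hv.continuousOn k).norm.pow 2).mono (Icc_subset_Icc_right ht₀.2))
    (fun t ht => hd.hasDerivAt_norm_sq hv.conj ⟨ht.1, ht.2.trans_le ht₀.2⟩ k)
    (Complex.continuous_re.comp_continuousOn hcont).intervalIntegrable
  rw [← integral_mul_convolution hv hw ht₀ k, ← intervalIntegral.integral_const_mul]
  exact hftc.symm.trans (Complex.reCLM.intervalIntegral_comp_comm hcont.intervalIntegrable)

variable {φ : ℤ → ℝ} {S : Finset ℤ} {P t₀ : ℝ}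

lemma integratedForm_eq_neg_sum (hv : RegularCoeffs T v) (hw : RegularCoeffs T w)
    (hφ : ∀ k, φ (-k) = φ k) (hS : ∀ k, φ k ≠ 0 → k ∈ S) (hP : ∀ k : ℤ, |k * φ k| ≤ P)
    (ht₀ : t₀ ∈ Icc 0 T) :
    integratedForm (fun p => p.1 * φ p.1) v v w t₀ =
      -∑ k ∈ S, ((k * φ k : ℝ) : ℂ) * ∑' n, triInt v v w t₀ (-k, n) := by
  have hterm (k : ℤ) : ∑' n, (((Equiv.neg ℤ k : ℤ) * φ (Equiv.neg ℤ k) : ℝ) : ℂ) *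
      triInt v v w t₀ (Equiv.neg ℤ k, n) =
      -(((k * φ k : ℝ) : ℂ) * ∑' n, triInt v v w t₀ (-k, n)) := by
    rw [tsum_mul_left, Equiv.neg_apply, hφ]
    push_cast
    ring
  rw [integratedForm, (summable_mul_triInt hv hv hw ht₀ fun p => hP p.1).tsum_prod,
    ← (Equiv.neg ℤ).tsum_eq, ← Finset.sum_neg_distrib]
  simp_rw [hterm]
  refine tsum_eq_sum fun k hk => ?_
  have hφk : φ k = 0 := by
    by_contra hne
    exact hk (hS k hne)
  rw [hφk, mul_zero, Complex.ofReal_zero, zero_mul, neg_zero]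

lemma SolvesTransport.sum_norm_sq_sub (hd : SolvesTransport T v w) (hv : RegularCoeffs T v)
    (hw : RegularCoeffs T w) (hφ : ∀ k, φ (-k) = φ k) (hS : ∀ k, φ k ≠ 0 → k ∈ S)
    (hP : ∀ k : ℤ, |k * φ k| ≤ P) (ht₀ : t₀ ∈ Icc 0 T) :
    ∑ k ∈ S, φ k * ‖v t₀ k‖ ^ 2 - ∑ k ∈ S, φ k * ‖v 0 k‖ ^ 2 =
      (-Complex.I * integratedForm (fun p => p.1 * φ p.1) v v w t₀).re := by
  rw [integratedForm_eq_neg_sum hv hw hφ hS hP ht₀, neg_mul_neg, Finset.mul_sum, Complex.re_sum,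
    ← Finset.sum_sub_distrib]
  refine Finset.sum_congr rfl fun k _ => ?_
  rw [← mul_sub, hd.norm_sq_sub_norm_sq hv hw ht₀, ← Complex.re_ofReal_mul]
  congr 1
  push_cast
  ring

lemma SolvesTransport.sum_norm_sq_le (hd : SolvesTransport T v w) (hv : RegularCoeffs T v)
    (hw : RegularCoeffs T w) (hφ : ∀ k, φ (-k) = φ k) (hS : ∀ k, φ k ≠ 0 → k ∈ S)
    (hP : ∀ k : ℤ, |k * φ k| ≤ P) (ht₀ : t₀ ∈ Icc 0 T) :
    ∑ k ∈ S, φ k * ‖v t₀ k‖ ^ 2 ≤ ∑ k ∈ S, φ k * ‖v 0 k‖ ^ 2 +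
      ‖integratedForm (fun p => p.1 * φ p.1) v v w t₀‖ := by
  have hre := Complex.re_le_norm (-Complex.I * integratedForm (fun p => p.1 * φ p.1) v v w t₀)
  rw [← hd.sum_norm_sq_sub hv hw hφ hS hP ht₀, norm_mul, norm_neg, Complex.norm_I, one_mul] at hre
  linarith

end Energy

/-! ### Decomposition into dyadic blocks -/

/-- The indices of the dyadic blocks that contain the frequencies `p.1`, `p.2` and `-p.1 - p.2`. -/
def blockIndex (p : ℤ × ℤ) : ℕ × ℕ × ℕ :=
  (Nat.log 2 p.1.natAbs, Nat.log 2 p.2.natAbs, Nat.log 2 (-p.1 - p.2).natAbs)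

/-- The symbol `m`, as a function of three frequencies, cut off to nonzero frequencies with sum zero
in the blocks with indices `i`. -/
noncomputable def localizedSymbol (m : ℤ × ℤ → ℝ) (i : ℕ × ℕ × ℕ) (k₁ k₂ k₃ : ℤ) : ℂ :=
  if k₁ + k₂ + k₃ = 0 ∧ (k₁ ∈ block i.1 ∧ k₁ ≠ 0) ∧ (k₂ ∈ block i.2.1 ∧ k₂ ≠ 0) ∧
    (k₃ ∈ block i.2.2 ∧ k₃ ≠ 0) then m (k₁, k₂) else 0

section Decomposition

variable {T : ℝ} {u₁ u₂ u₃ : ℝ → Torus → ℝ} {m : ℤ × ℤ → ℝ}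

lemma enorm_localizedSymbol_le {M : ℕ × ℕ × ℕ → ℝ≥0∞}
    (hM : ∀ p : ℤ × ℤ, p.1 ≠ 0 → p.2 ≠ 0 → -p.1 - p.2 ≠ 0 → ‖m p‖ₑ ≤ M (blockIndex p))
    (i : ℕ × ℕ × ℕ) (k₁ k₂ k₃ : ℤ) : ‖localizedSymbol m i k₁ k₂ k₃‖ₑ ≤ M i := by
  unfold localizedSymbol
  split_ifs with hk
  · obtain ⟨hsum, ⟨hmem₁, hne₁⟩, ⟨hmem₂, hne₂⟩, hmem₃, hne₃⟩ := hk
    obtain rfl : k₃ = -k₁ - k₂ := by omega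
    have hi : blockIndex (k₁, k₂) = i :=
      Prod.ext (mem_block_iff_log.mp hmem₁)
        (Prod.ext (mem_block_iff_log.mp hmem₂) (mem_block_iff_log.mp hmem₃))
    rw [← hi, ← ofReal_norm, Complex.norm_real, ofReal_norm]
    exact hM (k₁, k₂) hne₁ hne₂ hne₃
  · simp

lemma preimage_blockIndex (i : ℕ × ℕ × ℕ) :
    blockIndex ⁻¹' {i} =
      ((block i.1 ×ˢ block i.2.1).filter fun p => -p.1 - p.2 ∈ block i.2.2 : Finset (ℤ × ℤ)) := by
  ext p
  simp only [mem_preimage, mem_singleton_iff, Finset.coe_filter, Finset.mem_product,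
    mem_ofPred_eq, mem_block_iff_log, blockIndex, Prod.ext_iff, and_assoc]

lemma tsum_fiber_blockIndex (a b c : ℝ → ℤ → ℂ) (t₀ : ℝ) (m : ℤ × ℤ → ℝ) (i : ℕ × ℕ × ℕ)
    (hzero : ∀ p : ℤ × ℤ, p.1 = 0 ∨ p.2 = 0 ∨ -p.1 - p.2 = 0 → triInt a b c t₀ p = 0) :
    ∑' p : blockIndex ⁻¹' {i}, (m p : ℂ) * triInt a b c t₀ p =
      ∑ k₁ ∈ block i.1, ∑ k₂ ∈ block i.2.1, ∑ k₃ ∈ block i.2.2,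
        localizedSymbol m i k₁ k₂ k₃ * ∫ t in 0..t₀, a t k₁ * b t k₂ * c t k₃ := by
  rw [preimage_blockIndex, Finset.tsum_subtype' _ fun p => (m p : ℂ) * triInt a b c t₀ p,
    Finset.sum_filter, Finset.sum_product]
  refine Finset.sum_congr rfl fun k₁ hmem₁ => Finset.sum_congr rfl fun k₂ hmem₂ => ?_
  simp only [localizedSymbol]
  split_ifs with hmem₃
  · rw [Finset.sum_eq_single_of_mem _ hmem₃ fun k₃ _ hne => by
      rw [if_neg (fun hk => hne (by omega)), zero_mul]]
    split_ifs with hk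
    · rfl
    · rw [hzero, mul_zero, zero_mul]
      by_contra hne
      push Not at hne
      exact hk ⟨by ring, ⟨hmem₁, hne.1⟩, ⟨hmem₂, hne.2.1⟩, hmem₃, hne.2.2⟩
  · refine (Finset.sum_eq_zero fun k₃ hk₃ => ?_).symm
    rw [if_neg, zero_mul]
    rintro ⟨hsum, -⟩
    exact hmem₃ (by rwa [show -k₁ - k₂ = k₃ by omega])

theorem enorm_integratedForm_le (hT : 0 < T) (hT1 : T ≤ 1)
    (hu₁ : RegularCoeffs T fun t => fhat (u₁ t)) (hu₂ : RegularCoeffs T fun t => fhat (u₂ t))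
    (hu₃ : RegularCoeffs T fun t => fhat (u₃ t)) {P : ℝ} (hP : ∀ p, |m p| ≤ P)
    {M : ℕ × ℕ × ℕ → ℝ≥0∞} (hMtop : ∀ i, M i ≠ ⊤)
    (hM : ∀ p : ℤ × ℤ, p.1 ≠ 0 → p.2 ≠ 0 → -p.1 - p.2 ≠ 0 → ‖m p‖ₑ ≤ M (blockIndex p))
    {t₀ : ℝ} (ht₀ : t₀ ∈ Icc 0 T) :
    ‖integratedForm m (fun t => fhat (u₁ t)) (fun t => fhat (u₂ t)) (fun t => fhat (u₃ t)) t₀‖ₑ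
      ≤ trilinConst * ∑' i : ℕ × ℕ × ℕ, M i *
        (blockNorm T u₁ i.1 * blockNorm T u₂ i.2.1 * blockNorm T u₃ i.2.2) := by
  have hfibers := (summable_mul_triInt hu₁ hu₂ hu₃ ht₀ hP).hasSum.tsum_fiberwise blockIndex
  rw [integratedForm, ← hfibers.tsum_eq, ← ENNReal.tsum_mul_left]
  refine enorm_tsum_le_tsum_enorm.trans (ENNReal.tsum_le_tsum fun i => ?_)
  rw [tsum_fiber_blockIndex _ _ _ _ _ _ fun p hp => triInt_eq_zero hu₁ hu₂ hu₃ ht₀ hp, ← mul_assoc]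
  refine enorm_sum_integral_le hT hT1 hu₁.continuousOn hu₂.continuousOn hu₃.continuousOn (hMtop i)
    (enorm_localizedSymbol_le hM i) (fun k₁ k₂ k₃ hne => ?_) ht₀
  by_contra hk
  exact hne (if_neg hk)

end Decomposition

/-! ### Dyadic sums -/

/-- The weight `N ^ σ` at the dyadic frequency `N = 2 ^ j`. -/
noncomputable def dyadicWeight (σ : ℝ) (j : ℕ) : ℝ≥0∞ := ((2 : ℝ≥0∞) ^ j) ^ σ

lemma dyadicWeight_add (σ τ : ℝ) (j : ℕ) :
    dyadicWeight (σ + τ) j = dyadicWeight σ j * dyadicWeight τ j :=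
  ENNReal.rpow_add _ _ (by positivity) (by finiteness)

lemma dyadicWeight_one (j : ℕ) : dyadicWeight 1 j = 2 ^ j := ENNReal.rpow_one _

lemma dyadicWeight_zero (j : ℕ) : dyadicWeight 0 j = 1 := ENNReal.rpow_zero

lemma dyadicWeight_mono {σ : ℝ} (hσ : 0 ≤ σ) {i j : ℕ} (hij : i ≤ j) :
    dyadicWeight σ i ≤ dyadicWeight σ j :=
  ENNReal.rpow_le_rpow (pow_le_pow_right₀ (by norm_num) hij) hσ

lemma dyadicWeight_anti {δ : ℝ} (hδ : 0 ≤ δ) {i j : ℕ} (hij : i ≤ j) :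
    dyadicWeight (-δ) j ≤ dyadicWeight (-δ) i := by
  unfold dyadicWeight
  rw [ENNReal.rpow_neg, ENNReal.rpow_neg, ENNReal.inv_le_inv]
  exact dyadicWeight_mono hδ hij

lemma dyadicWeight_succ {σ : ℝ} (hσ : 0 ≤ σ) (j : ℕ) :
    dyadicWeight σ (j + 1) = 2 ^ σ * dyadicWeight σ j := by
  unfold dyadicWeight
  rw [pow_succ', ENNReal.mul_rpow_of_nonneg _ _ hσ]

/-- The sum of the negative powers `N ^ (-δ)` of the dyadic frequencies. -/
noncomputable def dyadicSum (δ : ℝ) : ℝ≥0∞ := ∑' j, dyadicWeight (-δ) j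

lemma dyadicSum_ne_top {δ : ℝ} (hδ : 0 < δ) : dyadicSum δ ≠ ⊤ := by
  have hgeom (j : ℕ) : dyadicWeight (-δ) j = ((2 : ℝ≥0∞) ^ (-δ)) ^ j := by
    unfold dyadicWeight
    rw [← ENNReal.rpow_natCast, ← ENNReal.rpow_natCast, ← ENNReal.rpow_mul, ← ENNReal.rpow_mul,
      mul_comm]
  simp_rw [dyadicSum, hgeom]
  rw [ENNReal.tsum_geometric]
  refine ENNReal.inv_ne_top.mpr (tsub_pos_of_lt ?_).ne'
  exact ENNReal.rpow_lt_one_of_one_lt_of_neg (by norm_num) (by linarith)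

lemma rpow_half_sq (x : ℝ≥0∞) : (x ^ (1 / 2 : ℝ)) ^ 2 = x := by
  rw [← ENNReal.rpow_natCast, ← ENNReal.rpow_mul]
  norm_num

/-- The `ℓ²` norm of a sequence. -/
noncomputable def ell2 (X : ℕ → ℝ≥0∞) : ℝ≥0∞ := (∑' j, X j ^ 2) ^ (1 / 2 : ℝ)

lemma ell2_sq (X : ℕ → ℝ≥0∞) : ell2 X ^ 2 = ∑' j, X j ^ 2 := rpow_half_sq _

lemma le_ell2 (X : ℕ → ℝ≥0∞) (j : ℕ) : X j ≤ ell2 X := by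
  rw [← ENNReal.pow_le_pow_left_iff two_ne_zero, ell2_sq]
  exact ENNReal.le_tsum (f := fun j => X j ^ 2) j

/-- Two dyadic indices differ by at most one. -/
abbrev Near (i j : ℕ) : Prop := i ≤ j + 1 ∧ j ≤ i + 1

lemma near_comm {i j : ℕ} : Near i j ↔ Near j i := and_comm

lemma tsum_near_le (a : ℕ) {f : ℕ → ℝ≥0∞} {B : ℝ≥0∞} (hf : ∀ j, Near j a → f j ≤ B) :
    ∑' j, (if Near j a then f j else 0) ≤ 3 * B := by
  rw [tsum_eq_sum (s := Finset.Icc (a - 1) (a + 1))]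
  · refine (Finset.sum_le_card_nsmul _ _ B fun j _ => ?_).trans ?_
    · split_ifs with hj
      · exact hf j hj
      · exact zero_le
    · rw [nsmul_eq_mul, Nat.card_Icc]
      gcongr
      exact_mod_cast (by omega : a + 1 + 1 - (a - 1) ≤ 3)
  · intro j hj
    rw [if_neg]
    rintro ⟨hja, haj⟩
    exact hj (Finset.mem_Icc.mpr ⟨by omega, hja⟩)

lemma tsum_near_mul_le (X Y : ℕ → ℝ≥0∞) :
    ∑' a, ∑' b, (if Near a b then X a * Y b else 0) ≤ 3 * (ell2 X * ell2 Y) := by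
  have hcauchySchwarz := ennreal_tsum_mul_sq_le
    (fun p : ℕ × ℕ => if Near p.1 p.2 then X p.1 else 0)
    fun p => if Near p.1 p.2 then Y p.2 else 0
  simp only [ENNReal.tsum_prod', ite_mul_ite, mul_zero, ite_pow, ne_eq, OfNat.ofNat_ne_zero,
    not_false_eq_true, zero_pow] at hcauchySchwarz
  have hX : ∑' a, ∑' b, (if Near a b then X a ^ 2 else 0) ≤ 3 * ell2 X ^ 2 := by
    rw [ell2_sq, ← ENNReal.tsum_mul_left]
    refine ENNReal.tsum_le_tsum fun a => ?_
    simp_rw [near_comm (i := a)]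
    exact tsum_near_le a fun _ _ => le_rfl
  have hY : ∑' a, ∑' b, (if Near a b then Y b ^ 2 else 0) ≤ 3 * ell2 Y ^ 2 := by
    rw [ENNReal.tsum_comm, ell2_sq, ← ENNReal.tsum_mul_left]
    exact ENNReal.tsum_le_tsum fun b => tsum_near_le b fun _ _ => le_rfl
  rw [← ENNReal.pow_le_pow_left_iff two_ne_zero]
  refine (hcauchySchwarz.trans (mul_le_mul' hX hY)).trans (le_of_eq ?_)
  ring

lemma tsum_near₁₂_le (X Y Z : ℕ → ℝ≥0∞) :
    ∑' i : ℕ × ℕ × ℕ, (if Near i.1 i.2.1 then X i.1 * Y i.2.1 * Z i.2.2 else 0) ≤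
      3 * (ell2 X * ell2 Y) * ∑' c, Z c := by
  simp_rw [ENNReal.tsum_prod']
  refine le_trans (le_of_eq ?_) (mul_le_mul_left (tsum_near_mul_le X Y) _)
  rw [← ENNReal.tsum_mul_right]
  refine tsum_congr fun a => ?_
  rw [← ENNReal.tsum_mul_right]
  refine tsum_congr fun b => ?_
  rw [← ENNReal.tsum_mul_left]
  refine tsum_congr fun c => ?_
  split_ifs <;> simp

lemma tsum_near₁₃_le (X Y Z : ℕ → ℝ≥0∞) :
    ∑' i : ℕ × ℕ × ℕ, (if Near i.1 i.2.2 then X i.1 * Y i.2.2 * Z i.2.1 else 0) ≤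
      3 * (ell2 X * ell2 Y) * ∑' c, Z c := by
  refine le_trans (le_of_eq ?_) (tsum_near₁₂_le X Y Z)
  simp_rw [ENNReal.tsum_prod']
  exact tsum_congr fun a => ENNReal.tsum_comm

lemma tsum_near₂₃_le (X Y Z : ℕ → ℝ≥0∞) :
    ∑' i : ℕ × ℕ × ℕ, (if Near i.2.1 i.2.2 then X i.2.1 * Y i.2.2 * Z i.1 else 0) ≤
      3 * (ell2 X * ell2 Y) * ∑' c, Z c := by
  refine le_trans (le_of_eq ?_) (tsum_near₁₃_le X Y Z)
  simp_rw [ENNReal.tsum_prod']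
  exact ENNReal.tsum_comm

/-- The triples of dyadic blocks that interact. -/
abbrev Admissible (i : ℕ × ℕ × ℕ) : Prop :=
  i.1 ≤ max i.2.1 i.2.2 + 1 ∧ i.2.1 ≤ max i.1 i.2.2 + 1 ∧ i.2.2 ≤ max i.1 i.2.1 + 1

/-- The largest of three indices. -/
abbrev top (i : ℕ × ℕ × ℕ) : ℕ := max i.1 (max i.2.1 i.2.2)

/-- The smallest of three indices. -/
abbrev bot (i : ℕ × ℕ × ℕ) : ℕ := min i.1 (min i.2.1 i.2.2)

lemma dyadicWeight_top_le {σ : ℝ} (hσ : 0 ≤ σ) {J a b : ℕ} (ha : J ≤ a + 1) (hb : J ≤ b + 1) :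
    dyadicWeight (2 * σ) (J + 1) ≤ (2 ^ σ) ^ 4 * (dyadicWeight σ a * dyadicWeight σ b) := by
  have hshift (c : ℕ) (hc : J ≤ c + 1) :
      dyadicWeight σ (J + 1) ≤ (2 ^ σ) ^ 2 * dyadicWeight σ c := by
    refine (dyadicWeight_mono hσ (show J + 1 ≤ c + 1 + 1 by omega)).trans (le_of_eq ?_)
    rw [dyadicWeight_succ hσ, dyadicWeight_succ hσ]
    ring
  rw [two_mul, dyadicWeight_add]
  refine (mul_le_mul' (hshift a ha) (hshift b hb)).trans (le_of_eq ?_)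
  ring

lemma two_pow_eq_dyadicWeight (s : ℝ) (j : ℕ) :
    (2 : ℝ≥0∞) ^ j = dyadicWeight (-(s - 1)) j * dyadicWeight s j := by
  rw [← dyadicWeight_add, ← dyadicWeight_one]
  congr 1
  ring

lemma tsum_dyadicWeight_mul_le (δ : ℝ) (X : ℕ → ℝ≥0∞) :
    ∑' j, dyadicWeight (-δ) j * X j ≤ dyadicSum δ * ell2 X := by
  rw [dyadicSum, ← ENNReal.tsum_mul_right]
  gcongr with j
  exact le_ell2 X j

lemma dyadicWeight_top_mul_two_pow_le {σ : ℝ} (hσ : 0 ≤ σ) (s : ℝ) {J a b : ℕ} (ha : J ≤ a + 1)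
    (hb : J ≤ b + 1) (c : ℕ) :
    dyadicWeight (2 * σ) (J + 1) * 2 ^ c ≤ (2 ^ σ) ^ 4 * (dyadicWeight σ a * dyadicWeight σ b) *
      (dyadicWeight (-(s - 1)) c * dyadicWeight s c) :=
  mul_le_mul' (dyadicWeight_top_le hσ ha hb) (two_pow_eq_dyadicWeight s c).le

/-- In an interacting triple the two larger frequencies are comparable, so the sum over such triples
reduces to three sums over two neighbouring indices and a free one. -/
lemma tsum_admissible_le {F : ℕ × ℕ × ℕ → ℝ≥0∞} {X Y Z X' Y' Z' : ℕ → ℝ≥0∞}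
    (h₁₂ : ∀ i, bot i = i.2.2 → top i ≤ i.1 + 1 → top i ≤ i.2.1 + 1 →
      F i ≤ X i.1 * Y i.2.1 * Z i.2.2)
    (h₁₃ : ∀ i, bot i = i.2.1 → top i ≤ i.1 + 1 → top i ≤ i.2.2 + 1 →
      F i ≤ X' i.1 * Y' i.2.2 * Z' i.2.1)
    (h₂₃ : ∀ i, bot i = i.1 → top i ≤ i.2.1 + 1 → top i ≤ i.2.2 + 1 →
      F i ≤ X' i.2.1 * Y' i.2.2 * Z' i.1) :
    ∑' i, (if Admissible i then F i else 0) ≤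
      3 * (ell2 X * ell2 Y) * ∑' c, Z c + 6 * (ell2 X' * ell2 Y') * ∑' c, Z' c := by
  simp only [top, bot] at h₁₂ h₁₃ h₂₃
  have hpoint (i : ℕ × ℕ × ℕ) : (if Admissible i then F i else 0) ≤
      (if Near i.1 i.2.1 then X i.1 * Y i.2.1 * Z i.2.2 else 0) +
      (if Near i.1 i.2.2 then X' i.1 * Y' i.2.2 * Z' i.2.1 else 0) +
      (if Near i.2.1 i.2.2 then X' i.2.1 * Y' i.2.2 * Z' i.1 else 0) := by
    by_cases hadm : Admissible i
    swap
    · rw [if_neg hadm]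
      exact zero_le
    rw [if_pos hadm]
    rcases le_total i.2.2 (min i.1 i.2.1) with hthird | hthird
    · refine le_trans ?_ (le_self_add.trans le_self_add)
      rw [if_pos (by omega)]
      exact h₁₂ i (by omega) (by omega) (by omega)
    rcases le_total i.2.1 i.1 with hsecond | hfirst
    · refine le_trans ?_ (le_add_self.trans le_self_add)
      rw [if_pos (by omega)]
      exact h₁₃ i (by omega) (by omega) (by omega)
    · refine le_trans ?_ le_add_self
      rw [if_pos (by omega)]
      exact h₂₃ i (by omega) (by omega) (by omega)
  refine (ENNReal.tsum_le_tsum hpoint).trans ?_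
  rw [ENNReal.tsum_add, ENNReal.tsum_add]
  refine (add_le_add_three (tsum_near₁₂_le X Y Z) (tsum_near₁₃_le X' Y' Z')
    (tsum_near₂₃_le X' Y' Z')).trans (le_of_eq ?_)
  ring

theorem tsum_admissible_third_le {σ s : ℝ} (hσ : 0 ≤ σ) (hs : 1 ≤ s) (A B : ℕ → ℝ≥0∞) :
    ∑' i : ℕ × ℕ × ℕ, (if Admissible i then dyadicWeight (2 * σ) (top i + 1) * 2 ^ i.2.2 *
        (A i.1 * A i.2.1 * B i.2.2) else 0) ≤
      6 * (2 ^ σ) ^ 4 * dyadicSum (s - 1) *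
        (ell2 (fun j => dyadicWeight σ j * A j) ^ 2 * ell2 (fun j => dyadicWeight s j * B j) +
          ell2 A * ell2 (fun j => dyadicWeight σ j * A j) *
            ell2 (fun j => dyadicWeight (σ + s) j * B j)) := by
  set X : ℕ → ℝ≥0∞ := fun j => dyadicWeight σ j * A j
  set Y : ℕ → ℝ≥0∞ := fun j => dyadicWeight (σ + s) j * B j
  set V : ℕ → ℝ≥0∞ := fun j => dyadicWeight s j * B j
  set κ : ℝ≥0∞ := (2 ^ σ) ^ 4
  have hlow (J a c d : ℕ) (ha : J ≤ a + 1) (hc : J ≤ c + 1) (hdc : d ≤ c) :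
      dyadicWeight (2 * σ) (J + 1) * 2 ^ c * (A a * A d * B c) ≤
        X a * Y c * (κ * (dyadicWeight (-(s - 1)) d * A d)) :=
    calc dyadicWeight (2 * σ) (J + 1) * 2 ^ c * (A a * A d * B c)
        ≤ κ * (dyadicWeight σ a * dyadicWeight σ c) *
          (dyadicWeight (-(s - 1)) d * dyadicWeight s c) * (A a * A d * B c) := by
          refine mul_le_mul_left ((dyadicWeight_top_mul_two_pow_le hσ s ha hc c).trans ?_) _
          gcongr
          exact dyadicWeight_anti (by linarith) hdc
      _ = _ := by
          simp only [X, Y, dyadicWeight_add]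
          ring
  have hthird (i : ℕ × ℕ × ℕ) : bot i ≤ i.2.2 := (min_le_right _ _).trans (min_le_right _ _)
  refine (tsum_admissible_le (X := X) (Y := X) (X' := X) (Y' := Y)
    (Z := fun c => κ * (dyadicWeight (-(s - 1)) c * V c))
    (Z' := fun d => κ * (dyadicWeight (-(s - 1)) d * A d)) (fun i _ h₁ h₂ => ?_)
    (fun i hi h₁ h₃ => hlow _ _ _ _ h₁ h₃ (hi ▸ hthird i)) fun i hi h₂ h₃ => ?_).trans ?_
  · refine (mul_le_mul_left (dyadicWeight_top_mul_two_pow_le hσ s h₁ h₂ i.2.2) _).trans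
      (le_of_eq ?_)
    simp only [X, V]
    ring
  · rw [mul_comm (A i.1)]
    exact hlow _ _ _ _ h₂ h₃ (hi ▸ hthird i)
  rw [ENNReal.tsum_mul_left, ENNReal.tsum_mul_left]
  calc _ ≤ 6 * (ell2 X * ell2 X) * (κ * (dyadicSum (s - 1) * ell2 V)) +
        6 * (ell2 X * ell2 Y) * (κ * (dyadicSum (s - 1) * ell2 A)) := by
        gcongr
        · norm_num
        · exact tsum_dyadicWeight_mul_le _ _
        · exact tsum_dyadicWeight_mul_le _ _
    _ = _ := by ring

theorem tsum_admissible_bot_le {s : ℝ} (hs : 0 ≤ s) (A : ℕ → ℝ≥0∞) :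
    ∑' i : ℕ × ℕ × ℕ, (if Admissible i then dyadicWeight (2 * s) (top i + 1) * 2 ^ bot i *
        (A i.1 * A i.2.1 * A i.2.2) else 0) ≤
      9 * (2 ^ s) ^ 4 * dyadicSum (s - 1) * ell2 (fun j => dyadicWeight s j * A j) ^ 3 := by
  set X : ℕ → ℝ≥0∞ := fun j => dyadicWeight s j * A j
  set Z : ℕ → ℝ≥0∞ := fun j => (2 ^ s) ^ 4 * (dyadicWeight (-(s - 1)) j * X j)
  have hbot (J a b c : ℕ) (ha : J ≤ a + 1) (hb : J ≤ b + 1) :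
      dyadicWeight (2 * s) (J + 1) * 2 ^ c * (A a * A b * A c) ≤ X a * X b * Z c := by
    refine (mul_le_mul_left (dyadicWeight_top_mul_two_pow_le hs s ha hb c) _).trans (le_of_eq ?_)
    simp only [X, Z]
    ring
  refine (tsum_admissible_le (X := X) (Y := X) (Z := Z) (X' := X) (Y' := X) (Z' := Z)
    (fun i hi h₁ h₂ => ?_) (fun i hi h₁ h₃ => ?_) fun i hi h₂ h₃ => ?_).trans ?_
  · rw [hi]
    exact hbot _ _ _ _ h₁ h₂
  · rw [hi, mul_right_comm (A i.1)]
    exact hbot _ _ _ _ h₁ h₃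
  · rw [hi, mul_assoc (A i.1), mul_comm (A i.1)]
    exact hbot _ _ _ _ h₂ h₃
  have hZ : ∑' c, Z c ≤ (2 ^ s) ^ 4 * (dyadicSum (s - 1) * ell2 X) := by
    rw [ENNReal.tsum_mul_left]
    gcongr
    exact tsum_dyadicWeight_mul_le _ _
  refine (add_le_add (mul_le_mul_right hZ _) (mul_le_mul_right hZ _)).trans (le_of_eq ?_)
  ring

/-- The index `j` is close to one of three indices. -/
abbrev NearAny (j : ℕ) (i : ℕ × ℕ × ℕ) : Prop := Near j i.1 ∨ Near j i.2.1 ∨ Near j i.2.2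

/-- The bound for the symbol of the energy of block `j` on the triple `i` of blocks. -/
noncomputable def symbolBound (μ : ℕ × ℕ × ℕ → ℝ≥0∞) (j : ℕ) (i : ℕ × ℕ × ℕ) : ℝ≥0∞ :=
  if NearAny j i ∧ Admissible i then 9 * μ i else 0

lemma tsum_dyadicWeight_symbolBound_le {σ : ℝ} (hσ : 0 ≤ σ) (μ : ℕ × ℕ × ℕ → ℝ≥0∞)
    (i : ℕ × ℕ × ℕ) : ∑' j, dyadicWeight (2 * σ) j * symbolBound μ j i ≤
      81 * if Admissible i then dyadicWeight (2 * σ) (top i + 1) * μ i else 0 := by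
  by_cases hadm : Admissible i
  swap
  · simp only [symbolBound, hadm, and_false, if_false, mul_zero, tsum_zero, zero_le]
  have h2σ : 0 ≤ 2 * σ := by linarith
  have hpoint (j : ℕ) : dyadicWeight (2 * σ) j * symbolBound μ j i ≤
      ((if Near j i.1 then dyadicWeight (2 * σ) j else 0) +
      (if Near j i.2.1 then dyadicWeight (2 * σ) j else 0) +
      (if Near j i.2.2 then dyadicWeight (2 * σ) j else 0)) * (9 * μ i) := by
    by_cases hnear : NearAny j i
    · rw [symbolBound, if_pos ⟨hnear, hadm⟩]
      gcongr
      rcases hnear with hnear | hnear | hnear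
      · rw [if_pos hnear]; exact le_self_add.trans le_self_add
      · rw [if_pos hnear]; exact le_add_self.trans le_self_add
      · rw [if_pos hnear]; exact le_add_self
    · rw [symbolBound, if_neg (fun hand => hnear hand.1), mul_zero]
      exact zero_le
  have hnearSum (a : ℕ) (ha : a ≤ top i) :
      ∑' j, (if Near j a then dyadicWeight (2 * σ) j else 0) ≤
        3 * dyadicWeight (2 * σ) (top i + 1) :=
    tsum_near_le a fun _ hj => dyadicWeight_mono h2σ (hj.1.trans (by omega))
  refine (ENNReal.tsum_le_tsum hpoint).trans ?_
  rw [ENNReal.tsum_mul_right, ENNReal.tsum_add, ENNReal.tsum_add, if_pos hadm]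
  calc _ ≤ (3 * dyadicWeight (2 * σ) (top i + 1) + 3 * dyadicWeight (2 * σ) (top i + 1) +
        3 * dyadicWeight (2 * σ) (top i + 1)) * (9 * μ i) := by
        gcongr
        · exact hnearSum _ (by simp only [top]; omega)
        · exact hnearSum _ (by simp only [top]; omega)
        · exact hnearSum _ (by simp only [top]; omega)
    _ = _ := by ring

lemma tsum_tsum_symbolBound_le {σ : ℝ} (hσ : 0 ≤ σ) (μ Q : ℕ × ℕ × ℕ → ℝ≥0∞) :
    ∑' j, dyadicWeight (2 * σ) j * ∑' i, symbolBound μ j i * Q i ≤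
      81 * ∑' i, if Admissible i then dyadicWeight (2 * σ) (top i + 1) * μ i * Q i else 0 := by
  simp_rw [← ENNReal.tsum_mul_left]
  rw [ENNReal.tsum_comm]
  refine ENNReal.tsum_le_tsum fun i => ?_
  simp_rw [← mul_assoc]
  rw [ENNReal.tsum_mul_right]
  refine (mul_le_mul_left (tsum_dyadicWeight_symbolBound_le hσ μ i) _).trans (le_of_eq ?_)
  split_ifs <;> ring

/-! ### Symmetrized symbols -/

/-- A Lipschitz cutoff to `|k| ~ 2 ^ j` that equals one on the nonzero part of `block j`. -/
noncomputable def tent (j : ℕ) (k : ℤ) : ℝ :=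
  max 0 (min 1 (min (2 * |(k : ℝ)| / 2 ^ j - 1) (2 - |(k : ℝ)| / 2 ^ (j + 1))))

lemma tent_nonneg (j : ℕ) (k : ℤ) : 0 ≤ tent j k := le_max_left _ _

lemma tent_le_one (j : ℕ) (k : ℤ) : tent j k ≤ 1 := max_le zero_le_one (min_le_left _ _)

lemma tent_neg (j : ℕ) (k : ℤ) : tent j (-k) = tent j k := by
  simp only [tent, Int.cast_neg, abs_neg]

lemma tent_zero (j : ℕ) : tent j 0 = 0 := by
  norm_num [tent]

lemma tent_of_mem_block {j : ℕ} {k : ℤ} (hk : k ∈ block j) (hk0 : k ≠ 0) : tent j k = 1 := by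
  have hlower : (2 : ℝ) ^ j ≤ |(k : ℝ)| := by exact_mod_cast two_pow_le_abs_of_mem_block hk hk0
  have hupper : |(k : ℝ)| < 2 ^ (j + 1) := by exact_mod_cast abs_lt_of_mem_block hk
  have hleft : 1 ≤ 2 * |(k : ℝ)| / 2 ^ j - 1 := by
    rw [le_sub_iff_add_le, le_div_iff₀ (by positivity)]
    linarith
  have hright : 1 ≤ 2 - |(k : ℝ)| / 2 ^ (j + 1) := by
    rw [le_sub_comm, div_le_iff₀ (by positivity)]
    linarith
  rw [tent, min_eq_left (le_min hleft hright), max_eq_right zero_le_one]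

lemma lt_of_tent_ne_zero {j : ℕ} {k : ℤ} (hk : tent j k ≠ 0) :
    (2 : ℝ) ^ j < 2 * |(k : ℝ)| ∧ |(k : ℝ)| < 2 ^ (j + 2) := by
  have hpos := lt_of_le_of_ne (tent_nonneg j k) hk.symm
  rw [tent, lt_max_iff, lt_min_iff, lt_min_iff] at hpos
  obtain ⟨-, hlower, hupper⟩ := hpos.resolve_left (lt_irrefl _)
  rw [lt_sub_iff_add_lt, zero_add, lt_div_iff₀ (by positivity), one_mul] at hlower
  rw [lt_sub_comm, sub_zero, div_lt_iff₀ (by positivity)] at hupper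
  exact ⟨hlower, hupper.trans_eq (by ring)⟩

lemma natAbs_of_tent_ne_zero {j : ℕ} {k : ℤ} (hk : tent j k ≠ 0) :
    2 ^ j < 2 * k.natAbs ∧ k.natAbs < 2 ^ (j + 2) := by
  have hreal := lt_of_tent_ne_zero hk
  rw [← Int.cast_abs, Int.abs_eq_natAbs] at hreal
  exact ⟨by exact_mod_cast hreal.1, by exact_mod_cast hreal.2⟩

lemma near_of_tent_ne_zero {j : ℕ} {k : ℤ} (hk : tent j k ≠ 0) :
    Near j (Nat.log 2 k.natAbs) := by
  obtain ⟨hlower, hupper⟩ := natAbs_of_tent_ne_zero hk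
  have hk0 : k.natAbs ≠ 0 := fun hk0 => by simp [hk0] at hlower
  have hlog := Nat.lt_pow_succ_log_self one_lt_two k.natAbs
  have hj : 2 ^ j < 2 ^ (Nat.log 2 k.natAbs + 2) := hlower.trans (by rw [pow_succ]; omega)
  have hj' := (Nat.pow_lt_pow_iff_right one_lt_two).mp hj
  have hlog' := (Nat.pow_lt_pow_iff_right one_lt_two).mp
    ((Nat.pow_log_le_self 2 hk0).trans_lt hupper)
  exact ⟨by omega, by omega⟩

/-- The frequencies at which `tent j` may be nonzero. -/
noncomputable def tentSupport (j : ℕ) : Finset ℤ := Finset.Ioo (-2 ^ (j + 2)) (2 ^ (j + 2))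

lemma mem_tentSupport {j : ℕ} {k : ℤ} (hk : tent j k ≠ 0) : k ∈ tentSupport j := by
  have hlt : |k| < 2 ^ (j + 2) := by exact_mod_cast (lt_of_tent_ne_zero hk).2
  exact Finset.mem_Ioo.mpr (abs_lt.mp hlt)

lemma abs_tent_sub_le (j : ℕ) (k l : ℤ) :
    |tent j k - tent j l| ≤ 2 / 2 ^ j * |(k : ℝ) - l| := by
  have habs : |(|(k : ℝ)| - |(l : ℝ)|)| ≤ |(k : ℝ) - l| := abs_abs_sub_abs_le_abs_sub _ _
  have hleft : |2 * |(k : ℝ)| / 2 ^ j - 1 - (2 * |(l : ℝ)| / 2 ^ j - 1)| ≤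
      2 / 2 ^ j * |(k : ℝ) - l| := by
    rw [show 2 * |(k : ℝ)| / 2 ^ j - 1 - (2 * |(l : ℝ)| / 2 ^ j - 1) =
      2 / 2 ^ j * (|(k : ℝ)| - |(l : ℝ)|) by ring, abs_mul, abs_of_nonneg (by positivity)]
    gcongr
  have hright : |2 - |(k : ℝ)| / 2 ^ (j + 1) - (2 - |(l : ℝ)| / 2 ^ (j + 1))| ≤
      2 / 2 ^ j * |(k : ℝ) - l| := by
    rw [show 2 - |(k : ℝ)| / 2 ^ (j + 1) - (2 - |(l : ℝ)| / 2 ^ (j + 1)) =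
      -(1 / 2 / 2 ^ j * (|(k : ℝ)| - |(l : ℝ)|)) by rw [pow_succ]; field_simp; ring,
      abs_neg, abs_mul, abs_of_nonneg (by positivity)]
    gcongr
    norm_num
  unfold tent
  refine (abs_max_sub_max_le_max _ _ _ _).trans (max_le (by simp) ?_)
  refine (abs_min_sub_min_le_max _ _ _ _).trans (max_le (by simp) ?_)
  exact (abs_min_sub_min_le_max _ _ _ _).trans (max_le hleft hright)

/-- The symbol `k · tent j k`. -/
noncomputable def tentSymbol (j : ℕ) (k : ℤ) : ℝ := k * tent j k

lemma tentSymbol_neg (j : ℕ) (k : ℤ) : tentSymbol j (-k) = -tentSymbol j k := by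
  simp only [tentSymbol, tent_neg, Int.cast_neg, neg_mul]

lemma abs_tentSymbol_le (j : ℕ) (k : ℤ) : |tentSymbol j k| ≤ |(k : ℝ)| := by
  rw [tentSymbol, abs_mul, abs_of_nonneg (tent_nonneg j k)]
  exact mul_le_of_le_one_right (abs_nonneg _) (tent_le_one j k)

lemma abs_tentSymbol_le_two_pow (j : ℕ) (k : ℤ) : |tentSymbol j k| ≤ 2 ^ (j + 2) := by
  by_cases hk : tent j k = 0
  · rw [tentSymbol, hk, mul_zero, abs_zero]; positivity
  · exact (abs_tentSymbol_le j k).trans (lt_of_tent_ne_zero hk).2.le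

lemma abs_tentSymbol_sub_le (j : ℕ) (k l : ℤ) :
    |tentSymbol j k - tentSymbol j l| ≤ 9 * |(k : ℝ) - l| := by
  have hsupport (k l : ℤ) (hk : tent j k ≠ 0) :
      |tentSymbol j k - tentSymbol j l| ≤ 9 * |(k : ℝ) - l| := by
    have hlipschitz := abs_tent_sub_le j k l
    have hupper := (lt_of_tent_ne_zero hk).2
    calc |tentSymbol j k - tentSymbol j l|
        = |k * (tent j k - tent j l) + (k - l) * tent j l| := by
          congr 1
          simp only [tentSymbol]
          ring
      _ ≤ |(k : ℝ)| * |tent j k - tent j l| + |(k : ℝ) - l| * |tent j l| := by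
          refine (abs_add_le _ _).trans (le_of_eq ?_)
          rw [abs_mul, abs_mul]
      _ ≤ 2 ^ (j + 2) * (2 / 2 ^ j * |(k : ℝ) - l|) + |(k : ℝ) - l| * 1 := by
          gcongr
          rw [abs_of_nonneg (tent_nonneg j l)]
          exact tent_le_one j l
      _ = _ := by
          rw [pow_add]
          field_simp
          ring
  by_cases hk : tent j k = 0
  · by_cases hl : tent j l = 0
    · simp only [tentSymbol, hk, hl, mul_zero, sub_zero, abs_zero]
      positivity
    · rw [abs_sub_comm, abs_sub_comm (k : ℝ)]
      exact hsupport l k hl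
  · exact hsupport k l hk

lemma abs_tentSymbol_add_le (j : ℕ) (k l : ℤ) :
    |tentSymbol j k + tentSymbol j l| ≤ 9 * |(k : ℝ) + l| := by
  have hsub := abs_tentSymbol_sub_le j k (-l)
  rwa [tentSymbol_neg, sub_neg_eq_add, Int.cast_neg, sub_neg_eq_add] at hsub

lemma abs_tentSymbol_sum_le (j : ℕ) {k l m : ℤ} (hsum : k + l + m = 0) :
    |tentSymbol j k + tentSymbol j l + tentSymbol j m| ≤ 10 * |(m : ℝ)| := by
  have hadd := abs_tentSymbol_add_le j k l
  rw [show (k : ℝ) + l = -m by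
    rw [eq_neg_iff_add_eq_zero]
    exact_mod_cast hsum, abs_neg] at hadd
  linarith [abs_add_le (tentSymbol j k + tentSymbol j l) (tentSymbol j m), abs_tentSymbol_le j m]

lemma log_natAbs_le_max {k l m : ℤ} (hsum : k + l + m = 0) (hk : k ≠ 0) :
    Nat.log 2 k.natAbs ≤ max (Nat.log 2 l.natAbs) (Nat.log 2 m.natAbs) + 1 := by
  set M := max (Nat.log 2 l.natAbs) (Nat.log 2 m.natAbs)
  have hl : l.natAbs < 2 ^ (M + 1) := (Nat.lt_pow_succ_log_self one_lt_two _).trans_le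
    (Nat.pow_le_pow_right two_pos (Nat.succ_le_succ (le_max_left _ _)))
  have hm : m.natAbs < 2 ^ (M + 1) := (Nat.lt_pow_succ_log_self one_lt_two _).trans_le
    (Nat.pow_le_pow_right two_pos (Nat.succ_le_succ (le_max_right _ _)))
  have hk' := Nat.pow_log_le_self 2 (Int.natAbs_ne_zero.mpr hk)
  have hlt : 2 ^ Nat.log 2 k.natAbs < 2 ^ (M + 2) := by
    rw [pow_succ _ (M + 1)]
    omega
  exact Nat.lt_succ_iff.mp ((Nat.pow_lt_pow_iff_right one_lt_two).mp hlt)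

lemma admissible_blockIndex {p : ℤ × ℤ} (h₁ : p.1 ≠ 0) (h₂ : p.2 ≠ 0) (h₃ : -p.1 - p.2 ≠ 0) :
    Admissible (blockIndex p) :=
  ⟨log_natAbs_le_max (by ring) h₁, log_natAbs_le_max (by ring) h₂, log_natAbs_le_max (by ring) h₃⟩

lemma abs_le_two_mul_two_pow_log (k : ℤ) : |(k : ℝ)| ≤ 2 * 2 ^ Nat.log 2 k.natAbs := by
  have hlog := Nat.lt_pow_succ_log_self one_lt_two k.natAbs
  rw [← Int.cast_abs, Int.abs_eq_natAbs, ← pow_succ']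
  exact_mod_cast hlog.le

lemma tentSymbol_eq_zero_of_not_nearAny {j : ℕ} {p : ℤ × ℤ} (hp : ¬NearAny j (blockIndex p)) :
    tentSymbol j p.1 = 0 ∧ tentSymbol j p.2 = 0 ∧ tentSymbol j (-p.1 - p.2) = 0 := by
  have hzero (k : ℤ) (hk : ¬Near j (Nat.log 2 k.natAbs)) : tentSymbol j k = 0 := by
    rw [tentSymbol, not_imp_comm.mp near_of_tent_ne_zero hk, mul_zero]
  simp only [NearAny, not_or] at hp
  exact ⟨hzero _ hp.1, hzero _ hp.2.1, hzero _ hp.2.2⟩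

lemma enorm_le_symbolBound {x : ℝ} {n : ℕ × ℕ × ℕ → ℕ} {j : ℕ} {p : ℤ × ℤ} (h₁ : p.1 ≠ 0)
    (h₂ : p.2 ≠ 0) (h₃ : -p.1 - p.2 ≠ 0) (hx : |x| ≤ 9 * 2 ^ n (blockIndex p))
    (hzero : ¬NearAny j (blockIndex p) → x = 0) :
    ‖x‖ₑ ≤ symbolBound (fun i => 2 ^ n i) j (blockIndex p) := by
  by_cases hnear : NearAny j (blockIndex p)
  · rw [symbolBound, if_pos ⟨hnear, admissible_blockIndex h₁ h₂ h₃⟩, Real.enorm_eq_ofReal_abs]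
    refine (ENNReal.ofReal_le_ofReal hx).trans (le_of_eq ?_)
    rw [ENNReal.ofReal_mul (by norm_num), ENNReal.ofReal_pow (by norm_num)]
    norm_num
  · rw [hzero hnear, enorm_zero]
    exact zero_le

lemma enorm_pairSymbol_le (j : ℕ) {p : ℤ × ℤ} (h₁ : p.1 ≠ 0) (h₂ : p.2 ≠ 0)
    (h₃ : -p.1 - p.2 ≠ 0) :
    ‖pairSymbol (tentSymbol j) p‖ₑ ≤ symbolBound (fun i => 2 ^ i.2.2) j (blockIndex p) := by
  refine enorm_le_symbolBound h₁ h₂ h₃ ?_ fun hfar => ?_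
  · have hthird := abs_le_two_mul_two_pow_log (-p.1 - p.2)
    rw [show ((-p.1 - p.2 : ℤ) : ℝ) = -((p.1 : ℝ) + p.2) by push_cast; ring, abs_neg] at hthird
    rw [pairSymbol, abs_div, abs_two, blockIndex]
    linarith [abs_tentSymbol_add_le j p.1 p.2]
  · obtain ⟨hz₁, hz₂, -⟩ := tentSymbol_eq_zero_of_not_nearAny hfar
    rw [pairSymbol, hz₁, hz₂, add_zero, zero_div]

lemma abs_tripleSymbol_tentSymbol_le (j : ℕ) (p : ℤ × ℤ) :
    |tripleSymbol (tentSymbol j) p| ≤ 9 * 2 ^ bot (blockIndex p) := by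
  have hrotate (k l m : ℤ) (hsum : k + l + m = 0) (n : ℕ) (hn : n = Nat.log 2 m.natAbs) :
      |(tentSymbol j k + tentSymbol j l + tentSymbol j m) / 3| ≤ 9 * 2 ^ n := by
    have hpos : (0 : ℝ) < 2 ^ n := by positivity
    have hm := abs_le_two_mul_two_pow_log m
    rw [← hn] at hm
    rw [abs_div, abs_of_pos (by norm_num : (0 : ℝ) < 3)]
    linarith [abs_tentSymbol_sum_le j hsum]
  have hcase : bot (blockIndex p) = Nat.log 2 (-p.1 - p.2).natAbs ∨
      bot (blockIndex p) = Nat.log 2 p.2.natAbs ∨ bot (blockIndex p) = Nat.log 2 p.1.natAbs := by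
    simp only [bot, blockIndex]
    omega
  unfold tripleSymbol
  rcases hcase with hthird | hsecond | hfirst
  · exact hrotate _ _ _ (by ring) _ hthird
  · rw [add_right_comm]
    exact hrotate _ _ _ (by ring) _ hsecond
  · rw [add_assoc, add_comm]
    exact hrotate _ _ _ (by ring) _ hfirst

lemma enorm_tripleSymbol_le (j : ℕ) {p : ℤ × ℤ} (h₁ : p.1 ≠ 0) (h₂ : p.2 ≠ 0)
    (h₃ : -p.1 - p.2 ≠ 0) :
    ‖tripleSymbol (tentSymbol j) p‖ₑ ≤ symbolBound (fun i => 2 ^ bot i) j (blockIndex p) := by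
  refine enorm_le_symbolBound h₁ h₂ h₃ (abs_tripleSymbol_tentSymbol_le j p) fun hfar => ?_
  obtain ⟨hz₁, hz₂, hz₃⟩ := tentSymbol_eq_zero_of_not_nearAny hfar
  rw [tripleSymbol, hz₁, hz₂, hz₃, add_zero, add_zero, zero_div]

lemma symbolBound_ne_top {μ : ℕ × ℕ × ℕ → ℝ≥0∞} (hμ : ∀ i, μ i ≠ ⊤) (j : ℕ) (i : ℕ × ℕ × ℕ) :
    symbolBound μ j i ≠ ⊤ := by
  unfold symbolBound
  split_ifs
  · exact ENNReal.mul_ne_top (by norm_num) (hμ i)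
  · exact ENNReal.zero_ne_top

/-! ### The energy norm and its relatives -/

lemma enorm_projBlock_sq (j : ℕ) (f : Torus → ℝ) :
    ‖projBlock j f‖ₑ ^ 2 = ∑ k ∈ block j, ‖fhat f k‖ₑ ^ 2 := by
  have hnorm : ‖projBlock j f‖ ^ 2 = ∑ k ∈ block j, ‖fhat f k‖ ^ 2 := by
    have hinner := (orthonormal_fourier (T := 2 * π)).inner_sum (fhat f) (fhat f) (block j)
    change inner ℂ (projBlock j f) (projBlock j f) = _ at hinner
    simp_rw [inner_self_eq_norm_sq_to_K, RCLike.conj_mul] at hinner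
    exact_mod_cast hinner
  simp_rw [← ofReal_norm, ← ENNReal.ofReal_pow (norm_nonneg _)]
  rw [← ENNReal.ofReal_sum_of_nonneg fun _ _ => by positivity, hnorm]

/-- The `L²` energy of `f` weighted by `tent j`, that is, at frequencies of size about `2 ^ j`. -/
noncomputable def tentEnergy (j : ℕ) (f : Torus → ℝ) : ℝ≥0∞ :=
  ∑' k, ENNReal.ofReal (tent j k) * ‖fhat f k‖ₑ ^ 2

lemma tentEnergy_eq (j : ℕ) (f : Torus → ℝ) :
    tentEnergy j f = ENNReal.ofReal (∑ k ∈ tentSupport j, tent j k * ‖fhat f k‖ ^ 2) := by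
  rw [tentEnergy, tsum_eq_sum (s := tentSupport j), ENNReal.ofReal_sum_of_nonneg
    fun k _ => mul_nonneg (tent_nonneg j k) (by positivity)]
  · refine Finset.sum_congr rfl fun k _ => ?_
    rw [ENNReal.ofReal_mul (tent_nonneg j k), ENNReal.ofReal_pow (norm_nonneg _), ofReal_norm]
  · intro k hk
    rw [not_imp_comm.mp mem_tentSupport hk, ENNReal.ofReal_zero, zero_mul]

lemma enorm_projBlock_sq_le_tentEnergy (j : ℕ) {f : Torus → ℝ} (hf : fhat f 0 = 0) :
    ‖projBlock j f‖ₑ ^ 2 ≤ tentEnergy j f := by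
  rw [enorm_projBlock_sq, tentEnergy]
  refine le_trans (Finset.sum_le_sum fun k hk => ?_) (ENNReal.sum_le_tsum (block j))
  by_cases hk0 : k = 0
  · simp [hk0, hf]
  · rw [tent_of_mem_block hk hk0, ENNReal.ofReal_one, one_mul]

lemma dyadicWeight_log_le {σ : ℝ} (hσ : 0 ≤ σ) {k : ℤ} (hk : k ≠ 0) :
    dyadicWeight (2 * σ) (Nat.log 2 k.natAbs) ≤ ENNReal.ofReal ((1 + (k : ℝ) ^ 2) ^ σ) := by
  rw [dyadicWeight, ENNReal.rpow_mul, ← ENNReal.ofReal_rpow_of_pos (by positivity)]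
  refine ENNReal.rpow_le_rpow ?_ hσ
  have hlog : (2 : ℝ) ^ Nat.log 2 k.natAbs ≤ |(k : ℝ)| := by
    rw [← Int.cast_abs, Int.abs_eq_natAbs]
    exact_mod_cast Nat.pow_log_le_self 2 (Int.natAbs_ne_zero.mpr hk)
  have hsq : ((2 : ℝ) ^ Nat.log 2 k.natAbs) ^ 2 ≤ 1 + (k : ℝ) ^ 2 := by
    rw [← sq_abs (k : ℝ)]
    linarith [pow_le_pow_left₀ (by positivity) hlog 2]
  refine le_trans (le_of_eq ?_) (ENNReal.ofReal_le_ofReal hsq)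
  rw [ENNReal.ofReal_pow (by positivity), ENNReal.ofReal_pow (by norm_num), ENNReal.ofReal_ofNat,
    ENNReal.rpow_ofNat]

lemma tsum_dyadicWeight_mul_tent_le {σ : ℝ} (hσ : 0 ≤ σ) (k : ℤ) :
    ∑' j, dyadicWeight (2 * σ) j * ENNReal.ofReal (tent j k) ≤
      3 * 2 ^ (2 * σ) * ENNReal.ofReal ((1 + (k : ℝ) ^ 2) ^ σ) := by
  have h2σ : 0 ≤ 2 * σ := by positivity
  obtain rfl | hk := eq_or_ne k 0
  · simp [tent_zero]
  calc ∑' j, dyadicWeight (2 * σ) j * ENNReal.ofReal (tent j k)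
      ≤ ∑' j, if Near j (Nat.log 2 k.natAbs) then dyadicWeight (2 * σ) j else 0 := by
        refine ENNReal.tsum_le_tsum fun j => ?_
        by_cases hj : tent j k = 0
        · rw [hj, ENNReal.ofReal_zero, mul_zero]
          exact zero_le
        · rw [if_pos (near_of_tent_ne_zero hj)]
          exact mul_le_of_le_one_right' (ENNReal.ofReal_le_one.mpr (tent_le_one j k))
    _ ≤ 3 * dyadicWeight (2 * σ) (Nat.log 2 k.natAbs + 1) :=
        tsum_near_le _ fun _ hj => dyadicWeight_mono h2σ hj.1
    _ ≤ _ := by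
        rw [dyadicWeight_succ h2σ, ← mul_assoc]
        gcongr
        exact dyadicWeight_log_le hσ hk

lemma tsum_tentEnergy_le {σ : ℝ} (hσ : 0 ≤ σ) (f : Torus → ℝ) :
    ∑' j, dyadicWeight (2 * σ) j * tentEnergy j f ≤ 3 * 2 ^ (2 * σ) * HNorm σ f ^ 2 := by
  rw [HNorm, rpow_half_sq]
  simp_rw [tentEnergy, ← ENNReal.tsum_mul_left]
  rw [ENNReal.tsum_comm]
  refine ENNReal.tsum_le_tsum fun k => ?_
  simp_rw [← mul_assoc]
  rw [ENNReal.tsum_mul_right]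
  gcongr
  exact tsum_dyadicWeight_mul_tent_le hσ k

lemma HNorm_zero_sq_le {f : Torus → ℝ} (hf : Continuous f) : HNorm 0 f ^ 2 ≤ L2Norm f ^ 2 := by
  set g : C(Torus, ℂ) := ⟨fun x => (f x : ℂ), by fun_prop⟩
  set φ : L2Torus := ContinuousMap.toLp 2 AddCircle.haarAddCircle ℂ g
  have hcoef (k : ℤ) : coef k φ = fhat f k := by
    have hrepr := fourierBasis_repr φ k
    rw [fourierCoeff_toLp, HilbertBasis.repr_apply_apply, coe_fourierBasis] at hrepr
    exact hrepr
  have hnorm : ‖φ‖ₑ = L2Norm f := by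
    rw [Lp.enorm_def, L2Norm, eLpNorm_congr_ae (ContinuousMap.coeFn_toLp _ g)]
    exact eLpNorm_congr_norm_ae (Filter.Eventually.of_forall fun x => by simp [g])
  rw [HNorm, rpow_half_sq, ← hnorm, ENNReal.tsum_eq_iSup_sum]
  refine iSup_le fun S => le_trans (le_of_eq ?_) (sum_enorm_coef_sq_le S φ)
  exact Finset.sum_congr rfl fun k _ => by simp [hcoef]

lemma ell2_blockNorm_le (σ T : ℝ) (u : ℝ → Torus → ℝ) :
    ell2 (fun j => dyadicWeight σ j * blockNorm T u j) ≤ FNorm σ T u := by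
  refine ENNReal.rpow_le_rpow (ENNReal.tsum_le_tsum fun j => ?_) (by norm_num)
  rw [mul_pow, sq (dyadicWeight σ j), ← dyadicWeight_add, ← two_mul]
  change dyadicWeight (2 * σ) j * _ ≤ dyadicWeight (2 * σ) j * _
  gcongr
  rw [← rpow_half_sq (⨆ (a : ℝ), _), ENNReal.pow_le_pow_left_iff two_ne_zero]
  refine iSup_le fun a => iSup₂_le fun ha ha' => ?_
  rw [← ENNReal.pow_le_pow_left_iff two_ne_zero, rpow_half_sq]
  exact le_iSup₂_of_le a ha (le_iSup (fun _ => u2Norm a (a + windowLength T j)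
    (fun t => profileBlock j t (u t)) ^ 2) ha')

lemma ell2_blockNorm_le_FNorm_zero (T : ℝ) (u : ℝ → Torus → ℝ) :
    ell2 (blockNorm T u) ≤ FNorm 0 T u := by
  simpa only [dyadicWeight_zero, one_mul] using ell2_blockNorm_le 0 T u

/-! ### Energy transfer -/

/-- A bound for the energy transferred into block `j` by `v v z`, when the symbol has size `2 ^ n`
on each triple of blocks that interacts with block `j`. -/
noncomputable def transferBound (n : ℕ × ℕ × ℕ → ℕ) (T : ℝ) (v z : ℝ → Torus → ℝ) (j : ℕ) :
    ℝ≥0∞ :=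
  trilinConst * ∑' i : ℕ × ℕ × ℕ, symbolBound (fun i => 2 ^ n i) j i *
    (blockNorm T v i.1 * blockNorm T v i.2.1 * blockNorm T z i.2.2)

/-- The constant of the energy transfer through a coefficient. -/
noncomputable def pairConst (σ s : ℝ) : ℝ≥0∞ :=
  trilinConst * (81 * (6 * (2 ^ σ) ^ 4 * dyadicSum (s - 1)))

/-- The constant of the self-interaction. -/
noncomputable def tripleConst (s : ℝ) : ℝ≥0∞ :=
  trilinConst * (81 * (9 * (2 ^ s) ^ 4 * dyadicSum (s - 1)))

section Transfer

variable {T σ s : ℝ} {v z : ℝ → Torus → ℝ} {w : ℝ → ℤ → ℂ}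

lemma trilinConst_ne_top : trilinConst ≠ ⊤ := by
  unfold trilinConst
  finiteness

lemma pairConst_ne_top (hσ : 0 ≤ σ) (hs : 1 < s) : pairConst σ s ≠ ⊤ := by
  have hsum := dyadicSum_ne_top (sub_pos.mpr hs)
  have htrilin := trilinConst_ne_top
  have hpow : (2 : ℝ≥0∞) ^ σ ≠ ⊤ := ENNReal.rpow_ne_top_of_nonneg hσ (by norm_num)
  unfold pairConst
  finiteness

lemma tripleConst_ne_top (hs : 1 < s) : tripleConst s ≠ ⊤ := by
  have hsum := dyadicSum_ne_top (sub_pos.mpr hs)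
  have htrilin := trilinConst_ne_top
  have hpow : (2 : ℝ≥0∞) ^ s ≠ ⊤ := ENNReal.rpow_ne_top_of_nonneg (by linarith) (by norm_num)
  unfold tripleConst
  finiteness

theorem enorm_integratedForm_pair_le (hT : 0 < T) (hT1 : T ≤ 1)
    (hv : RegularCoeffs T fun t => fhat (v t)) (hz : RegularCoeffs T fun t => fhat (z t)) {t₀ : ℝ}
    (ht₀ : t₀ ∈ Icc 0 T) (j : ℕ) :
    ‖integratedForm (fun p => tentSymbol j p.1) (fun t => fhat (v t)) (fun t => fhat (v t))
      (fun t => fhat (z t)) t₀‖ₑ ≤ transferBound (fun i => i.2.2) T v z j := by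
  rw [← integratedForm_pairSymbol hv hz ht₀ (abs_tentSymbol_le_two_pow j)]
  exact enorm_integratedForm_le hT hT1 hv hv hz (abs_pairSymbol_le (abs_tentSymbol_le_two_pow j))
    (symbolBound_ne_top (fun i => by finiteness) j) (fun p => enorm_pairSymbol_le j) ht₀

theorem enorm_integratedForm_triple_le (hT : 0 < T) (hT1 : T ≤ 1)
    (hv : RegularCoeffs T fun t => fhat (v t)) {t₀ : ℝ} (ht₀ : t₀ ∈ Icc 0 T) (j : ℕ) :
    ‖integratedForm (fun p => tentSymbol j p.1) (fun t => fhat (v t)) (fun t => fhat (v t))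
      (fun t => fhat (v t)) t₀‖ₑ ≤ transferBound bot T v v j := by
  rw [← integratedForm_tripleSymbol hv ht₀ (abs_tentSymbol_le_two_pow j)]
  exact enorm_integratedForm_le hT hT1 hv hv hv (abs_tripleSymbol_le (abs_tentSymbol_le_two_pow j))
    (symbolBound_ne_top (fun i => by finiteness) j) (fun p => enorm_tripleSymbol_le j) ht₀

lemma tsum_transferBound_le (hσ : 0 ≤ σ) (n : ℕ × ℕ × ℕ → ℕ) (T : ℝ) (v z : ℝ → Torus → ℝ) :
    ∑' j, dyadicWeight (2 * σ) j * transferBound n T v z j ≤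
      trilinConst * (81 * ∑' i, if Admissible i then dyadicWeight (2 * σ) (top i + 1) * 2 ^ n i *
        (blockNorm T v i.1 * blockNorm T v i.2.1 * blockNorm T z i.2.2) else 0) := by
  simp_rw [transferBound, mul_left_comm (dyadicWeight _ _) trilinConst]
  rw [ENNReal.tsum_mul_left]
  gcongr
  exact tsum_tsum_symbolBound_le hσ _ _

lemma tsum_transferBound_third_le (hσ : 0 ≤ σ) (hs : 1 ≤ s) (T : ℝ) (v z : ℝ → Torus → ℝ) :
    ∑' j, dyadicWeight (2 * σ) j * transferBound (fun i => i.2.2) T v z j ≤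
      pairConst σ s * (FNorm σ T v ^ 2 * FNorm s T z +
        FNorm 0 T v * FNorm σ T v * FNorm (σ + s) T z) := by
  refine (tsum_transferBound_le hσ _ T v z).trans ?_
  rw [pairConst, mul_assoc, mul_assoc 81]
  gcongr
  refine (tsum_admissible_third_le hσ hs _ _).trans ?_
  gcongr <;> first | exact ell2_blockNorm_le _ _ _ | exact ell2_blockNorm_le_FNorm_zero _ _

lemma tsum_transferBound_bot_le (hs : 0 ≤ s) (T : ℝ) (v : ℝ → Torus → ℝ) :
    ∑' j, dyadicWeight (2 * s) j * transferBound bot T v v j ≤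
      tripleConst s * FNorm s T v ^ 3 := by
  refine (tsum_transferBound_le hs _ T v v).trans ?_
  rw [tripleConst, mul_assoc, mul_assoc 81]
  gcongr
  refine (tsum_admissible_bot_le hs _).trans ?_
  gcongr
  exact ell2_blockNorm_le _ _ _

theorem ENorm_sq_le (hσ : 0 ≤ σ) (hd : SolvesTransport T (fun t => fhat (v t)) w)
    (hv : RegularCoeffs T fun t => fhat (v t)) (hw : RegularCoeffs T w) {R : ℕ → ℝ≥0∞}
    (hR : ∀ j, ∀ t₀ ∈ Icc 0 T, ‖integratedForm (fun p => tentSymbol j p.1)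
      (fun t => fhat (v t)) (fun t => fhat (v t)) w t₀‖ₑ ≤ R j) :
    ENorm σ T v ^ 2 ≤
      3 * 2 ^ (2 * σ) * HNorm σ (v 0) ^ 2 + ∑' j, dyadicWeight (2 * σ) j * R j := by
  rw [ENorm, rpow_half_sq]
  refine le_trans ?_ (add_le_add_left (tsum_tentEnergy_le hσ (v 0)) _)
  rw [← ENNReal.tsum_add]
  refine ENNReal.tsum_le_tsum fun j => ?_
  rw [← mul_add]
  change dyadicWeight (2 * σ) j * _ ≤ _
  gcongr
  refine iSup₂_le fun t₀ ht₀ => (enorm_projBlock_sq_le_tentEnergy j (hv.zero t₀ ht₀)).trans ?_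
  refine le_trans ?_ (add_le_add_right (hR j t₀ ht₀) _)
  rw [tentEnergy_eq, tentEnergy_eq, ← ofReal_norm, ← ENNReal.ofReal_add
    (Finset.sum_nonneg fun k _ => mul_nonneg (tent_nonneg j k) (by positivity)) (norm_nonneg _)]
  exact ENNReal.ofReal_le_ofReal (hd.sum_norm_sq_le hv hw (tent_neg j) (fun k => mem_tentSupport)
    (abs_tentSymbol_le_two_pow j) ht₀)

lemma enorm_integratedForm_add_le {a c d : ℝ → ℤ → ℂ} {t₀ : ℝ} (ha : RegularCoeffs T a)
    (hc : RegularCoeffs T c) (hd : RegularCoeffs T d) (ht₀ : t₀ ∈ Icc 0 T) (j : ℕ) {x y : ℝ≥0∞}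
    (hx : ‖integratedForm (fun p => tentSymbol j p.1) a a c t₀‖ₑ ≤ x)
    (hy : ‖integratedForm (fun p => tentSymbol j p.1) a a d t₀‖ₑ ≤ y) :
    ‖integratedForm (fun p => tentSymbol j p.1) a a (fun t k => c t k + d t k) t₀‖ₑ ≤ x + y := by
  rw [integratedForm_add ha ha hc hd ht₀ fun p => abs_tentSymbol_le_two_pow j _]
  exact (enorm_add_le _ _).trans (add_le_add hx hy)

end Transfer

/-! ### Differences of solutions -/

section Difference

variable {T s : ℝ} {u₁ u₂ : ℝ → Torus → ℝ}

lemma fhat_difference (hu₁ : IsSmoothSolution T u₁) (hu₂ : IsSmoothSolution T u₂) {t : ℝ}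
    (ht : t ∈ Icc 0 T) (k : ℤ) :
    fhat ((u₁ - u₂) t) k = fhat (u₁ t) k - fhat (u₂ t) k :=
  fhat_sub (hu₁.continuous_slice ht) (hu₂.continuous_slice ht) k

lemma regularCoeffs_difference (hT : 0 < T) (hu₁ : IsSmoothSolution T u₁)
    (hu₂ : IsSmoothSolution T u₂) : RegularCoeffs T fun t => fhat ((u₁ - u₂) t) where
  continuousOn k := (((hu₁.regularCoeffs hT).sub (hu₂.regularCoeffs hT)).continuousOn k).congr
    fun _ ht => fhat_difference hu₁ hu₂ ht k
  decay := by
    obtain ⟨D, hD0, hD⟩ := ((hu₁.regularCoeffs hT).sub (hu₂.regularCoeffs hT)).decay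
    refine ⟨D, hD0, fun t ht k => ?_⟩
    rw [fhat_difference hu₁ hu₂ ht]
    exact hD t ht k
  conj _ _ := fhat_neg _ _
  zero t ht := by
    rw [fhat_difference hu₁ hu₂ ht, hu₁.fhat_zero hT ht, hu₂.fhat_zero hT ht, sub_zero]

lemma tsum_fhat_sub_mul_add {f g : Torus → ℝ} (hf : Continuous f) (hg : Continuous g)
    (hf' : Summable fun n => ‖fhat f n‖) (hg' : Summable fun n => ‖fhat g n‖) (k : ℤ) :
    ∑' n, (fhat f n - fhat g n) * (fhat f (k - n) + fhat g (k - n)) =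
      ∑' n, fhat f n * fhat f (k - n) - ∑' n, fhat g n * fhat g (k - n) := by
  have hff := hasSum_fhat_mul hf hf hf' k
  have hfg := hasSum_fhat_mul hf hg hf' k
  have hgf := hasSum_fhat_mul hg hf hg' k
  have hgg := hasSum_fhat_mul hg hg hg' k
  simp_rw [mul_comm (g _)] at hgf
  rw [hff.tsum_eq, hgg.tsum_eq, ← add_sub_add_right_eq_sub _ _ (fhat (fun x => f x * g x) k),
    add_comm (fhat (fun x => g x * g x) k), ← ((hff.add hfg).sub (hgf.add hgg)).tsum_eq]
  refine tsum_congr fun n => ?_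
  ring

/-- As `u₁ ∂ₓu₁ - u₂ ∂ₓu₂ = ∂ₓ(v (u₁ + u₂)) / 2`, the difference `v` is transported by
`u₁ + u₂`. -/
lemma solvesTransport_difference (hT : 0 < T) (hu₁ : IsSmoothSolution T u₁)
    (hu₂ : IsSmoothSolution T u₂) :
    SolvesTransport T (fun t => fhat ((u₁ - u₂) t)) fun t k => fhat (u₁ t) k + fhat (u₂ t) k := by
  intro t ht k
  have ht' := Ioo_subset_Icc_self ht
  have hderiv := (hu₁.solvesTransport hT t ht k).sub (hu₂.solvesTransport hT t ht k)
  refine (hderiv.congr_of_eventuallyEq ?_).congr_deriv ?_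
  · filter_upwards [Ioo_mem_nhds ht.1 ht.2] with τ hτ
    exact fhat_difference hu₁ hu₂ (Ioo_subset_Icc_self hτ) k
  · simp_rw [fhat_difference hu₁ hu₂ ht']
    rw [tsum_fhat_sub_mul_add (hu₁.continuous_slice ht') (hu₂.continuous_slice ht')
      (hu₁.summable_fhat ht') (hu₂.summable_fhat ht')]
    ring

/-- Here the coefficient is written as `u₁ + u₂ = v + u₂ + u₂`, so that no norm of `u₁` enters. -/
lemma solvesTransport_difference' (hT : 0 < T) (hu₁ : IsSmoothSolution T u₁)
    (hu₂ : IsSmoothSolution T u₂) :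
    SolvesTransport T (fun t => fhat ((u₁ - u₂) t)) fun t k =>
      fhat ((u₁ - u₂) t) k + fhat (u₂ t) k + fhat (u₂ t) k := by
  intro t ht k
  refine (solvesTransport_difference hT hu₁ hu₂ t ht k).congr_deriv ?_
  have hcoeff (l : ℤ) : fhat ((u₁ - u₂) t) l + fhat (u₂ t) l = fhat (u₁ t) l := by
    rw [fhat_difference hu₁ hu₂ (Ioo_subset_Icc_self ht), sub_add_cancel]
  simp_rw [hcoeff]

theorem ENorm_zero_difference_le (hs : 1 ≤ s) (hT : 0 < T) (hT1 : T ≤ 1)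
    (hu₁ : IsSmoothSolution T u₁) (hu₂ : IsSmoothSolution T u₂) :
    ENorm 0 T (u₁ - u₂) ^ 2 ≤ 3 * L2Norm ((u₁ - u₂) 0) ^ 2 + 2 * pairConst 0 s *
      (FNorm 0 T (u₁ - u₂) ^ 2 * (FNorm s T u₁ + FNorm s T u₂)) := by
  have hv := regularCoeffs_difference hT hu₁ hu₂
  have hc₁ := hu₁.regularCoeffs hT
  have hc₂ := hu₂.regularCoeffs hT
  have h0 : (0 : ℝ) ∈ Icc 0 T := ⟨le_rfl, hT.le⟩
  have hinitial := HNorm_zero_sq_le ((hu₁.continuous_slice h0).sub (hu₂.continuous_slice h0))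
  have henergy := ENorm_sq_le le_rfl (solvesTransport_difference hT hu₁ hu₂) hv (hc₁.add hc₂)
    fun j t₀ ht₀ => enorm_integratedForm_add_le hv hc₁ hc₂ ht₀ j
      (enorm_integratedForm_pair_le hT hT1 hv hc₁ ht₀ j)
      (enorm_integratedForm_pair_le hT hT1 hv hc₂ ht₀ j)
  have htransfer := add_le_add (tsum_transferBound_third_le le_rfl hs T (u₁ - u₂) u₁)
    (tsum_transferBound_third_le le_rfl hs T (u₁ - u₂) u₂)
  simp_rw [mul_add (dyadicWeight _ _), ENNReal.tsum_add] at henergy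
  refine (henergy.trans (add_le_add (mul_le_mul_right hinitial _) htransfer)).trans (le_of_eq ?_)
  rw [zero_add, mul_zero, ENNReal.rpow_zero, Pi.sub_apply]
  ring

theorem ENorm_difference_le (hs : 1 ≤ s) (hT : 0 < T) (hT1 : T ≤ 1)
    (hu₁ : IsSmoothSolution T u₁) (hu₂ : IsSmoothSolution T u₂) :
    ENorm s T (u₁ - u₂) ^ 2 ≤ 3 * 2 ^ (2 * s) * HNorm s ((u₁ - u₂) 0) ^ 2 +
      (tripleConst s * FNorm s T (u₁ - u₂) ^ 3 + 2 * pairConst s s *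
        (FNorm s T (u₁ - u₂) ^ 2 * FNorm s T u₂ +
          FNorm 0 T (u₁ - u₂) * FNorm s T (u₁ - u₂) * FNorm (2 * s) T u₂)) := by
  have hs0 : 0 ≤ s := by linarith
  have hv := regularCoeffs_difference hT hu₁ hu₂
  have hc₂ := hu₂.regularCoeffs hT
  have henergy := ENorm_sq_le hs0 (solvesTransport_difference' hT hu₁ hu₂) hv
    ((hv.add hc₂).add hc₂) fun j t₀ ht₀ =>
      enorm_integratedForm_add_le hv (hv.add hc₂) hc₂ ht₀ j
        (enorm_integratedForm_add_le hv hv hc₂ ht₀ j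
          (enorm_integratedForm_triple_le hT hT1 hv ht₀ j)
          (enorm_integratedForm_pair_le hT hT1 hv hc₂ ht₀ j))
        (enorm_integratedForm_pair_le hT hT1 hv hc₂ ht₀ j)
  simp_rw [mul_add (dyadicWeight _ _)] at henergy
  rw [ENNReal.tsum_add, ENNReal.tsum_add] at henergy
  have hpair := tsum_transferBound_third_le hs0 hs T (u₁ - u₂) u₂
  rw [← two_mul s] at hpair
  refine henergy.trans ?_
  rw [two_mul (pairConst s s), add_mul, ← add_assoc (tripleConst s * _)]
  gcongr
  exact tsum_transferBound_bot_le hs0 T _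

end Difference

/-! ### The zero solution -/

lemma fhat_zero_fun (k : ℤ) : fhat 0 k = 0 := by
  simp [fhat, fourierCoeff]

lemma isSmoothSolution_zero (T : ℝ) : IsSmoothSolution T 0 where
  smooth := contDiffOn_const
  equation t _ x := by
    have hdx : dx (0 : Torus → ℝ) = 0 := funext fun x => by simp [dx]
    simp [hdx, hilbertTransform, fhat_zero_fun]
  mean_zero := by simp

lemma u2Norm_zero {a b : ℝ} (hab : a < b) : u2Norm a b (fun _ => (0 : L2Torus)) = 0 := by
  have hatom : IsU2Atom a b ((Ico a b).indicator fun _ => (fourierLp 2 0 : L2Torus)) := by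
    refine ⟨1, ![a, b], fun _ => fourierLp 2 0, ?_, rfl, rfl, ?_, fun t => by simp⟩
    · intro i j hij
      fin_cases i <;> fin_cases j <;> simp_all
    · simp [(orthonormal_fourier (T := 2 * π)).1 0]
  refine le_antisymm ?_ zero_le
  refine (iInf₂_le (fun _ => 0) fun _ => (Ico a b).indicator fun _ => fourierLp 2 0).trans ?_
  exact (iInf₂_le (fun _ => hatom) fun t _ => by simp).trans (by simp)

lemma FNorm_zero_fun {T : ℝ} (hT : 0 < T) (σ : ℝ) : FNorm σ T 0 = 0 := by
  have hprofile (j : ℕ) (t : ℝ) : profileBlock j t 0 = 0 := by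
    simp [profileBlock, fhat_zero_fun]
  have hwindow (j : ℕ) (a : ℝ) : u2Norm a (a + windowLength T j) (fun _ => (0 : L2Torus)) = 0 :=
    u2Norm_zero (lt_add_of_pos_right a (windowLength_pos hT j))
  simp [FNorm, hprofile, hwindow]

/-! ### The energy estimates with a common constant -/

/-- The constant `C(s)` of the energy estimates. -/
noncomputable def energyConst (s : ℝ) : ℝ≥0∞ :=
  3 * 2 ^ (2 * s) + 3 + 2 * pairConst 0 s + 2 * pairConst s s + tripleConst s

section EnergyConst

variable {T s : ℝ} {u u₁ u₂ : ℝ → Torus → ℝ}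

lemma energyConst_ne_top (hs : 1 < s) : energyConst s ≠ ⊤ := by
  have hs0 : 0 ≤ s := by linarith
  have hpair₀ := pairConst_ne_top le_rfl hs
  have hpair := pairConst_ne_top hs0 hs
  have htriple := tripleConst_ne_top hs
  have hpow : (2 : ℝ≥0∞) ^ (2 * s) ≠ ⊤ := ENNReal.rpow_ne_top_of_nonneg (by positivity) (by simp)
  unfold energyConst
  finiteness

theorem ENorm_zero_difference_le_energyConst (hs : 1 ≤ s) (hT : 0 < T) (hT1 : T ≤ 1)
    (hu₁ : IsSmoothSolution T u₁) (hu₂ : IsSmoothSolution T u₂) :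
    ENorm 0 T (u₁ - u₂) ^ 2 ≤ energyConst s * (L2Norm ((u₁ - u₂) 0) ^ 2 +
      FNorm 0 T (u₁ - u₂) ^ 2 * (FNorm s T u₁ + FNorm s T u₂)) := by
  have hinitial : 3 ≤ energyConst s :=
    (le_add_self.trans le_self_add).trans (le_self_add.trans le_self_add)
  have hpair : 2 * pairConst 0 s ≤ energyConst s :=
    le_add_self.trans (le_self_add.trans le_self_add)
  rw [mul_add]
  refine (ENorm_zero_difference_le hs hT hT1 hu₁ hu₂).trans ?_
  gcongr

theorem ENorm_difference_le_energyConst (hs : 1 ≤ s) (hT : 0 < T) (hT1 : T ≤ 1)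
    (hu₁ : IsSmoothSolution T u₁) (hu₂ : IsSmoothSolution T u₂) :
    ENorm s T (u₁ - u₂) ^ 2 ≤
      energyConst s * (HNorm s ((u₁ - u₂) 0) ^ 2 + FNorm s T (u₁ - u₂) ^ 3 +
        FNorm s T (u₁ - u₂) ^ 2 * FNorm s T u₂ +
        FNorm 0 T (u₁ - u₂) * FNorm s T (u₁ - u₂) * FNorm (2 * s) T u₂) := by
  have hinitial : 3 * 2 ^ (2 * s) ≤ energyConst s :=
    (le_self_add.trans le_self_add).trans (le_self_add.trans le_self_add)
  have hpair : 2 * pairConst s s ≤ energyConst s := le_add_self.trans le_self_add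
  have htriple : tripleConst s ≤ energyConst s := le_add_self
  rw [add_assoc, add_assoc, mul_add, mul_add]
  refine (ENorm_difference_le hs hT hT1 hu₁ hu₂).trans ?_
  gcongr

theorem ENorm_le_energyConst (hs : 1 ≤ s) (hT : 0 < T) (hT1 : T ≤ 1) (hu : IsSmoothSolution T u) :
    ENorm s T u ^ 2 ≤ energyConst s * (HNorm s (u 0) ^ 2 + FNorm s T u ^ 3) := by
  simpa only [sub_zero, FNorm_zero_fun hT, mul_zero, add_zero] using
    ENorm_difference_le_energyConst hs hT hT1 hu (isSmoothSolution_zero T)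

end EnergyConst

end BenjaminOno

theorem mainTheorem7 (s : ℝ) (hs : 1 < s) :
    ∃ C : ℝ≥0, ∀ T : ℝ, 0 < T → T ≤ 1 →
      (∀ u : ℝ → BenjaminOno.Torus → ℝ, BenjaminOno.IsSmoothSolution T u →
        BenjaminOno.ENorm s T u ^ 2 ≤
          C * (BenjaminOno.HNorm s (u 0) ^ 2 + BenjaminOno.FNorm s T u ^ 3)) ∧
      (∀ u₁ u₂ v : ℝ → BenjaminOno.Torus → ℝ,
        BenjaminOno.IsSmoothSolution T u₁ → BenjaminOno.IsSmoothSolution T u₂ → v = u₁ - u₂ →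
          BenjaminOno.ENorm 0 T v ^ 2 ≤
            C * (BenjaminOno.L2Norm (v 0) ^ 2 +
              BenjaminOno.FNorm 0 T v ^ 2 *
                (BenjaminOno.FNorm s T u₁ + BenjaminOno.FNorm s T u₂)) ∧
          BenjaminOno.ENorm s T v ^ 2 ≤
            C * (BenjaminOno.HNorm s (v 0) ^ 2 + BenjaminOno.FNorm s T v ^ 3 +
              BenjaminOno.FNorm s T v ^ 2 * BenjaminOno.FNorm s T u₂ +
              BenjaminOno.FNorm 0 T v * BenjaminOno.FNorm s T v *
                BenjaminOno.FNorm (2 * s) T u₂)) := by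
  refine ⟨(BenjaminOno.energyConst s).toNNReal, fun T hT hT1 => ?_⟩
  rw [ENNReal.coe_toNNReal (BenjaminOno.energyConst_ne_top hs)]
  refine ⟨fun u hu => BenjaminOno.ENorm_le_energyConst hs.le hT hT1 hu, ?_⟩
  rintro u₁ u₂ v hu₁ hu₂ rfl
  exact ⟨BenjaminOno.ENorm_zero_difference_le_energyConst hs.le hT hT1 hu₁ hu₂,
    BenjaminOno.ENorm_difference_le_energyConst hs.le hT hT1 hu₁ hu₂⟩
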